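/- Let $R\subseteq\mathbb N$ be computably enumerable but not computable, and let $p_0=2,\ p_1=3,\ p_2=5,\dots$ be the primes in increasing order. For $k\in\mathbb N$ let $\mathcal O_k$ be the Cuntz algebra, that is, the universal unital $\mathrm{C}^*$-algebra generated by elements $s_1,\dots,s_k$ such that $s_i^*s_i=1$ for every $i$ and $\sum_{i=1}^k s_is_i^*=1$. For $n\in\mathbb N$ put \[\mathbf B_n=\begin{cases}\mathbb C & n\in R,\\ \mathcal O_{p_n+1} & n\notin R,\end{cases}\] and let $\mathbf B=\bigoplus_{n\in\mathbb N}\mathbf B_n$ be the $\mathrm{C}^*$-algebraic direct sum, consisting of the sequences $(b_n)_n$ with $b_n\in\mathbf B_n$ and $\|b_n\|\to 0$, with coordinatewise operations and the supremum norm. Then $\mathbf B$ has a computable presentation. That is, there is a sequence $(a_j)_{j\in\mathbb N}$ in $\mathbf B$ that generates $\mathbf B$ as a $\mathrm{C}^*$-algebra, together with an algorithm which, given $k\in\mathbb N$ and a noncommutative $*$-polynomial $\rho$ without constant term, in finitely many of the variables $x_0,x_1,\dots$, with coefficients in $\mathbb Q(i)$, returns a rational number $q$ with $\bigl|\,\|\rho(a_0,a_1,\dots)\|-q\,\bigr|<2^{-k}$.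 -/

import Mathlib

noncomputable section

open scoped ENNReal
open Filter Topology

namespace CompCStar

/-! ## The Cuntz algebras as universal C*-algebras -/

/-- The free unital `*`-algebra over `ℂ` on the symbols `s 0, …, s (k - 1)`: the free algebra on the
symbols `(i, false)`, standing for `s i`, and `(i, true)`, standing for `star (s i)`. -/
def FreeStarAlg (k : ℕ) : Type := FreeAlgebra ℂ (Fin k × Bool)

namespace FreeStarAlg

variable {k : ℕ}

instance : Ring (FreeStarAlg k) := inferInstanceAs (Ring (FreeAlgebra ℂ (Fin k × Bool)))

instance : Algebra ℂ (FreeStarAlg k) :=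
  inferInstanceAs (Algebra ℂ (FreeAlgebra ℂ (Fin k × Bool)))

/-- The symbol `(i, b)` as an element of the free `*`-algebra. -/
def letter (x : Fin k × Bool) : FreeStarAlg k := FreeAlgebra.ι ℂ x

/-- The free generator `s i`. -/
def gen (i : Fin k) : FreeStarAlg k := letter (i, false)

theorem induct {motive : FreeStarAlg k → Prop}
    (scalar : ∀ r : ℂ, motive (algebraMap ℂ (FreeStarAlg k) r))
    (lett : ∀ x, motive (letter x))
    (mul : ∀ a b, motive a → motive b → motive (a * b))
    (add : ∀ a b, motive a → motive b → motive (a + b))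
    (a : FreeStarAlg k) : motive a :=
  FreeAlgebra.induction (R := ℂ) (X := Fin k × Bool) (motive := motive) scalar lett mul add a

/-- The involution, as a ring homomorphism to the opposite ring: it conjugates scalars, exchanges
the two symbols `(i, false)` and `(i, true)`, and reverses products. -/
def starAux (k : ℕ) : FreeStarAlg k →+* (FreeStarAlg k)ᵐᵒᵖ :=
  letI : Algebra ℂ (FreeStarAlg k)ᵐᵒᵖ :=
    RingHom.toAlgebra' ((algebraMap ℂ (FreeStarAlg k)ᵐᵒᵖ).comp (starRingEnd ℂ))
      (fun c x => Algebra.commutes (starRingEnd ℂ c) x)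
  (FreeAlgebra.lift ℂ (fun x : Fin k × Bool => MulOpposite.op (letter (x.1, !x.2)))).toRingHom

theorem starAux_letter (x : Fin k × Bool) :
    starAux k (letter x) = MulOpposite.op (letter (x.1, !x.2)) := by
  let _ : Algebra ℂ (FreeStarAlg k)ᵐᵒᵖ :=
    RingHom.toAlgebra' ((algebraMap ℂ (FreeStarAlg k)ᵐᵒᵖ).comp (starRingEnd ℂ))
      (fun c x => Algebra.commutes (starRingEnd ℂ c) x)
  exact FreeAlgebra.lift_ι_apply (R := ℂ)
    (fun x : Fin k × Bool => MulOpposite.op (letter (x.1, !x.2))) x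

theorem starAux_algebraMap (r : ℂ) :
    starAux k (algebraMap ℂ _ r) =
      MulOpposite.op (algebraMap ℂ (FreeStarAlg k) (starRingEnd ℂ r)) := by
  let _ : Algebra ℂ (FreeStarAlg k)ᵐᵒᵖ :=
    RingHom.toAlgebra' ((algebraMap ℂ (FreeStarAlg k)ᵐᵒᵖ).comp (starRingEnd ℂ))
      (fun c x => Algebra.commutes (starRingEnd ℂ c) x)
  exact AlgHom.commutes (FreeAlgebra.lift ℂ
    (fun x : Fin k × Bool => MulOpposite.op (letter (x.1, !x.2)))) r

instance : StarRing (FreeStarAlg k) where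
  star x := (starAux k x).unop
  star_involutive x := by
    induction x using induct with
    | scalar r => simp [starAux_algebraMap]
    | lett x => simp [starAux_letter]
    | mul a b ha hb => simp only [map_mul, MulOpposite.unop_mul, ha, hb]
    | add a b ha hb => simp only [map_add, MulOpposite.unop_add, ha, hb]
  star_mul a b := by simp
  star_add a b := by simp

theorem star_letter (x : Fin k × Bool) : star (letter x) = letter (x.1, !x.2) := by
  change (starAux k (letter x)).unop = _
  rw [starAux_letter]; rfl

theorem star_algebraMap (r : ℂ) :
    star (algebraMap ℂ (FreeStarAlg k) r) = algebraMap ℂ _ (star r) := by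
  change (starAux k _).unop = _
  rw [starAux_algebraMap]; rfl

instance : StarModule ℂ (FreeStarAlg k) where
  star_smul r a := by
    rw [Algebra.smul_def, star_mul, star_algebraMap, Algebra.smul_def, Algebra.commutes]

end FreeStarAlg

/-- The Cuntz relations: `star (s i) * s i = 1` for every `i`, and `∑ i, s i * star (s i) = 1`. -/
structure CuntzRel {k : ℕ} {A : Type*} [Ring A] [StarRing A] (s : Fin k → A) : Prop where
  isometry : ∀ i, star (s i) * s i = 1
  sum_range : ∑ i, s i * star (s i) = 1

/-- C*-seminorms on the free `*`-algebra in which the Cuntz relations hold. -/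
structure IsCuntzSeminorm {k : ℕ} (N : RingSeminorm (FreeStarAlg k)) : Prop where
  smul : ∀ (c : ℂ) (x : FreeStarAlg k), N (c • x) = ‖c‖ * N x
  star_mul_self : ∀ x : FreeStarAlg k, N (star x * x) = N x * N x
  isometry : ∀ i : Fin k, N (star (FreeStarAlg.gen i) * FreeStarAlg.gen i - 1) = 0
  sum_range : N (∑ i : Fin k, FreeStarAlg.gen i * star (FreeStarAlg.gen i) - 1) = 0

namespace IsCuntzSeminorm

variable {k : ℕ} {N : RingSeminorm (FreeStarAlg k)}

theorem one_le (h : IsCuntzSeminorm N) : N 1 ≤ 1 := by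
  have := h.star_mul_self 1
  simp only [star_one, mul_one] at this
  nlinarith [apply_nonneg N 1]

theorem le_star (h : IsCuntzSeminorm N) (x : FreeStarAlg k) : N x ≤ N (star x) := by
  have h1 := h.star_mul_self x
  have h2 := map_mul_le_mul N (star x) x
  rcases (apply_nonneg N x).eq_or_lt with h0 | h0
  · rw [← h0]; exact apply_nonneg _ _
  · rw [h1] at h2; exact le_of_mul_le_mul_right h2 h0

theorem star_eq (h : IsCuntzSeminorm N) (x : FreeStarAlg k) : N (star x) = N x :=
  le_antisymm (by simpa using h.le_star (star x)) (h.le_star x)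

theorem gen_le (h : IsCuntzSeminorm N) (i : Fin k) : N (FreeStarAlg.gen i) ≤ 1 := by
  have h1 := h.star_mul_self (FreeStarAlg.gen i)
  have h2 := map_add_le_add N (star (FreeStarAlg.gen i) * FreeStarAlg.gen i - 1) 1
  rw [sub_add_cancel, h.isometry, h1] at h2
  nlinarith [apply_nonneg N (FreeStarAlg.gen i), h.one_le]

theorem letter_le (h : IsCuntzSeminorm N) (x : Fin k × Bool) : N (FreeStarAlg.letter x) ≤ 1 := by
  obtain ⟨i, b⟩ := x
  cases b with
  | false => exact h.gen_le i
  | true =>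
    have := FreeStarAlg.star_letter (k := k) (i, false)
    rw [show FreeStarAlg.letter (i, true) = star (FreeStarAlg.gen i) from this.symm, h.star_eq]
    exact h.gen_le i

end IsCuntzSeminorm

theorem exists_bound {k : ℕ} (x : FreeStarAlg k) :
    ∃ C : ℝ, ∀ N : RingSeminorm (FreeStarAlg k), IsCuntzSeminorm N → N x ≤ C := by
  induction x using FreeStarAlg.induct with
  | scalar r =>
    refine ⟨‖r‖, fun N h => ?_⟩
    rw [Algebra.algebraMap_eq_smul_one, h.smul]
    nlinarith [h.one_le, norm_nonneg r]
  | lett x => exact ⟨1, fun N h => h.letter_le x⟩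
  | mul a b ha hb =>
    obtain ⟨C, hC⟩ := ha
    obtain ⟨D, hD⟩ := hb
    refine ⟨C * D, fun N h => (map_mul_le_mul N a b).trans ?_⟩
    exact mul_le_mul (hC N h) (hD N h) (apply_nonneg _ _) ((apply_nonneg _ _).trans (hC N h))
  | add a b ha hb =>
    obtain ⟨C, hC⟩ := ha
    obtain ⟨D, hD⟩ := hb
    exact ⟨C + D, fun N h => (map_add_le_add N a b).trans (add_le_add (hC N h) (hD N h))⟩

theorem isCuntzSeminorm_zero (k : ℕ) : IsCuntzSeminorm (0 : RingSeminorm (FreeStarAlg k)) where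
  smul c x := by
    change (0 : ℝ) = ‖c‖ * 0
    simp
  star_mul_self x := by
    change (0 : ℝ) = 0 * 0
    simp
  isometry _ := rfl
  sum_range := rfl

instance (k : ℕ) : Nonempty {N : RingSeminorm (FreeStarAlg k) // IsCuntzSeminorm N} :=
  ⟨⟨0, isCuntzSeminorm_zero k⟩⟩

theorem bddAbove_seminorms {k : ℕ} (x : FreeStarAlg k) :
    BddAbove (Set.range fun N : {N : RingSeminorm (FreeStarAlg k) // IsCuntzSeminorm N} =>
      N.1 x) := by
  obtain ⟨C, hC⟩ := exists_bound x
  exact ⟨C, by rintro _ ⟨N, rfl⟩; exact hC N.1 N.2⟩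

/-- The universal C*-seminorm: the largest C*-seminorm in which the Cuntz relations hold. -/
def univSeminorm (k : ℕ) : RingSeminorm (FreeStarAlg k) where
  toFun x := ⨆ N : {N : RingSeminorm (FreeStarAlg k) // IsCuntzSeminorm N}, N.1 x
  map_zero' := by simp
  add_le' x y := ciSup_le fun N => (map_add_le_add N.1 x y).trans
    (add_le_add (le_ciSup (bddAbove_seminorms x) N) (le_ciSup (bddAbove_seminorms y) N))
  neg' x := by simp [map_neg_eq_map]
  mul_le' x y := ciSup_le fun N => (map_mul_le_mul N.1 x y).trans
    (mul_le_mul (le_ciSup (bddAbove_seminorms x) N) (le_ciSup (bddAbove_seminorms y) N)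
      (apply_nonneg _ _) ((apply_nonneg N.1 x).trans (le_ciSup (bddAbove_seminorms x) N)))

theorem univSeminorm_apply {k : ℕ} (x : FreeStarAlg k) :
    univSeminorm k x = ⨆ N : {N : RingSeminorm (FreeStarAlg k) // IsCuntzSeminorm N}, N.1 x :=
  rfl

theorem le_univSeminorm {k : ℕ} {N : RingSeminorm (FreeStarAlg k)} (h : IsCuntzSeminorm N)
    (x : FreeStarAlg k) : N x ≤ univSeminorm k x :=
  le_ciSup (bddAbove_seminorms x) ⟨N, h⟩

theorem isCuntzSeminorm_univ (k : ℕ) : IsCuntzSeminorm (univSeminorm k) where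
  smul c x := by
    rw [univSeminorm_apply, univSeminorm_apply, Real.mul_iSup_of_nonneg (norm_nonneg c)]
    exact iSup_congr fun N => N.2.smul c x
  star_mul_self x := by
    apply le_antisymm
    · exact ciSup_le fun N => (N.2.star_mul_self x).trans_le
        (mul_le_mul (le_univSeminorm N.2 x) (le_univSeminorm N.2 x) (apply_nonneg _ _)
          (apply_nonneg _ _))
    · rw [← sq, ← Real.le_sqrt (apply_nonneg _ _) (apply_nonneg _ _)]
      refine ciSup_le fun N => ?_
      rw [Real.le_sqrt (apply_nonneg _ _) (apply_nonneg _ _), sq, ← N.2.star_mul_self]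
      exact le_univSeminorm N.2 _
  isometry i := by
    rw [univSeminorm_apply]
    simp [fun N : {N : RingSeminorm (FreeStarAlg k) // IsCuntzSeminorm N} => N.2.isometry i]
  sum_range := by
    rw [univSeminorm_apply]
    simp [fun N : {N : RingSeminorm (FreeStarAlg k) // IsCuntzSeminorm N} => N.2.sum_range]

instance (k : ℕ) : SeminormedRing (FreeStarAlg k) where
  __ := (univSeminorm k).toAddGroupSeminorm.toSeminormedAddCommGroup
  __ := (inferInstance : Ring (FreeStarAlg k))
  norm_mul_le x y := (univSeminorm k).mul_le' x y

theorem FreeStarAlg.norm_def {k : ℕ} (x : FreeStarAlg k) : ‖x‖ = univSeminorm k x := rfl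

instance (k : ℕ) : NormedAlgebra ℂ (FreeStarAlg k) where
  norm_smul_le c x := ((isCuntzSeminorm_univ k).smul c x).le

instance (k : ℕ) : NormedStarGroup (FreeStarAlg k) where
  norm_star_le x := ((isCuntzSeminorm_univ k).star_eq x).le

/-- The Cuntz algebra `O_k`: the universal C*-algebra on `k` generators subject to the Cuntz
relations, that is, the Hausdorff completion of the free `*`-algebra for the universal C*-seminorm
(see `CuntzAlgebra.existsUnique_lift` for the universal property). -/
def CuntzAlgebra (k : ℕ) : Type := UniformSpace.Completion (FreeStarAlg k)

namespace CuntzAlgebra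

open UniformSpace

variable {k : ℕ}

instance : NormedRing (CuntzAlgebra k) :=
  inferInstanceAs (NormedRing (Completion (FreeStarAlg k)))

instance : CompleteSpace (CuntzAlgebra k) :=
  inferInstanceAs (CompleteSpace (Completion (FreeStarAlg k)))

instance : NormedAlgebra ℂ (CuntzAlgebra k) where
  __ := (inferInstance : Algebra ℂ (Completion (FreeStarAlg k)))
  norm_smul_le := norm_smul_le (α := ℂ) (β := Completion (FreeStarAlg k))

/-- The canonical map from the free `*`-algebra. -/
def ofFree (k : ℕ) : FreeStarAlg k →ₐ[ℂ] CuntzAlgebra k where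
  __ := (Completion.coeRingHom : FreeStarAlg k →+* Completion (FreeStarAlg k))
  commutes' _ := rfl

theorem norm_ofFree (x : FreeStarAlg k) : ‖ofFree k x‖ = univSeminorm k x :=
  Completion.norm_coe x

theorem continuous_ofFree : Continuous (ofFree k) := Completion.continuous_coe (FreeStarAlg k)

theorem denseRange_ofFree : DenseRange (ofFree k) := Completion.denseRange_coe

instance : Star (CuntzAlgebra k) where
  star := Completion.map (star : FreeStarAlg k → FreeStarAlg k)

theorem star_ofFree (x : FreeStarAlg k) : star (ofFree k x) = ofFree k (star x) :=
  Completion.map_coe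
    ((AddMonoidHomClass.isometry_of_norm (starAddEquiv : FreeStarAlg k ≃+ FreeStarAlg k)
      (fun x => norm_star x)).uniformContinuous) x

theorem continuous_star' : Continuous (star : CuntzAlgebra k → CuntzAlgebra k) :=
  Completion.continuous_map

theorem ind {p : CuntzAlgebra k → Prop} (hp : IsClosed {x | p x}) (h : ∀ x, p (ofFree k x))
    (x : CuntzAlgebra k) : p x :=
  denseRange_ofFree.induction_on x hp h

theorem ind₂ {p : CuntzAlgebra k → CuntzAlgebra k → Prop}
    (hp : IsClosed {x : CuntzAlgebra k × CuntzAlgebra k | p x.1 x.2})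
    (h : ∀ x y, p (ofFree k x) (ofFree k y)) (x y : CuntzAlgebra k) : p x y :=
  denseRange_ofFree.induction_on₂ hp h x y

instance : StarRing (CuntzAlgebra k) where
  star_involutive := ind
    (isClosed_eq (continuous_star'.comp continuous_star') continuous_id)
    fun x => by rw [star_ofFree, star_ofFree, star_star]
  star_mul := ind₂
    (isClosed_eq (continuous_star'.comp (continuous_fst.mul continuous_snd))
      ((continuous_star'.comp continuous_snd).mul (continuous_star'.comp continuous_fst)))
    fun x y => by rw [← map_mul, star_ofFree, star_ofFree, star_ofFree, star_mul, map_mul]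
  star_add := ind₂
    (isClosed_eq (continuous_star'.comp (continuous_fst.add continuous_snd))
      ((continuous_star'.comp continuous_fst).add (continuous_star'.comp continuous_snd)))
    fun x y => by rw [← map_add, star_ofFree, star_ofFree, star_ofFree, star_add, map_add]

instance : CStarRing (CuntzAlgebra k) where
  norm_mul_self_le := ind
    (isClosed_le (continuous_norm.mul continuous_norm)
      (continuous_norm.comp (continuous_star'.mul continuous_id)))
    fun x => by
      rw [star_ofFree, ← map_mul, norm_ofFree, norm_ofFree,
        (isCuntzSeminorm_univ k).star_mul_self]

instance : StarModule ℂ (CuntzAlgebra k) where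
  star_smul c := ind
    (isClosed_eq (continuous_star'.comp (continuous_const_smul c))
      (continuous_star'.const_smul (star c)))
    fun x => by rw [← map_smul, star_ofFree, star_ofFree, star_smul, map_smul]

instance : CStarAlgebra (CuntzAlgebra k) where

/-- The generator `s i` of the Cuntz algebra. -/
def gen (i : Fin k) : CuntzAlgebra k := ofFree k (FreeStarAlg.gen i)

theorem cuntzRel_gen (k : ℕ) : CuntzRel (gen : Fin k → CuntzAlgebra k) where
  isometry i := by
    rw [← sub_eq_zero, ← norm_eq_zero, ← (isCuntzSeminorm_univ k).isometry i, ← norm_ofFree]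
    simp [gen, star_ofFree]
  sum_range := by
    rw [← sub_eq_zero, ← norm_eq_zero, ← (isCuntzSeminorm_univ k).sum_range, ← norm_ofFree]
    simp [gen, star_ofFree]

/-- The universal property: every family satisfying the Cuntz relations in a unital C*-algebra is
the image of the generators under exactly one unital `*`-homomorphism. -/
theorem existsUnique_lift {A : Type*} [CStarAlgebra A] {t : Fin k → A} (ht : CuntzRel t) :
    ∃! φ : CuntzAlgebra k →⋆ₐ[ℂ] A, ∀ i, φ (gen i) = t i := by
  let f : FreeStarAlg k →ₐ[ℂ] A :=
    FreeAlgebra.lift ℂ (fun x : Fin k × Bool => if x.2 then star (t x.1) else t x.1)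
  have hfl (x) : f (FreeStarAlg.letter x) = if x.2 then star (t x.1) else t x.1 :=
    FreeAlgebra.lift_ι_apply (R := ℂ) _ x
  have hfg (i) : f (FreeStarAlg.gen i) = t i := by
    rw [FreeStarAlg.gen, hfl]; simp
  have hfs (x) : f (star x) = star (f x) := by
    induction x using FreeStarAlg.induct with
    | scalar r => rw [FreeStarAlg.star_algebraMap, AlgHom.commutes, AlgHom.commutes,
        algebraMap_star_comm]
    | lett x =>
      obtain ⟨i, b⟩ := x
      rw [FreeStarAlg.star_letter, hfl, hfl]
      cases b <;> simp
    | mul a b ha hb => rw [star_mul, map_mul, map_mul, star_mul, ha, hb]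
    | add a b ha hb => rw [star_add, map_add, map_add, star_add, ha, hb]
  let N : RingSeminorm (FreeStarAlg k) :=
    { toFun := fun x => ‖f x‖
      map_zero' := by simp
      add_le' := fun x y => by rw [map_add]; exact norm_add_le _ _
      neg' := fun x => by rw [map_neg, norm_neg]
      mul_le' := fun x y => by rw [map_mul]; exact norm_mul_le _ _ }
  have hN : IsCuntzSeminorm N :=
    { smul := fun c x => by
        change ‖f (c • x)‖ = ‖c‖ * ‖f x‖
        rw [map_smul, norm_smul]
      star_mul_self := fun x => by
        change ‖f (star x * x)‖ = ‖f x‖ * ‖f x‖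
        rw [map_mul, hfs, CStarRing.norm_star_mul_self]
      isometry := fun i => by
        change ‖f _‖ = 0
        rw [map_sub, map_mul, hfs, hfg, ht.isometry, map_one, sub_self, norm_zero]
      sum_range := by
        change ‖f _‖ = 0
        simp only [map_sub, map_sum, map_mul, hfs, hfg, ht.sum_range, map_one, sub_self,
          norm_zero] }
  have hfc : Continuous f := AddMonoidHomClass.continuous_of_bound f 1 fun x => by
    rw [one_mul]; exact le_univSeminorm hN x
  let g : CuntzAlgebra k →+* A := Completion.extensionHom (f : FreeStarAlg k →+* A) hfc
  have hgc : Continuous g := Completion.continuous_extension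
  have hg (x) : g (ofFree k x) = f x :=
    Completion.extensionHom_coe (f : FreeStarAlg k →+* A) hfc x
  have hgs (x) : g (star x) = star (g x) := by
    induction x using ind with
    | hp => exact isClosed_eq (hgc.comp continuous_star') (continuous_star.comp hgc)
    | h x => rw [star_ofFree, hg, hg, hfs]
  refine ⟨{ g with
    commutes' := fun r => by
      change g _ = _
      rw [← AlgHom.commutes (ofFree k), hg, AlgHom.commutes]
    map_star' := hgs }, fun i => (hg _).trans (hfg i), fun φ hφ => ?_⟩
  have hφ' (x) : φ (ofFree k x) = f x := by
    induction x using FreeStarAlg.induct with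
    | scalar r => rw [AlgHom.commutes, AlgHom.commutes, AlgHomClass.commutes]
    | lett x =>
      obtain ⟨i, b⟩ := x
      cases b with
      | false => exact (hφ i).trans (hfg i).symm
      | true =>
        have e : FreeStarAlg.letter (i, true) = star (FreeStarAlg.gen i) :=
          (FreeStarAlg.star_letter (k := k) (i, false)).symm
        rw [e, ← star_ofFree, map_star, hfs, hfg]
        exact congrArg star (hφ i)
    | mul a b ha hb => rw [map_mul, map_mul, map_mul, ha, hb]
    | add a b ha hb => rw [map_add, map_add, map_add, ha, hb]
  have hφc : Continuous φ := AddMonoidHomClass.continuous_of_bound φ 1 fun x => by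
    rw [one_mul]; exact NonUnitalStarAlgHom.norm_apply_le φ x
  ext x
  induction x using ind with
  | hp => exact isClosed_eq hφc hgc
  | h x => exact (hφ' x).trans (hg x).symm

end CuntzAlgebra

/-! ## The C*-algebraic direct sum -/

/-- The C*-algebraic direct sum of a sequence of C*-algebras: the bounded sequences whose norms tend
to `0`, inside the C*-algebra of all bounded sequences with the supremum norm. -/
def directSum (A : ℕ → Type*) [∀ n, NonUnitalCStarAlgebra (A n)] :
    NonUnitalStarSubalgebra ℂ (lp A ∞) where
  carrier := {x | Tendsto (fun n => ‖x n‖) atTop (𝓝 0)}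
  zero_mem' := by simp
  add_mem' {x y} hx hy := by
    refine squeeze_zero (fun n => norm_nonneg _) (fun n => norm_add_le (x n) (y n)) ?_
    simpa using Tendsto.add hx hy
  mul_mem' {x y} hx hy := by
    refine squeeze_zero (fun n => norm_nonneg _) (fun n => norm_mul_le (x n) (y n)) ?_
    simpa using Tendsto.mul hx hy
  smul_mem' c x hx := by
    have : Tendsto (fun n => ‖c‖ * ‖x n‖) atTop (𝓝 (‖c‖ * 0)) := Tendsto.const_mul ‖c‖ hx
    simpa [norm_smul] using this
  star_mem' {x} hx := by simpa [norm_star] using hx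

theorem isClosed_directSum (A : ℕ → Type*) [∀ n, NonUnitalCStarAlgebra (A n)] :
    IsClosed (directSum A : Set (lp A ∞)) := by
  refine isClosed_of_closure_subset fun x hx => ?_
  change Tendsto (fun n => ‖x n‖) atTop (𝓝 0)
  rw [Metric.tendsto_atTop]
  intro ε hε
  obtain ⟨y, hy, hxy⟩ := Metric.mem_closure_iff.1 hx (ε / 2) (half_pos hε)
  obtain ⟨M, hM⟩ := Metric.tendsto_atTop.1 (show Tendsto (fun n => ‖y n‖) atTop (𝓝 0) from hy)
    (ε / 2) (half_pos hε)
  refine ⟨M, fun n hn => ?_⟩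
  have h1 := hM n hn
  have h2 : ‖x n - y n‖ ≤ ‖x - y‖ := lp.norm_apply_le_norm ENNReal.top_ne_zero (x - y) n
  have h3 : ‖x n‖ ≤ ‖x n - y n‖ + ‖y n‖ := by simpa using norm_add_le (x n - y n) (y n)
  rw [dist_eq_norm] at hxy
  simp only [dist_zero_right, norm_norm] at h1 ⊢
  linarith

instance (A : ℕ → Type*) [∀ n, NonUnitalCStarAlgebra (A n)] :
    NonUnitalCStarAlgebra (directSum A) :=
  NonUnitalStarSubalgebra.nonUnitalCStarAlgebra _ (h_closed := isClosed_directSum A)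

/-! ## Presentations of C*-algebras -/

/-- A code `(a, b, c)` of the rational number `(a - b) / (c + 1)`; every rational has a code. -/
abbrev RatCode : Type := ℕ × ℕ × ℕ

/-- The rational number with a given code. -/
def RatCode.toRat (q : RatCode) : ℚ := ((q.1 : ℚ) - q.2.1) / (q.2.2 + 1)

/-- A letter `x_j` (for `(j, false)`) or `star x_j` (for `(j, true)`). -/
abbrev Letter : Type := ℕ × Bool

/-- A monomial `c • w`: codes of the real and imaginary part of a coefficient `c ∈ ℚ(i)`, and a
nonempty word `w` in the letters, split into its first letter and the list of the other ones. -/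
abbrev RatMonomial : Type := (RatCode × RatCode) × Letter × List Letter

/-- Rational `*`-polynomials: noncommutative polynomials without constant term in the variables
`x_0, x_1, …` and their adjoints, with coefficients in `ℚ(i)`, written as a sum of monomials. -/
abbrev RatStarPoly : Type := List RatMonomial

section Eval

variable {A : Type*} [NonUnitalCStarAlgebra A]

/-- The value of a letter at a sequence of points. -/
def evalLetter (a : ℕ → A) (l : Letter) : A := if l.2 then star (a l.1) else a l.1

/-- The value of a monomial at a sequence of points. -/
def evalMonomial (a : ℕ → A) (m : RatMonomial) : A :=
  (⟨(m.1.1.toRat : ℝ), (m.1.2.toRat : ℝ)⟩ : ℂ) •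
    (m.2.2.map (evalLetter a)).foldl (· * ·) (evalLetter a m.2.1)

/-- The value of a rational `*`-polynomial at a sequence of points. -/
def evalPoly (a : ℕ → A) (p : RatStarPoly) : A := (p.map (evalMonomial a)).sum

end Eval

/-- A presentation of a C*-algebra: a sequence of special points that generates it. -/
structure Presentation (A : Type*) [NonUnitalCStarAlgebra A] where
  point : ℕ → A
  generates :
    (NonUnitalStarAlgebra.adjoin ℂ (Set.range point)).topologicalClosure = ⊤

/-- A presentation is computable if some algorithm takes (a code of) a rational point, that is, a
rational `*`-polynomial in the special points, and a precision `k`, and returns a rational number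
within `2⁻ᵏ` of the norm of that point. -/
def Presentation.IsComputable {A : Type*} [NonUnitalCStarAlgebra A] (P : Presentation A) : Prop :=
  ∃ f : RatStarPoly × ℕ → RatCode, Computable f ∧
    ∀ (p : RatStarPoly) (k : ℕ),
      |‖evalPoly P.point p‖ - ((f (p, k)).toRat : ℝ)| < ((2 : ℝ) ^ k)⁻¹

/-! ## The algebras `B_n` -/

/-- A unital C*-algebra, bundled. -/
structure BundledCStarAlg where
  carrier : Type
  [str : CStarAlgebra carrier]

instance : CoeSort BundledCStarAlg Type := ⟨BundledCStarAlg.carrier⟩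

instance (A : BundledCStarAlg) : CStarAlgebra A := A.str

open Classical in
/-- `B_n` is `ℂ` if `n ∈ R`, and the Cuntz algebra on `p_n + 1` generators otherwise, where
`p_0 = 2, p_1 = 3, …` are the primes. -/
def summand (R : Set ℕ) (n : ℕ) : BundledCStarAlg :=
  if n ∈ R then ⟨ℂ⟩ else ⟨CuntzAlgebra (Nat.nth Nat.Prime n + 1)⟩

end CompCStar

end

noncomputable section

open scoped ENNReal
open Filter Topology

namespace CompCStar

/-! ## Arithmetic on codes -/

namespace RatCode

/-- Addition of codes of rational numbers. -/
def add (q r : RatCode) : RatCode :=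
  (q.1 * (r.2.2 + 1) + r.1 * (q.2.2 + 1), q.2.1 * (r.2.2 + 1) + r.2.1 * (q.2.2 + 1),
    (q.2.2 + 1) * (r.2.2 + 1) - 1)

/-- Multiplication of codes of rational numbers. -/
def mul (q r : RatCode) : RatCode :=
  (q.1 * r.1 + q.2.1 * r.2.1, q.1 * r.2.1 + q.2.1 * r.1, (q.2.2 + 1) * (r.2.2 + 1) - 1)

/-- Negation of codes of rational numbers. -/
def neg (q : RatCode) : RatCode := (q.2.1, q.1, q.2.2)

/-- The absolute value on codes of rational numbers. -/
def abs (q : RatCode) : RatCode := ((q.1 - q.2.1) + (q.2.1 - q.1), 0, q.2.2)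

/-- The code of a natural number. -/
def ofNat (n : ℕ) : RatCode := (n, 0, 0)

/-- Powers of codes of rational numbers. -/
def pow (q : RatCode) (n : ℕ) : RatCode := n.rec (ofNat 1) fun _ r => mul r q

/-- The sum of a list of codes of rational numbers. -/
def sum (l : List RatCode) : RatCode := l.foldr add (ofNat 0)

/-- The strict order on codes of rational numbers. -/
def Lt (q r : RatCode) : Prop :=
  q.1 * (r.2.2 + 1) + r.2.1 * (q.2.2 + 1) < r.1 * (q.2.2 + 1) + q.2.1 * (r.2.2 + 1)

instance : DecidableRel Lt := fun _ _ => inferInstanceAs (Decidable (_ < _))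

theorem cast_den (q r : RatCode) :
    (((q.2.2 + 1) * (r.2.2 + 1) - 1 : ℕ) : ℚ) + 1 = (q.2.2 + 1) * (r.2.2 + 1) := by
  rw [Nat.cast_sub (Nat.succ_le_of_lt (by positivity))]
  push_cast
  ring

theorem toRat_add (q r : RatCode) : (add q r).toRat = q.toRat + r.toRat := by
  have h1 : (q.2.2 : ℚ) + 1 ≠ 0 := by positivity
  have h2 : (r.2.2 : ℚ) + 1 ≠ 0 := by positivity
  simp only [toRat, add, cast_den]
  push_cast
  field_simp
  ring

theorem toRat_mul (q r : RatCode) : (mul q r).toRat = q.toRat * r.toRat := by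
  have h1 : (q.2.2 : ℚ) + 1 ≠ 0 := by positivity
  have h2 : (r.2.2 : ℚ) + 1 ≠ 0 := by positivity
  simp only [toRat, mul, cast_den]
  push_cast
  field_simp
  ring

theorem toRat_neg (q : RatCode) : (neg q).toRat = -q.toRat := by
  simp only [toRat, neg]
  ring

theorem toRat_abs (q : RatCode) : (abs q).toRat = |q.toRat| := by
  have h1 : (0 : ℚ) < q.2.2 + 1 := by positivity
  simp only [toRat, abs, abs_div, abs_of_pos h1]
  congr 1
  rcases le_total q.1 q.2.1 with h | h
  · have h' : (q.1 : ℚ) ≤ q.2.1 := by exact_mod_cast h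
    rw [abs_of_nonpos (by linarith), Nat.sub_eq_zero_of_le h, zero_add, Nat.cast_sub h]
    push_cast; ring
  · have h' : (q.2.1 : ℚ) ≤ q.1 := by exact_mod_cast h
    rw [abs_of_nonneg (by linarith), Nat.sub_eq_zero_of_le h, add_zero, Nat.cast_sub h]
    push_cast; ring

@[simp] theorem toRat_ofNat (n : ℕ) : (ofNat n).toRat = n := by simp [toRat, ofNat]

theorem toRat_pow (q : RatCode) (n : ℕ) : (pow q n).toRat = q.toRat ^ n := by
  induction n with
  | zero => simp [pow]
  | succ n ih => rw [pow_succ, ← ih, ← toRat_mul]; rfl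

theorem toRat_sum (l : List RatCode) : (sum l).toRat = (l.map toRat).sum := by
  induction l with
  | nil => simp [sum]
  | cons q l ih => rw [List.map_cons, List.sum_cons, ← ih, ← toRat_add]; rfl

theorem lt_iff (q r : RatCode) : Lt q r ↔ q.toRat < r.toRat := by
  have h1 : (0 : ℚ) < q.2.2 + 1 := by positivity
  have h2 : (0 : ℚ) < r.2.2 + 1 := by positivity
  rw [toRat, toRat, div_lt_div_iff₀ h1 h2, Lt, ← Nat.cast_lt (α := ℚ)]
  push_cast
  constructor <;> intro h <;> nlinarith

theorem exists_toRat (x : ℚ) : ∃ q : RatCode, q.toRat = x := by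
  refine ⟨(x.num.toNat, (-x.num).toNat, x.den - 1), ?_⟩
  have h : ((x.den - 1 : ℕ) : ℚ) + 1 = x.den := by
    rw [Nat.cast_sub x.pos]; push_cast; ring
  have h2 : ((x.num.toNat : ℕ) : ℚ) - ((-x.num).toNat : ℕ) = x.num := by
    have := Int.toNat_sub_toNat_neg x.num
    exact_mod_cast this
  simp only [toRat]
  rw [h, h2, Rat.num_div_den]

end RatCode

/-- A code of an element of `ℚ(i)`. -/
abbrev GaussCode : Type := RatCode × RatCode

namespace GaussCode

/-- The complex number with a given code. -/
def toComplex (c : GaussCode) : ℂ := ⟨(c.1.toRat : ℝ), (c.2.toRat : ℝ)⟩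

/-- Multiplication of codes of elements of `ℚ(i)`. -/
def mul (c d : GaussCode) : GaussCode :=
  (RatCode.add (RatCode.mul c.1 d.1) (RatCode.neg (RatCode.mul c.2 d.2)),
    RatCode.add (RatCode.mul c.1 d.2) (RatCode.mul c.2 d.1))

/-- Complex conjugation of codes of elements of `ℚ(i)`. -/
def conj (c : GaussCode) : GaussCode := (c.1, RatCode.neg c.2)

/-- The code of `1`. -/
def one : GaussCode := (RatCode.ofNat 1, RatCode.ofNat 0)

/-- The code of `-1`. -/
def negOne : GaussCode := (RatCode.neg (RatCode.ofNat 1), RatCode.ofNat 0)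

theorem toComplex_mul (c d : GaussCode) : toComplex (mul c d) = toComplex c * toComplex d := by
  apply Complex.ext <;>
    simp [toComplex, mul, RatCode.toRat_add, RatCode.toRat_mul, RatCode.toRat_neg, sub_eq_add_neg]

theorem toComplex_conj (c : GaussCode) : toComplex (conj c) = star (toComplex c) := by
  apply Complex.ext <;> simp [toComplex, conj, RatCode.toRat_neg]

@[simp] theorem toComplex_one : toComplex one = 1 := by
  apply Complex.ext <;> simp [toComplex, one]

@[simp] theorem toComplex_negOne : toComplex negOne = -1 := by
  apply Complex.ext <;> simp [toComplex, negOne, RatCode.toRat_neg]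

end GaussCode

/-! ## Polynomials with constant term in the generators of a Cuntz algebra -/

/-- Rational `*`-polynomials, possibly with a constant term, written as sums of monomials. -/
abbrev CuntzPoly : Type := List (GaussCode × List Letter)

namespace CuntzPoly

/-- The word of the adjoint. -/
def starWord (w : List Letter) : List Letter := (w.map fun l => (l.1, !l.2)).reverse

/-- Multiplication of polynomials. -/
def mul (p q : CuntzPoly) : CuntzPoly :=
  p.flatMap fun a => q.map fun b => (GaussCode.mul a.1 b.1, a.2 ++ b.2)

/-- The adjoint of a polynomial. -/
def adj (p : CuntzPoly) : CuntzPoly := p.map fun a => (GaussCode.conj a.1, starWord a.2)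

/-- Scalar multiples of polynomials. -/
def smul (c : GaussCode) (p : CuntzPoly) : CuntzPoly := p.map fun a => (GaussCode.mul c a.1, a.2)

/-- The unit polynomial. -/
def one : CuntzPoly := [(GaussCode.one, [])]

/-- Powers of polynomials. -/
def pow (p : CuntzPoly) (n : ℕ) : CuntzPoly := n.rec one fun _ r => mul r p

/-- The number of letters `s i` in a word. -/
def posCount (w : List Letter) : ℕ := (w.filter fun l => l.2 = false).length

/-- The number of letters `star (s i)` in a word. -/
def negCount (w : List Letter) : ℕ := (w.filter fun l => l.2 = true).length

/-- The part of a polynomial of degree `0` for the gauge action. -/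
def balanced (p : CuntzPoly) : CuntzPoly := p.filter fun a => posCount a.2 = negCount a.2

/-- The action of a letter on natural numbers, seen as words in base `k`. -/
def actLetter (k : ℕ) (l : Letter) (j : ℕ) : Option ℕ :=
  if l.2 = true then (if l.1 % k = j % k then some (j / k) else none) else some (k * j + l.1 % k)

/-- The action of a word on natural numbers, seen as words in base `k`. -/
def act (k : ℕ) (w : List Letter) (j : ℕ) : Option ℕ :=
  w.foldr (fun l o => o.bind (actLetter k l)) (some j)

/-- The sum of the absolute values of the real and imaginary part of a matrix coefficient. -/
def entrySize (k : ℕ) (p : CuntzPoly) (i j : ℕ) : RatCode :=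
  RatCode.add
    (RatCode.abs (RatCode.sum ((p.filter fun a => act k a.2 j = some i).map fun a => a.1.1)))
    (RatCode.abs (RatCode.sum ((p.filter fun a => act k a.2 j = some i).map fun a => a.1.2)))

/-- The sum of the sizes of the coefficients of the matrix by which a polynomial acts on the words
of length `m`. -/
def matrixSize (k m : ℕ) (p : CuntzPoly) : RatCode :=
  RatCode.sum ((List.range (k ^ m)).flatMap fun i =>
    (List.range (k ^ m)).map fun j => entrySize k p i j)

section Eval

variable {A : Type*} [CStarAlgebra A] (g : ℕ → A)

/-- The value of a word. -/
def evalWord (w : List Letter) : A := (w.map (evalLetter g)).prod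

/-- The value of a polynomial. -/
def eval (p : CuntzPoly) : A := (p.map fun a => GaussCode.toComplex a.1 • evalWord g a.2).sum

@[simp] theorem evalWord_nil : evalWord g [] = 1 := rfl

@[simp] theorem evalWord_cons (l : Letter) (w : List Letter) :
    evalWord g (l :: w) = evalLetter g l * evalWord g w := by simp [evalWord]

@[simp] theorem evalWord_append (v w : List Letter) :
    evalWord g (v ++ w) = evalWord g v * evalWord g w := by simp [evalWord]

theorem evalLetter_not (l : Letter) : evalLetter g (l.1, !l.2) = star (evalLetter g l) := by
  obtain ⟨i, b⟩ := l
  cases b <;> simp [evalLetter]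

theorem evalWord_starWord (w : List Letter) : evalWord g (starWord w) = star (evalWord g w) := by
  induction w with
  | nil => simp [starWord]
  | cons l w ih =>
    rw [evalWord_cons, star_mul, ← ih, ← evalLetter_not]
    simp [starWord]

@[simp] theorem eval_nil : eval g [] = 0 := rfl

@[simp] theorem eval_cons (a : GaussCode × List Letter) (p : CuntzPoly) :
    eval g (a :: p) = GaussCode.toComplex a.1 • evalWord g a.2 + eval g p := by simp [eval]

@[simp] theorem eval_append (p q : CuntzPoly) : eval g (p ++ q) = eval g p + eval g q := by
  simp [eval]

theorem eval_smul (c : GaussCode) (p : CuntzPoly) :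
    eval g (smul c p) = GaussCode.toComplex c • eval g p := by
  induction p with
  | nil => simp [smul]
  | cons a p ih =>
    rw [eval_cons, smul_add, ← ih, smul_smul, ← GaussCode.toComplex_mul]
    simp [smul]

theorem eval_mul (p q : CuntzPoly) : eval g (mul p q) = eval g p * eval g q := by
  induction p with
  | nil => simp [mul]
  | cons a p ih =>
    have h : eval g (q.map fun b => (GaussCode.mul a.1 b.1, a.2 ++ b.2)) =
        (GaussCode.toComplex a.1 • evalWord g a.2) * eval g q := by
      clear ih
      induction q with
      | nil => simp
      | cons b q ihq =>
        rw [List.map_cons, eval_cons, ihq, eval_cons, mul_add, GaussCode.toComplex_mul,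
          evalWord_append, smul_mul_smul_comm]
    rw [eval_cons, add_mul, ← ih, ← h, ← eval_append]
    rfl

theorem eval_adj (p : CuntzPoly) : eval g (adj p) = star (eval g p) := by
  induction p with
  | nil => simp [adj]
  | cons a p ih =>
    rw [eval_cons, star_add, ← ih, star_smul, ← GaussCode.toComplex_conj, ← evalWord_starWord]
    simp [adj]

@[simp] theorem eval_one : eval g one = 1 := by simp [one]

theorem eval_pow (p : CuntzPoly) (n : ℕ) : eval g (pow p n) = eval g p ^ n := by
  induction n with
  | zero => simp [pow]
  | succ n ih => rw [pow_succ, ← ih, ← eval_mul]; rfl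

end Eval

/-! ### Lengths of words -/

/-- All words of a polynomial have length at most `d`. -/
def LengthLE (p : CuntzPoly) (d : ℕ) : Prop := ∀ a ∈ p, a.2.length ≤ d

theorem LengthLE.mono {p : CuntzPoly} {d e : ℕ} (h : LengthLE p d) (hde : d ≤ e) : LengthLE p e :=
  fun a ha => (h a ha).trans hde

theorem LengthLE.mul {p q : CuntzPoly} {d e : ℕ} (hp : LengthLE p d) (hq : LengthLE q e) :
    LengthLE (mul p q) (d + e) := by
  intro a ha
  simp only [CuntzPoly.mul, List.mem_flatMap, List.mem_map] at ha
  obtain ⟨b, hb, c, hc, rfl⟩ := ha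
  simpa using add_le_add (hp b hb) (hq c hc)

theorem LengthLE.adj {p : CuntzPoly} {d : ℕ} (hp : LengthLE p d) : LengthLE (adj p) d := by
  intro a ha
  simp only [CuntzPoly.adj, List.mem_map] at ha
  obtain ⟨b, hb, rfl⟩ := ha
  simpa [starWord] using hp b hb

theorem LengthLE.pow {p : CuntzPoly} {d : ℕ} (hp : LengthLE p d) (n : ℕ) :
    LengthLE (pow p n) (d * n) := by
  induction n with
  | zero =>
    intro a ha
    obtain rfl : a = (GaussCode.one, []) := List.mem_singleton.1 ha
    simp
  | succ n ih => exact ih.mul hp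

theorem LengthLE.balanced {p : CuntzPoly} {d : ℕ} (hp : LengthLE p d) :
    LengthLE (balanced p) d := fun a ha => hp a (List.mem_of_mem_filter ha)

end CuntzPoly

/-! ## Sequences of isometries satisfying the Cuntz relations -/

/-- A sequence of elements, periodic with period `k`, whose first `k` terms satisfy the Cuntz
relations, including the orthogonality of ranges. -/
structure IsCuntzSeq {A : Type*} [CStarAlgebra A] (k : ℕ) (g : ℕ → A) : Prop where
  two_le : 2 ≤ k
  congr : ∀ i j, i % k = j % k → g i = g j
  star_mul_self : ∀ i, star (g i) * g i = 1
  star_mul_of_ne : ∀ i j, i % k ≠ j % k → star (g i) * g j = 0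
  sum_range : ∑ i ∈ Finset.range k, g i * star (g i) = 1

open scoped CStarAlgebra ComplexOrder in
/-- The ranges of isometries satisfying the Cuntz relations are orthogonal. -/
theorem CuntzRel.star_mul_of_ne {A : Type*} [CStarAlgebra A] {k : ℕ} {s : Fin k → A}
    (hs : CuntzRel s) {i j : Fin k} (hij : i ≠ j) : star (s i) * s j = 0 := by
  let _ := CStarAlgebra.spectralOrder A
  have _ := CStarAlgebra.spectralOrderedRing A
  have h1 : ∑ l, (star (s i) * s l) * star (star (s i) * s l) = 1 := by
    have : star (s i) * (∑ l, s l * star (s l)) * s i = 1 := by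
      rw [hs.sum_range, mul_one, hs.isometry]
    rw [← this, Finset.mul_sum, Finset.sum_mul]
    exact Finset.sum_congr rfl fun l _ => by rw [star_mul, star_star]; noncomm_ring
  rw [← Finset.add_sum_erase _ _ (Finset.mem_univ i), hs.isometry, star_one, mul_one,
    add_eq_left] at h1
  have h2 := (Finset.sum_eq_zero_iff_of_nonneg (fun l _ => mul_star_self_nonneg _)).1 h1 j
    (Finset.mem_erase.2 ⟨hij.symm, Finset.mem_univ j⟩)
  exact CStarRing.mul_star_self_eq_zero_iff _ |>.1 h2

/-- The periodic sequence of isometries of a Cuntz family. -/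
def CuntzRel.seq {A : Type*} {k : ℕ} (hk : 2 ≤ k) (s : Fin k → A) (i : ℕ) : A :=
  s ⟨i % k, Nat.mod_lt i (by omega)⟩

theorem CuntzRel.isCuntzSeq {A : Type*} [CStarAlgebra A] {k : ℕ} (hk : 2 ≤ k) {s : Fin k → A}
    (hs : CuntzRel s) : IsCuntzSeq k (CuntzRel.seq hk s) where
  two_le := hk
  congr i j h := by simp [CuntzRel.seq, h]
  star_mul_self i := hs.isometry _
  star_mul_of_ne i j h := hs.star_mul_of_ne fun e => h (congrArg Fin.val e)
  sum_range := by
    rw [← hs.sum_range, ← Fin.sum_univ_eq_sum_range fun i => seq hk s i * star (seq hk s i)]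
    refine Finset.sum_congr rfl fun i _ => ?_
    simp [seq, Nat.mod_eq_of_lt i.2]

namespace IsCuntzSeq

variable {A : Type*} [CStarAlgebra A] {k : ℕ} {g : ℕ → A}

/-- The isometry of a word of length `r`, written as a natural number in base `k`. -/
def wordIso (k : ℕ) (g : ℕ → A) : ℕ → ℕ → A
  | 0, _ => 1
  | r + 1, j => g j * wordIso k g r (j / k)

theorem pos (h : IsCuntzSeq k g) : 0 < k := by have := h.two_le; omega

theorem wordIso_add (r t j : ℕ) :
    wordIso k g (r + t) j = wordIso k g r j * wordIso k g t (j / k ^ r) := by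
  induction r generalizing j with
  | zero => simp [wordIso]
  | succ r ih =>
    rw [Nat.add_right_comm, wordIso, ih, wordIso, mul_assoc, Nat.div_div_eq_div_mul, ← pow_succ']

theorem star_wordIso_mul_self (h : IsCuntzSeq k g) (r j : ℕ) :
    star (wordIso k g r j) * wordIso k g r j = 1 := by
  induction r generalizing j with
  | zero => simp [wordIso]
  | succ r ih =>
    rw [wordIso, star_mul, mul_assoc, ← mul_assoc (star (g j)), h.star_mul_self, one_mul, ih]

theorem star_wordIso_mul (h : IsCuntzSeq k g) (r i j : ℕ) :
    star (wordIso k g r i) * wordIso k g r j = if i % k ^ r = j % k ^ r then 1 else 0 := by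
  induction r generalizing i j with
  | zero => simp [wordIso, Nat.mod_one]
  | succ r ih =>
    rw [wordIso, wordIso, star_mul, mul_assoc, ← mul_assoc (star (g i)), pow_succ', Nat.mod_mul,
      Nat.mod_mul]
    by_cases hij : i % k = j % k
    · rw [h.congr i j hij, h.star_mul_self, one_mul, ih, hij]
      refine if_congr ?_ rfl rfl
      have := h.pos
      simp [this.ne']
    · rw [h.star_mul_of_ne i j hij, zero_mul, mul_zero, if_neg]
      intro e
      have := congrArg (· % k) e
      simp at this
      exact hij this

theorem star_wordIso_mul_of_lt (h : IsCuntzSeq k g) {r i j : ℕ} (hi : i < k ^ r) (hj : j < k ^ r) :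
    star (wordIso k g r i) * wordIso k g r j = if i = j then 1 else 0 := by
  rw [h.star_wordIso_mul, Nat.mod_eq_of_lt hi, Nat.mod_eq_of_lt hj]

theorem sum_wordIso (h : IsCuntzSeq k g) (r : ℕ) :
    ∑ j ∈ Finset.range (k ^ r), wordIso k g r j * star (wordIso k g r j) = 1 := by
  induction r with
  | zero => simp [wordIso]
  | succ r ih =>
    have key : ∀ f : ℕ → A, ∑ j ∈ Finset.range (k ^ (r + 1)), f j =
        ∑ a ∈ Finset.range k, ∑ b ∈ Finset.range (k ^ r), f (a + k * b) := by
      intro f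
      rw [pow_succ', Finset.sum_comm, ← Finset.sum_product']
      refine (Finset.sum_nbij' (fun x => x.2 + k * x.1) (fun j => (j / k, j % k)) ?_ ?_ ?_ ?_
        ?_).symm
      · rintro ⟨b, a⟩ hx
        simp only [Finset.mem_product, Finset.mem_range] at hx ⊢
        nlinarith
      · intro j hj
        simp only [Finset.mem_product, Finset.mem_range] at hj ⊢
        exact ⟨Nat.div_lt_of_lt_mul hj, Nat.mod_lt _ h.pos⟩
      · rintro ⟨b, a⟩ hx
        simp only [Finset.mem_product, Finset.mem_range] at hx ⊢
        rw [Nat.add_mul_div_left _ _ h.pos, Nat.div_eq_of_lt hx.2, Nat.add_mul_mod_self_left,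
          Nat.mod_eq_of_lt hx.2, zero_add]
      · intro j _
        exact Nat.mod_add_div j k
      · intros; rfl
    rw [key, ← h.sum_range]
    refine Finset.sum_congr rfl fun a ha => ?_
    have ha' := Finset.mem_range.1 ha
    have e : ∀ b, wordIso k g (r + 1) (a + k * b) = g a * wordIso k g r b := fun b => by
      rw [wordIso, Nat.add_mul_div_left _ _ h.pos, Nat.div_eq_of_lt ha', zero_add,
        h.congr (a + k * b) a (Nat.add_mul_mod_self_left _ _ _)]
    simp only [e, star_mul]
    calc _ = g a * (∑ b ∈ Finset.range (k ^ r), wordIso k g r b * star (wordIso k g r b)) *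
          star (g a) := by
            rw [Finset.mul_sum, Finset.sum_mul]
            exact Finset.sum_congr rfl fun _ _ => by noncomm_ring
      _ = _ := by rw [ih, mul_one]

theorem norm_wordIso_le (h : IsCuntzSeq k g) (r j : ℕ) : ‖wordIso k g r j‖ ≤ 1 := by
  have h1 := CStarRing.norm_star_mul_self (x := wordIso k g r j)
  rw [h.star_wordIso_mul_self] at h1
  have h2 := CStarRing.norm_star_mul_self (x := (1 : A))
  rw [star_one, mul_one] at h2
  have h3 : ‖(1 : A)‖ ≤ 1 := by nlinarith [norm_nonneg (1 : A)]
  nlinarith [norm_nonneg (wordIso k g r j)]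

open CuntzPoly

theorem posCount_cons (l : Letter) (w : List Letter) :
    posCount (l :: w) = posCount w + if l.2 = true then 0 else 1 := by
  obtain ⟨i, b⟩ := l
  cases b <;> simp [posCount]

theorem negCount_cons (l : Letter) (w : List Letter) :
    negCount (l :: w) = negCount w + if l.2 = true then 1 else 0 := by
  obtain ⟨i, b⟩ := l
  cases b <;> simp [negCount]

theorem posCount_add_negCount (w : List Letter) : posCount w + negCount w = w.length := by
  induction w with
  | nil => rfl
  | cons l w ih =>
    rw [posCount_cons, negCount_cons, List.length_cons, ← ih]
    split_ifs <;> omega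

theorem act_cons (k : ℕ) (l : Letter) (w : List Letter) (j : ℕ) :
    act k (l :: w) j = (act k w j).bind (actLetter k l) := rfl

theorem act_append (k : ℕ) (v w : List Letter) (j : ℕ) :
    act k (v ++ w) j = (act k w j).bind (act k v) := by
  induction v with
  | nil => rw [List.nil_append]; cases act k w j <;> rfl
  | cons l v ih =>
    rw [List.cons_append, act_cons, ih, Option.bind_assoc]
    rfl

/-- A word maps the isometry of a word to the isometry of a word, or to zero. -/
theorem evalWord_mul_wordIso (h : IsCuntzSeq k g) (w : List Letter) {r : ℕ}
    (hr : negCount w ≤ r) (j : ℕ) :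
    evalWord g w * wordIso k g r j =
      (act k w j).elim 0 (wordIso k g (r + posCount w - negCount w)) := by
  induction w with
  | nil => simp [act, posCount, negCount]
  | cons l w ih =>
    obtain ⟨i, b⟩ := l
    rw [negCount_cons] at hr
    rw [evalWord_cons, mul_assoc, ih (by omega), act_cons, posCount_cons, negCount_cons]
    cases hw : act k w j with
    | none => simp
    | some j' =>
      cases b with
      | false =>
        have e : r + (posCount w + 1) - negCount w = (r + posCount w - negCount w) + 1 := by
          simp at hr; omega
        simp only [Option.elim_some, Option.bind_some, actLetter, Bool.false_eq_true, if_false,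
          evalLetter, add_zero, e]
        rw [wordIso, Nat.mul_add_div h.pos, Nat.div_eq_of_lt (Nat.mod_lt _ h.pos), add_zero,
          h.congr (k * j' + i % k) i (by simp)]
      | true =>
        obtain ⟨q, hq⟩ : ∃ q, r + posCount w - negCount w = q + 1 :=
          ⟨r + posCount w - negCount w - 1, by simp at hr; omega⟩
        have e : r + (posCount w + 0) - (negCount w + 1) = q := by omega
        simp only [Option.elim_some, Option.bind_some, actLetter, if_true, evalLetter, e, hq]
        rw [wordIso, ← mul_assoc]
        by_cases hij : i % k = j' % k
        · rw [h.congr i j' hij, h.star_mul_self, if_pos hij, one_mul]; rfl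
        · rw [h.star_mul_of_ne i j' hij, if_neg hij, zero_mul]; rfl

theorem act_lt (h : IsCuntzSeq k g) (w : List Letter) {r : ℕ} (hr : negCount w ≤ r) {j j' : ℕ}
    (hj : j < k ^ r) (hj' : act k w j = some j') :
    j' < k ^ (r + posCount w - negCount w) := by
  induction w generalizing j' with
  | nil =>
    obtain rfl : j = j' := Option.some_injective _ hj'
    simpa [posCount, negCount] using hj
  | cons l w ih =>
    obtain ⟨i, b⟩ := l
    rw [negCount_cons] at hr
    rw [act_cons, Option.bind_eq_some_iff] at hj'
    obtain ⟨a, ha, hj'⟩ := hj'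
    have ha := ih (by omega) ha
    rw [posCount_cons, negCount_cons]
    cases b with
    | false =>
      simp only [actLetter, Bool.false_eq_true, if_false, Option.some.injEq] at hj'
      have e : r + (posCount w + 1) - (negCount w + 0) = (r + posCount w - negCount w) + 1 := by
        simp at hr; omega
      simp only [Bool.false_eq_true, if_false]
      have := Nat.mod_lt i h.pos
      rw [e, pow_succ', ← hj']
      nlinarith
    | true =>
      obtain ⟨q, hq⟩ : ∃ q, r + posCount w - negCount w = q + 1 :=
        ⟨r + posCount w - negCount w - 1, by simp at hr; omega⟩
      have e : r + (posCount w + 0) - (negCount w + 1) = q := by omega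
      simp only [actLetter, if_true] at hj' ⊢
      rw [e]
      rw [hq, pow_succ'] at ha
      split_ifs at hj'
      rw [← Option.some_injective _ hj']
      exact Nat.div_lt_of_lt_mul ha

end IsCuntzSeq

namespace IsCuntzSeq

open CuntzPoly

variable {A : Type*} [CStarAlgebra A] {k : ℕ} {g : ℕ → A}

/-! ### Compression to the part of degree zero -/

theorem star_pow_mul_wordIso (h : IsCuntzSeq k g) {r t : ℕ} (htr : t ≤ r) (j : ℕ) :
    star (g 0 ^ r) * wordIso k g t j = 0 ∨
      star (g 0 ^ r) * wordIso k g t j = star (g 0 ^ (r - t)) := by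
  induction t generalizing r j with
  | zero => right; simp [wordIso]
  | succ t ih =>
    obtain ⟨r, rfl⟩ : ∃ q, r = q + 1 := ⟨r - 1, by omega⟩
    rw [wordIso, pow_succ', star_mul, mul_assoc, ← mul_assoc (star (g 0))]
    by_cases hj : 0 % k = j % k
    · rw [h.congr j 0 hj.symm, h.star_mul_self, one_mul, Nat.add_sub_add_right]
      exact ih (by omega) _
    · left
      rw [h.star_mul_of_ne 0 j hj, zero_mul, mul_zero]

/-- The isometry of a word none of whose shifts overlaps with it. -/
def aperiodic (g : ℕ → A) (r : ℕ) : A := g 0 ^ r * g 1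

theorem star_pow_mul_pow (h : IsCuntzSeq k g) (r : ℕ) : star (g 0 ^ r) * g 0 ^ r = 1 := by
  induction r with
  | zero => simp
  | succ r ih =>
    rw [pow_succ', star_mul, mul_assoc, ← mul_assoc (star (g 0)), h.star_mul_self, one_mul, ih]

theorem star_aperiodic_mul_self (h : IsCuntzSeq k g) (r : ℕ) :
    star (aperiodic g r) * aperiodic g r = 1 := by
  rw [aperiodic, star_mul, mul_assoc, ← mul_assoc (star (g 0 ^ r)), h.star_pow_mul_pow, one_mul,
    h.star_mul_self]

theorem star_one_mul_zero (h : IsCuntzSeq k g) : star (g 1) * g 0 = 0 := by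
  have := h.two_le
  exact h.star_mul_of_ne 1 0 (by rw [Nat.mod_eq_of_lt (by omega)]; simp)

theorem star_aperiodic_mul (h : IsCuntzSeq k g) {r t : ℕ} (ht : 1 ≤ t) (htr : t ≤ r) (j : ℕ) :
    star (aperiodic g r) * wordIso k g t j * aperiodic g r = 0 := by
  rw [aperiodic, star_mul, mul_assoc (star (g 1))]
  rcases h.star_pow_mul_wordIso htr j with e | e
  · rw [e]; simp
  · obtain ⟨t, rfl⟩ : ∃ q, t = q + 1 := ⟨t - 1, by omega⟩
    have e2 : star (g 0 ^ (r - (t + 1))) * g 0 ^ r = g 0 * g 0 ^ t := by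
      rw [← pow_succ', ← one_mul (g 0 ^ (t + 1)), ← h.star_pow_mul_pow (r - (t + 1)), mul_assoc,
        ← pow_add]
      congr 2; omega
    calc _ = star (g 1) * ((star (g 0 ^ (r - (t + 1))) * g 0 ^ r) * g 1) := by
            rw [e]; simp only [mul_assoc]
      _ = star (g 1) * g 0 * (g 0 ^ t * g 1) := by
            rw [e2]; simp only [mul_assoc]
      _ = 0 := by rw [h.star_one_mul_zero, zero_mul]

/-- An isometry which compresses words of length at most `r` to their part of degree zero. -/
def compressor (k : ℕ) (g : ℕ → A) (r : ℕ) : A :=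
  ∑ j ∈ Finset.range (k ^ r), wordIso k g r j * aperiodic g r * star (wordIso k g r j)

theorem star_compressor (r : ℕ) : star (compressor k g r) =
    ∑ j ∈ Finset.range (k ^ r), wordIso k g r j * star (aperiodic g r) *
      star (wordIso k g r j) := by
  simp only [compressor, star_sum, star_mul, star_star, mul_assoc]

theorem star_compressor_mul (h : IsCuntzSeq k g) (r j : ℕ) :
    star (compressor k g r) * wordIso k g r j * aperiodic g r = wordIso k g r j := by
  rw [star_compressor, Finset.sum_mul, Finset.sum_mul]
  conv_rhs => rw [← one_mul (wordIso k g r j), ← h.sum_wordIso r, Finset.sum_mul]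
  refine Finset.sum_congr rfl fun i _ => ?_
  rw [mul_assoc _ (star (wordIso k g r i)), mul_assoc _ (star (wordIso k g r i)),
    h.star_wordIso_mul]
  split_ifs
  · rw [mul_one, mul_one, mul_assoc, h.star_aperiodic_mul_self, mul_one]
  · simp

theorem star_compressor_mul_of_pos (h : IsCuntzSeq k g) {r t : ℕ} (ht : 1 ≤ t) (htr : t ≤ r)
    (j : ℕ) : star (compressor k g r) * wordIso k g (r + t) j * aperiodic g r = 0 := by
  rw [star_compressor, Finset.sum_mul, Finset.sum_mul]
  refine Finset.sum_eq_zero fun i _ => ?_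
  rw [wordIso_add, ← mul_assoc, mul_assoc _ (star (wordIso k g r i)), h.star_wordIso_mul]
  split_ifs
  · rw [mul_one, mul_assoc, mul_assoc, ← mul_assoc (star _), h.star_aperiodic_mul ht htr, mul_zero]
  · simp

theorem compress_of_eq (h : IsCuntzSeq k g) {w : List Letter} {r : ℕ} (hr : w.length ≤ r)
    (hw : posCount w = negCount w) :
    star (compressor k g r) * evalWord g w * compressor k g r = evalWord g w := by
  have hc := posCount_add_negCount w
  rw [compressor, Finset.mul_sum]
  conv_rhs => rw [← mul_one (evalWord g w), ← h.sum_wordIso r, Finset.mul_sum]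
  refine Finset.sum_congr rfl fun i _ => ?_
  rw [← mul_assoc, ← mul_assoc, ← mul_assoc, mul_assoc _ (evalWord g w),
    h.evalWord_mul_wordIso w (by omega), hw, Nat.add_sub_cancel]
  congr 1
  cases act k w i with
  | none => simp
  | some j => exact h.star_compressor_mul r j

theorem compress_of_lt (h : IsCuntzSeq k g) {w : List Letter} {r : ℕ} (hr : w.length ≤ r)
    (hw : negCount w < posCount w) :
    star (compressor k g r) * evalWord g w * compressor k g r = 0 := by
  have hc := posCount_add_negCount w
  conv_lhs => rw [compressor, Finset.mul_sum]
  refine Finset.sum_eq_zero fun i _ => ?_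
  rw [← mul_assoc, ← mul_assoc, mul_assoc _ (evalWord g w),
    h.evalWord_mul_wordIso w (by omega), Nat.add_sub_assoc hw.le]
  cases act k w i with
  | none => simp
  | some j =>
    rw [Option.elim_some]
    have := h.star_compressor_mul_of_pos (r := r) (t := posCount w - negCount w) (by omega)
      (by omega) j
    rw [compressor] at this
    rw [this, zero_mul]

theorem posCount_starWord (w : List Letter) : posCount (starWord w) = negCount w := by
  simp only [posCount, starWord, List.filter_reverse, List.length_reverse, List.filter_map,
    List.length_map, negCount]
  congr 2
  funext l
  simp

theorem negCount_starWord (w : List Letter) : negCount (starWord w) = posCount w := by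
  simp only [posCount, starWord, List.filter_reverse, List.length_reverse, List.filter_map,
    List.length_map, negCount]
  congr 2
  funext l
  simp

theorem compress_of_ne (h : IsCuntzSeq k g) {w : List Letter} {r : ℕ} (hr : w.length ≤ r)
    (hw : posCount w ≠ negCount w) :
    star (compressor k g r) * evalWord g w * compressor k g r = 0 := by
  rcases hw.lt_or_gt with hw | hw
  · have := h.compress_of_lt (w := starWord w) (r := r) (by simpa [starWord] using hr)
      (by rwa [posCount_starWord, negCount_starWord])
    rw [evalWord_starWord] at this
    have := congrArg star this
    simpa [mul_assoc] using this
  · exact h.compress_of_lt hr hw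

theorem eval_balanced (h : IsCuntzSeq k g) {p : CuntzPoly} {r : ℕ} (hp : LengthLE p r) :
    eval g (balanced p) = star (compressor k g r) * eval g p * compressor k g r := by
  induction p with
  | nil => simp [balanced]
  | cons a p ih =>
    have ih := ih fun b hb => hp b (List.mem_cons_of_mem _ hb)
    have ha := hp a List.mem_cons_self
    rw [eval_cons, mul_add, add_mul, ← ih, mul_smul_comm, smul_mul_assoc]
    by_cases hw : posCount a.2 = negCount a.2
    · rw [h.compress_of_eq ha hw]
      simp [balanced, hw]
    · rw [h.compress_of_ne ha hw]
      simp [balanced, hw]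

theorem norm_compressor_sq (h : IsCuntzSeq k g) (r : ℕ) :
    ‖compressor k g r‖ ≤ 1 := by
  have h0 := h.compress_of_eq (w := []) (r := r) (by simp) rfl
  simp only [evalWord_nil, mul_one] at h0
  have h1 := CStarRing.norm_star_mul_self (x := compressor k g r)
  rw [h0] at h1
  have h2 := CStarRing.norm_star_mul_self (x := (1 : A))
  rw [star_one, mul_one] at h2
  have h3 : ‖(1 : A)‖ ≤ 1 := by nlinarith [norm_nonneg (1 : A)]
  nlinarith [norm_nonneg (compressor k g r)]

theorem norm_eval_balanced_le (h : IsCuntzSeq k g) (p : CuntzPoly) :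
    ‖eval g (balanced p)‖ ≤ ‖eval g p‖ := by
  obtain ⟨r, hr⟩ : ∃ r, LengthLE p r := by
    refine ⟨(p.map fun a => a.2.length).sum, fun a ha => ?_⟩
    exact List.single_le_sum (by simp) _ (List.mem_map.2 ⟨a, ha, rfl⟩)
  rw [h.eval_balanced hr]
  calc _ ≤ ‖star (compressor k g r)‖ * ‖eval g p‖ * ‖compressor k g r‖ := norm_mul₃_le
    _ ≤ 1 * ‖eval g p‖ * 1 := by
        rw [norm_star]
        gcongr <;> exact h.norm_compressor_sq r
    _ = _ := by ring

/-! ### Matrix coefficients -/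

/-- A word which permutes the words of length `m`, where it is defined. -/
def ActsOn (k : ℕ) (g : ℕ → A) (m : ℕ) (w : List Letter) : Prop :=
  ∀ j, j < k ^ m → evalWord g w * wordIso k g m j = (act k w j).elim 0 (wordIso k g m) ∧
    ∀ j' ∈ act k w j, j' < k ^ m

theorem actsOn (h : IsCuntzSeq k g) {m : ℕ} {w : List Letter} (hw : posCount w = negCount w)
    (hm : w.length ≤ m) : ActsOn k g m w := by
  have hc := posCount_add_negCount w
  intro j hj
  refine ⟨?_, fun j' hj' => ?_⟩
  · rw [h.evalWord_mul_wordIso w (by omega), hw, Nat.add_sub_cancel]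
  · have := h.act_lt w (by omega) hj hj'
    rwa [hw, Nat.add_sub_cancel] at this

theorem actsOn_nil (m : ℕ) : ActsOn k g m [] := by
  intro j hj
  refine ⟨by simp [act], fun j' hj' => ?_⟩
  obtain rfl : j = j' := Option.some_injective _ hj'
  exact hj

theorem ActsOn.append {m : ℕ} {v w : List Letter} (hv : ActsOn k g m v) (hw : ActsOn k g m w) :
    ActsOn k g m (v ++ w) := by
  intro j hj
  obtain ⟨h1, h2⟩ := hw j hj
  rw [evalWord_append, mul_assoc, h1, act_append]
  cases hj' : act k w j with
  | none => simp
  | some j' =>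
    rw [hj'] at h2
    exact hv j' (h2 j' rfl)

theorem actsOn_pow {m : ℕ} {p : CuntzPoly} (hp : ∀ a ∈ p, ActsOn k g m a.2) (n : ℕ) :
    ∀ a ∈ pow p n, ActsOn k g m a.2 := by
  induction n with
  | zero =>
    intro a ha
    obtain rfl : a = (GaussCode.one, []) := List.mem_singleton.1 ha
    exact actsOn_nil m
  | succ n ih =>
    intro a ha
    have ha : a ∈ mul (pow p n) p := ha
    simp only [CuntzPoly.mul, List.mem_flatMap, List.mem_map] at ha
    obtain ⟨b, hb, c, hc, rfl⟩ := ha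
    exact (ih b hb).append (hp c hc)

/-- A matrix coefficient of a polynomial. -/
def entry (k : ℕ) (p : CuntzPoly) (i j : ℕ) : ℂ :=
  ((p.filter fun a => act k a.2 j = some i).map fun a => GaussCode.toComplex a.1).sum

theorem entry_cons (k : ℕ) (a : GaussCode × List Letter) (p : CuntzPoly) (i j : ℕ) :
    entry k (a :: p) i j =
      (if act k a.2 j = some i then GaussCode.toComplex a.1 else 0) + entry k p i j := by
  unfold entry
  by_cases h : act k a.2 j = some i <;> simp [h]

theorem eval_mul_wordIso {m : ℕ} {p : CuntzPoly} (hp : ∀ a ∈ p, ActsOn k g m a.2)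
    {j : ℕ} (hj : j < k ^ m) : eval g p * wordIso k g m j =
      ∑ i ∈ Finset.range (k ^ m), entry k p i j • wordIso k g m i := by
  induction p with
  | nil => simp [entry]
  | cons a p ih =>
    have ih := ih fun b hb => hp b (List.mem_cons_of_mem _ hb)
    obtain ⟨h1, h2⟩ := hp a List.mem_cons_self j hj
    simp only [eval_cons, add_mul, ih, smul_mul_assoc, h1, entry_cons, add_smul,
      Finset.sum_add_distrib]
    congr 1
    cases hj' : act k a.2 j with
    | none => simp
    | some j' =>
      have := h2 j' hj'
      simp [ite_smul, this]

theorem norm_entry_le [Nontrivial A] (h : IsCuntzSeq k g) {m : ℕ} {p : CuntzPoly}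
    (hp : ∀ a ∈ p, ActsOn k g m a.2) {i j : ℕ} (hi : i < k ^ m) (hj : j < k ^ m) :
    ‖entry k p i j‖ ≤ ‖eval g p‖ := by
  have e : star (wordIso k g m i) * (eval g p * wordIso k g m j) = algebraMap ℂ A
      (entry k p i j) := by
    rw [eval_mul_wordIso hp hj, Finset.mul_sum, Finset.sum_eq_single_of_mem i
      (Finset.mem_range.2 hi), mul_smul_comm, h.star_wordIso_mul_self, Algebra.algebraMap_eq_smul_one]
    intro l hl hli
    rw [mul_smul_comm, h.star_wordIso_mul_of_lt hi (Finset.mem_range.1 hl), if_neg hli.symm,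
      smul_zero]
  rw [← norm_algebraMap' A (entry k p i j), ← e]
  calc _ ≤ ‖star (wordIso k g m i)‖ * (‖eval g p‖ * ‖wordIso k g m j‖) :=
        (norm_mul_le _ _).trans (by gcongr; exact norm_mul_le _ _)
    _ ≤ 1 * (‖eval g p‖ * 1) := by
        rw [norm_star]
        gcongr <;> exact h.norm_wordIso_le _ _
    _ = _ := by ring

theorem norm_eval_le (h : IsCuntzSeq k g) {m : ℕ} {p : CuntzPoly}
    (hp : ∀ a ∈ p, ActsOn k g m a.2) : ‖eval g p‖ ≤
      ∑ i ∈ Finset.range (k ^ m), ∑ j ∈ Finset.range (k ^ m), ‖entry k p i j‖ := by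
  conv_lhs => rw [← mul_one (eval g p), ← h.sum_wordIso m, Finset.mul_sum]
  rw [Finset.sum_comm]
  refine (norm_sum_le _ _).trans (Finset.sum_le_sum fun j hj => ?_)
  rw [← mul_assoc]
  have h1 : ‖eval g p * wordIso k g m j‖ ≤ ∑ i ∈ Finset.range (k ^ m), ‖entry k p i j‖ := by
    rw [eval_mul_wordIso hp (Finset.mem_range.1 hj)]
    refine (norm_sum_le _ _).trans (Finset.sum_le_sum fun i _ => ?_)
    rw [norm_smul]
    exact mul_le_of_le_one_right (norm_nonneg _) (h.norm_wordIso_le _ _)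
  calc _ ≤ ‖eval g p * wordIso k g m j‖ * ‖star (wordIso k g m j)‖ := norm_mul_le _ _
    _ ≤ (∑ i ∈ Finset.range (k ^ m), ‖entry k p i j‖) * 1 := by
        rw [norm_star]
        gcongr
        exact h.norm_wordIso_le _ _
    _ = _ := mul_one _

theorem toRat_entrySize (k : ℕ) (p : CuntzPoly) (i j : ℕ) :
    ((entrySize k p i j).toRat : ℝ) = |(entry k p i j).re| + |(entry k p i j).im| := by
  have hre : ∀ l : List (GaussCode × List Letter),
      (l.map fun a => GaussCode.toComplex a.1).sum.re =
        (((l.map fun a => a.1.1).map RatCode.toRat).sum : ℚ) := by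
    intro l
    induction l with
    | nil => simp
    | cons a l ih =>
      simp only [List.map_cons, List.sum_cons, Complex.add_re, ih, Rat.cast_add]
      rfl
  have him : ∀ l : List (GaussCode × List Letter),
      (l.map fun a => GaussCode.toComplex a.1).sum.im =
        (((l.map fun a => a.1.2).map RatCode.toRat).sum : ℚ) := by
    intro l
    induction l with
    | nil => simp
    | cons a l ih =>
      simp only [List.map_cons, List.sum_cons, Complex.add_im, ih, Rat.cast_add]
      rfl
  rw [entrySize, entry, hre, him, RatCode.toRat_add, RatCode.toRat_abs, RatCode.toRat_abs,
    RatCode.toRat_sum, RatCode.toRat_sum]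
  push_cast
  rfl

theorem toRat_matrixSize (k m : ℕ) (p : CuntzPoly) : ((matrixSize k m p).toRat : ℝ) =
    ∑ i ∈ Finset.range (k ^ m), ∑ j ∈ Finset.range (k ^ m),
      (|(entry k p i j).re| + |(entry k p i j).im|) := by
  simp only [← toRat_entrySize]
  rw [matrixSize, RatCode.toRat_sum, List.map_flatMap, List.flatMap_def, List.sum_flatten]
  simp only [List.map_map, Function.comp_def]
  have e : ∀ (n : ℕ) (f : ℕ → ℚ), ((List.range n).map f).sum = ∑ i ∈ Finset.range n, f i :=
    fun n f => rfl
  simp only [e]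
  push_cast
  rfl

theorem norm_le_matrixSize (h : IsCuntzSeq k g) {m : ℕ} {p : CuntzPoly}
    (hp : ∀ a ∈ p, ActsOn k g m a.2) : ‖eval g p‖ ≤ (matrixSize k m p).toRat := by
  rw [toRat_matrixSize]
  refine (h.norm_eval_le hp).trans ?_
  gcongr
  exact Complex.norm_le_abs_re_add_abs_im _

theorem matrixSize_le [Nontrivial A] (h : IsCuntzSeq k g) {m : ℕ} {p : CuntzPoly}
    (hp : ∀ a ∈ p, ActsOn k g m a.2) :
    (matrixSize k m p).toRat ≤ 2 * k ^ (2 * m) * ‖eval g p‖ := by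
  rw [toRat_matrixSize]
  have : ∀ i ∈ Finset.range (k ^ m), ∀ j ∈ Finset.range (k ^ m),
      |(entry k p i j).re| + |(entry k p i j).im| ≤ 2 * ‖eval g p‖ := by
    intro i hi j hj
    have h1 := h.norm_entry_le hp (Finset.mem_range.1 hi) (Finset.mem_range.1 hj)
    have h2 := Complex.abs_re_le_norm (entry k p i j)
    have h3 := Complex.abs_im_le_norm (entry k p i j)
    linarith
  refine (Finset.sum_le_sum fun i hi => Finset.sum_le_sum (this i hi)).trans_eq ?_
  simp only [Finset.sum_const, Finset.card_range, nsmul_eq_mul]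
  push_cast
  ring

end IsCuntzSeq

/-! ## The gauge action -/

namespace CuntzAlgebra

open CuntzPoly

variable {k : ℕ}

/-- The periodic sequence of generators of the Cuntz algebra. -/
def genSeq (hk : 2 ≤ k) : ℕ → CuntzAlgebra k := CuntzRel.seq hk gen

theorem isCuntzSeq_genSeq (hk : 2 ≤ k) : IsCuntzSeq k (genSeq hk) :=
  (cuntzRel_gen k).isCuntzSeq hk

theorem cuntzRel_smul {A : Type*} [CStarAlgebra A] {s : Fin k → A} (hs : CuntzRel s) {z : ℂ}
    (hz : ‖z‖ = 1) : CuntzRel fun i => z • s i where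
  isometry i := by
    have : star z * z = 1 := by
      have := RCLike.conj_mul z
      rw [hz] at this
      simpa using this
    rw [star_smul, smul_mul_smul_comm, this, one_smul, hs.isometry]
  sum_range := by
    have : z * star z = 1 := by
      have := RCLike.mul_conj z
      rw [hz] at this
      simpa using this
    simp only [star_smul, smul_mul_smul_comm, this, one_smul, hs.sum_range]

/-- The gauge automorphism which multiplies the generators by a complex number of modulus one. -/
def gauge (z : ℂ) (hz : ‖z‖ = 1) : CuntzAlgebra k →⋆ₐ[ℂ] CuntzAlgebra k :=
  (existsUnique_lift (cuntzRel_smul (cuntzRel_gen k) hz)).choose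

theorem gauge_gen (z : ℂ) (hz : ‖z‖ = 1) (i : Fin k) : gauge z hz (gen i) = z • gen i :=
  (existsUnique_lift (cuntzRel_smul (cuntzRel_gen k) hz)).choose_spec.1 i

theorem gauge_evalWord (hk : 2 ≤ k) (z : ℂ) (hz : ‖z‖ = 1) (w : List Letter) :
    gauge z hz (evalWord (genSeq hk) w) =
      (z ^ posCount w * star z ^ negCount w) • evalWord (genSeq hk) w := by
  induction w with
  | nil => simp [posCount, negCount]
  | cons l w ih =>
    obtain ⟨i, b⟩ := l
    rw [evalWord_cons, map_mul, ih, IsCuntzSeq.posCount_cons, IsCuntzSeq.negCount_cons]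
    cases b
    · simp only [evalLetter, genSeq, CuntzRel.seq, gauge_gen, Bool.false_eq_true, if_false,
        smul_mul_smul_comm, pow_succ', add_zero, mul_assoc]
    · simp only [evalLetter, genSeq, CuntzRel.seq, map_star, gauge_gen, if_true,
        smul_mul_smul_comm, pow_succ', add_zero, star_smul]
      congr 1
      ring

theorem sum_unit_pow {N : ℕ} {ζ : ℂ} (hζ : IsPrimitiveRoot ζ N) {a b : ℕ} (ha : a < N)
    (hb : b < N) (hN : ‖ζ‖ = 1) :
    ∑ j ∈ Finset.range N, (ζ ^ j) ^ a * star (ζ ^ j) ^ b = if a = b then (N : ℂ) else 0 := by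
  have hs : ζ * star ζ = 1 := by
    have := RCLike.mul_conj ζ
    rw [hN] at this
    simpa using this
  have e : ∀ j, (ζ ^ j) ^ a * star (ζ ^ j) ^ b = (ζ ^ a * star ζ ^ b) ^ j := fun j => by
    rw [star_pow, mul_pow]; ring
  simp only [e]
  split_ifs with hab
  · subst hab
    simp only [← mul_pow, hs, one_pow]
    simp
  · have h1 : ζ ^ a * star ζ ^ b ≠ 1 := fun h => by
      apply hab
      apply hζ.pow_inj ha hb
      calc ζ ^ a = ζ ^ a * (ζ * star ζ) ^ b := by rw [hs, one_pow, mul_one]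
        _ = ζ ^ b * (ζ ^ a * star ζ ^ b) := by rw [mul_pow]; ring
        _ = ζ ^ b := by rw [h, mul_one]
    have h2 : (ζ ^ a * star ζ ^ b) ^ N = 1 := by
      rw [mul_pow, ← pow_mul, ← pow_mul, mul_comm a, mul_comm b, pow_mul, pow_mul, ← star_pow,
        hζ.pow_eq_one]
      simp
    have h3 := geom_sum_mul (ζ ^ a * star ζ ^ b) N
    rw [h2, sub_self] at h3
    exact (mul_eq_zero.1 h3).resolve_right (sub_ne_zero.2 h1)

/-- The average of the gauge action over roots of unity. -/
theorem sum_gauge_eval (hk : 2 ≤ k) {N : ℕ} {ζ : ℂ} (hζ : IsPrimitiveRoot ζ N)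
    (hζ1 : ∀ j, ‖ζ ^ j‖ = 1) {p : CuntzPoly} {d : ℕ} (hd : d < N) (hp : LengthLE p d) :
    ∑ j ∈ Finset.range N, gauge (ζ ^ j) (hζ1 j) (eval (genSeq hk) p) =
      (N : ℂ) • eval (genSeq hk) (balanced p) := by
  induction p with
  | nil => simp [balanced]
  | cons a p ih =>
    have ih := ih fun b hb => hp b (List.mem_cons_of_mem _ hb)
    have ha := hp a List.mem_cons_self
    have hc := IsCuntzSeq.posCount_add_negCount a.2
    simp only [eval_cons, map_add, map_smul, gauge_evalWord, Finset.sum_add_distrib, ih]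
    rw [← Finset.smul_sum, ← Finset.sum_smul, sum_unit_pow hζ (by omega) (by omega)
      (by simpa using hζ1 1)]
    by_cases hw : posCount a.2 = negCount a.2
    · have e : balanced (a :: p) = a :: balanced p := by simp [balanced, hw]
      rw [e, eval_cons, if_pos hw, smul_add, smul_comm]
    · simp [balanced, hw]

open scoped ComplexOrder in
theorem norm_sq_le_balanced (hk : 2 ≤ k) {p : CuntzPoly} {d : ℕ} (hp : LengthLE p d) :
    ‖eval (genSeq hk) p‖ ^ 2 ≤
      (2 * d + 1) * ‖eval (genSeq hk) (balanced (mul (adj p) p))‖ ∧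
    IsSelfAdjoint (eval (genSeq hk) (balanced (mul (adj p) p))) := by
  let _ := CStarAlgebra.spectralOrder (CuntzAlgebra k)
  have _ := CStarAlgebra.spectralOrderedRing (CuntzAlgebra k)
  set N := 2 * d + 1 with hN
  have hN0 : N ≠ 0 := by omega
  have hζ := Complex.isPrimitiveRoot_exp N hN0
  set ζ := Complex.exp (2 * Real.pi * Complex.I / N)
  have hζ1 : ∀ j, ‖ζ ^ j‖ = 1 := fun j => by
    rw [norm_pow, hζ.norm'_eq_one hN0, one_pow]
  have hs := sum_gauge_eval hk hζ hζ1 (p := mul (adj p) p) (d := d + d) (by omega)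
    (hp.adj.mul hp)
  have hs' : ∀ j, gauge (ζ ^ j) (hζ1 j) (eval (genSeq hk) (mul (adj p) p)) =
      star (gauge (ζ ^ j) (hζ1 j) (eval (genSeq hk) p)) *
        gauge (ζ ^ j) (hζ1 j) (eval (genSeq hk) p) := fun j => by
    rw [eval_mul, eval_adj, map_mul, map_star]
  simp only [hs'] at hs
  have h0 : gauge (ζ ^ 0) (hζ1 0) (eval (genSeq hk) p) = eval (genSeq hk) p := by
    have : ∀ p : CuntzPoly, gauge (ζ ^ 0) (hζ1 0) (eval (genSeq hk) p) = eval (genSeq hk) p := by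
      intro p
      induction p with
      | nil => simp
      | cons a p ih =>
        rw [eval_cons, map_add, map_smul, gauge_evalWord, ih, pow_zero]
        simp
    exact this p
  constructor
  · have h1 : star (eval (genSeq hk) p) * eval (genSeq hk) p ≤
        (N : ℂ) • eval (genSeq hk) (balanced (mul (adj p) p)) := by
      rw [← hs]
      have := Finset.single_le_sum (f := fun j => star (gauge (ζ ^ j) (hζ1 j)
        (eval (genSeq hk) p)) * gauge (ζ ^ j) (hζ1 j) (eval (genSeq hk) p))
        (fun j _ => star_mul_self_nonneg _) (Finset.mem_range.2 (Nat.pos_of_ne_zero hN0))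
      simpa only [h0] using this
    have h2 := CStarAlgebra.norm_le_norm_of_nonneg_of_le (star_mul_self_nonneg _) h1
    rw [CStarRing.norm_star_mul_self, norm_smul, ← sq] at h2
    refine h2.trans_eq ?_
    rw [Complex.norm_natCast, hN]
    push_cast
    rfl
  · have h1 : IsSelfAdjoint ((N : ℂ) • eval (genSeq hk) (balanced (mul (adj p) p))) := by
      rw [← hs]
      simp [IsSelfAdjoint, star_sum]
    have h2 : eval (genSeq hk) (balanced (mul (adj p) p)) =
        ((N : ℂ)⁻¹) • ((N : ℂ) • eval (genSeq hk) (balanced (mul (adj p) p))) := by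
      rw [smul_smul, inv_mul_cancel₀ (by exact_mod_cast hN0), one_smul]
    rw [h2]
    refine IsSelfAdjoint.smul ?_ h1
    simp [IsSelfAdjoint]

end CuntzAlgebra

/-! ## Two-sided bounds for the norm -/

namespace CuntzPoly

/-- The part of degree zero of a high power of `x* x`. -/
def core (n : ℕ) (p : CuntzPoly) : CuntzPoly :=
  balanced (mul (adj (pow (mul (adj p) p) n)) (pow (mul (adj p) p) n))

/-- An approximation to `‖x‖ ^ (4 n ^ 2)`, for polynomials of degree at most `d`. -/
def normApprox (k d n : ℕ) (p : CuntzPoly) : RatCode :=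
  matrixSize k (4 * d * n) (pow (core n p) n)

theorem LengthLE.core {p : CuntzPoly} {d : ℕ} (hp : LengthLE p d) (n : ℕ) :
    LengthLE (core n p) (4 * d * n) := by
  have h := (hp.adj.mul hp).pow n
  exact (h.adj.mul h).balanced.mono (by nlinarith)

theorem posCount_of_mem_core {p : CuntzPoly} {n : ℕ} {a : GaussCode × List Letter}
    (ha : a ∈ core n p) : posCount a.2 = negCount a.2 := by
  simpa using (List.mem_filter.1 ha).2

theorem actsOn_core {A : Type*} [CStarAlgebra A] {k : ℕ} {g : ℕ → A} (h : IsCuntzSeq k g)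
    {p : CuntzPoly} {d : ℕ} (hp : LengthLE p d) (n : ℕ) :
    ∀ a ∈ pow (core n p) n, IsCuntzSeq.ActsOn k g (4 * d * n) a.2 :=
  IsCuntzSeq.actsOn_pow (fun a ha => h.actsOn (posCount_of_mem_core ha) (hp.core n a ha)) n

theorem normApprox_le {A : Type*} [CStarAlgebra A] [Nontrivial A] {k : ℕ} {g : ℕ → A}
    (h : IsCuntzSeq k g) {p : CuntzPoly} {d : ℕ} (hp : LengthLE p d) (n : ℕ) :
    (normApprox k d n p).toRat ≤ 2 * k ^ (8 * d * n) * ‖eval g p‖ ^ (4 * n ^ 2) := by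
  refine (h.matrixSize_le (actsOn_core h hp n)).trans ?_
  rw [eval_pow, show 2 * (4 * d * n) = 8 * d * n by ring]
  gcongr
  have h2 : ‖eval g (core n p)‖ ≤ ‖eval g p‖ ^ (4 * n) := by
    refine (h.norm_eval_balanced_le _).trans ?_
    rw [eval_mul, eval_adj, CStarRing.norm_star_mul_self, eval_pow, eval_mul, eval_adj]
    have h3 : ‖(star (eval g p) * eval g p) ^ n‖ ≤ ‖eval g p‖ ^ (2 * n) := by
      refine (norm_pow_le _ n).trans_eq ?_
      rw [CStarRing.norm_star_mul_self, ← sq, pow_mul]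
    calc _ ≤ ‖eval g p‖ ^ (2 * n) * ‖eval g p‖ ^ (2 * n) := by gcongr
      _ = _ := by rw [← pow_add]; congr 1; ring
  calc _ ≤ ‖eval g (core n p)‖ ^ n := norm_pow_le _ n
    _ ≤ (‖eval g p‖ ^ (4 * n)) ^ n := by gcongr
    _ = _ := by rw [← pow_mul]; congr 1; ring

theorem le_normApprox {k : ℕ} (hk : 2 ≤ k) {p : CuntzPoly} {d : ℕ} (hp : LengthLE p d) (a : ℕ) :
    ‖eval (CuntzAlgebra.genSeq hk) p‖ ^ (4 * (2 ^ a) ^ 2) ≤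
      (4 * d * 2 ^ a + 1) ^ 2 ^ a * (normApprox k d (2 ^ a) p).toRat := by
  set g := CuntzAlgebra.genSeq hk
  set n := 2 ^ a with hn
  have h := CuntzAlgebra.isCuntzSeq_genSeq hk
  have h1 := CuntzAlgebra.norm_sq_le_balanced hk ((hp.adj.mul hp).pow n)
  have h2 : ‖eval g (pow (mul (adj p) p) n)‖ = ‖eval g p‖ ^ (2 * n) := by
    rw [eval_pow, hn, eval_mul, eval_adj,
      (IsSelfAdjoint.star_mul_self (eval g p)).norm_pow_two_pow, CStarRing.norm_star_mul_self,
      ← sq, ← pow_mul]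
  have h3 : ‖eval g (pow (core n p) n)‖ = ‖eval g (core n p)‖ ^ n := by
    rw [eval_pow, hn]
    exact h1.2.norm_pow_two_pow a
  have h4 := h.norm_le_matrixSize (actsOn_core h hp n)
  have h5 : ‖eval g p‖ ^ (4 * n) ≤ (4 * d * n + 1) * ‖eval g (core n p)‖ := by
    refine le_of_eq_of_le ?_ (h1.1.trans_eq ?_)
    · rw [h2, ← pow_mul]; congr 1; ring
    · push_cast
      rw [core]
      congr 1
      ring
  calc _ = (‖eval g p‖ ^ (4 * n)) ^ n := by
        rw [← pow_mul ‖eval g p‖ (4 * n) n, show 4 * n * n = 4 * (2 ^ a) ^ 2 by rw [hn]; ring]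
    _ ≤ ((4 * d * n + 1) * ‖eval g (core n p)‖) ^ n := by gcongr
    _ = (4 * d * n + 1) ^ n * ‖eval g (pow (core n p) n)‖ := by rw [mul_pow, h3]
    _ ≤ (4 * d * n + 1) ^ n * (normApprox k d n p).toRat := by gcongr; exact h4
    _ = _ := by rw [hn]; push_cast; rfl

end CuntzPoly

/-! ## Simplicity of the Cuntz algebras -/

/-- A bound for the error factors of the approximations to `4 n ^ 2`-th powers of norms. -/
def normBound (k d P n : ℕ) : ℕ := (4 * d * n + 1) ^ n * (2 * k ^ (8 * d * n)) * P

theorem normBound_le (k d P : ℕ) {n : ℕ} (hn : 1 ≤ n) :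
    normBound k d P n ≤ ((4 * d + 1) * (2 * (k + 1) ^ (8 * d)) * (P + 1) * n) ^ n := by
  have h1 : (4 * d * n + 1) ^ n ≤ ((4 * d + 1) * n) ^ n := by gcongr; nlinarith
  have h2 : 2 * k ^ (8 * d * n) ≤ (2 * (k + 1) ^ (8 * d)) ^ n := by
    rw [mul_pow, ← pow_mul]
    gcongr
    · exact Nat.le_self_pow (by omega) 2
    · omega
  have h3 : P ≤ (P + 1) ^ n := (Nat.le_succ P).trans (Nat.le_self_pow (by omega) _)
  calc _ ≤ ((4 * d + 1) * n) ^ n * (2 * (k + 1) ^ (8 * d)) ^ n * (P + 1) ^ n := by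
        unfold normBound; gcongr
    _ = _ := by rw [← mul_pow, ← mul_pow]; congr 1; ring

theorem exists_normBound_sq_lt (k d P : ℕ) {c : ℝ} (hc : 1 < c) :
    ∃ a : ℕ, (normBound k d P (2 ^ a) : ℝ) ^ 2 < c ^ (4 * (2 ^ a) ^ 2) := by
  set Q : ℕ := (4 * d + 1) * (2 * (k + 1) ^ (8 * d)) * (P + 1) with hQ
  have h1 : Tendsto (fun n : ℕ => (Q : ℝ) ^ 2 * ((n : ℝ) ^ 2 / (c ^ 4) ^ n)) atTop (𝓝 (Q ^ 2 * 0)) :=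
    (tendsto_pow_const_div_const_pow_of_one_lt 2 (one_lt_pow₀ hc (by norm_num))).const_mul _
  rw [mul_zero] at h1
  have h2 := h1.comp (tendsto_pow_atTop_atTop_of_one_lt (one_lt_two (α := ℕ)))
  obtain ⟨a, ha⟩ := (h2.eventually (gt_mem_nhds one_pos)).exists
  refine ⟨a, ?_⟩
  simp only [Function.comp_apply] at ha
  set n : ℕ := 2 ^ a with hn
  have hn1 : 1 ≤ n := Nat.one_le_two_pow
  have hc0 : 0 < c := by linarith
  rw [← mul_div_assoc, div_lt_one (by positivity)] at ha
  have h3 : (normBound k d P n : ℝ) ≤ ((Q : ℝ) * n) ^ n := by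
    exact_mod_cast normBound_le k d P hn1
  calc (normBound k d P n : ℝ) ^ 2 ≤ (((Q : ℝ) * n) ^ n) ^ 2 := by gcongr
    _ = ((Q : ℝ) ^ 2 * (n : ℝ) ^ 2) ^ n := by rw [← pow_mul, mul_comm n 2, pow_mul, mul_pow]
    _ < ((c ^ 4) ^ n) ^ n := by
        apply pow_lt_pow_left₀ ha (by positivity) (by omega)
    _ = _ := by rw [← pow_mul, ← pow_mul]; congr 1; ring

namespace CuntzAlgebra

open CuntzPoly

variable {k : ℕ}

theorem map_eval {A B : Type*} [CStarAlgebra A] [CStarAlgebra B] (φ : A →⋆ₐ[ℂ] B) (g : ℕ → A)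
    (p : CuntzPoly) : φ (eval g p) = eval (fun i => φ (g i)) p := by
  have hw : ∀ w : List Letter, φ (evalWord g w) = evalWord (fun i => φ (g i)) w := by
    intro w
    induction w with
    | nil => simp
    | cons l w ih =>
      obtain ⟨i, b⟩ := l
      cases b <;> simp [ih, evalLetter, map_star]
  induction p with
  | nil => simp
  | cons a p ih => simp [ih, hw, map_smul]

theorem norm_map_eval {A : Type*} [CStarAlgebra A] [Nontrivial A] (hk : 2 ≤ k)
    (φ : CuntzAlgebra k →⋆ₐ[ℂ] A) (p : CuntzPoly) :
    ‖φ (eval (genSeq hk) p)‖ = ‖eval (genSeq hk) p‖ := by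
  refine le_antisymm (NonUnitalStarAlgHom.norm_apply_le φ _) ?_
  have ht : CuntzRel fun i => φ (gen i) :=
    { isometry := fun i => by
        rw [← map_star, ← map_mul, (cuntzRel_gen k).isometry, map_one]
      sum_range := by
        simp only [← map_star, ← map_mul, ← map_sum, (cuntzRel_gen k).sum_range, map_one] }
  have hg := ht.isCuntzSeq hk
  obtain ⟨d, hd⟩ : ∃ d, LengthLE p d :=
    ⟨(p.map fun a => a.2.length).sum, fun a ha =>
      List.single_le_sum (by simp) _ (List.mem_map.2 ⟨a, ha, rfl⟩)⟩
  have e : φ (eval (genSeq hk) p) = eval (CuntzRel.seq hk fun i => φ (gen i)) p := map_eval _ _ _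
  rw [e]
  set u := ‖eval (genSeq hk) p‖ with hu
  set v := ‖eval (CuntzRel.seq hk fun i => φ (gen i)) p‖ with hv
  by_contra hlt
  rw [not_le] at hlt
  have hv0 : 0 ≤ v := norm_nonneg _
  have key : ∀ a : ℕ, u ^ (4 * (2 ^ a) ^ 2) ≤
      normBound k d 1 (2 ^ a) * v ^ (4 * (2 ^ a) ^ 2) := fun a => by
    refine (le_normApprox hk hd a).trans ?_
    have := normApprox_le hg hd (2 ^ a)
    calc _ ≤ ((4 * d * 2 ^ a + 1) ^ 2 ^ a : ℝ) *
          (2 * k ^ (8 * d * 2 ^ a) * v ^ (4 * (2 ^ a) ^ 2)) := by gcongr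
      _ = _ := by rw [normBound]; push_cast; ring
  rcases hv0.eq_or_lt with h0 | h0
  · have := key 0
    rw [← h0] at this
    simp at this
    have h1 : 0 < u ^ 4 := by rw [← h0] at hlt; positivity
    linarith
  · obtain ⟨a, ha⟩ := exists_normBound_sq_lt k d 1 ((one_lt_div h0).2 hlt)
    have h1 := key a
    rw [div_pow, lt_div_iff₀ (by positivity)] at ha
    have h2 : (1 : ℝ) ≤ normBound k d 1 (2 ^ a) := by
      have : 0 < normBound k d 1 (2 ^ a) := by
        have : 0 < k := by omega
        unfold normBound; positivity
      exact_mod_cast this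
    have h3 : (normBound k d 1 (2 ^ a) : ℝ) ≤ (normBound k d 1 (2 ^ a) : ℝ) ^ 2 := by nlinarith
    have h4 : 0 < v ^ (4 * (2 ^ a) ^ 2) := by positivity
    nlinarith [mul_le_mul_of_nonneg_right h3 h4.le]

theorem mem_closure_rational (hk : 2 ≤ k) (x : CuntzAlgebra k) :
    x ∈ closure (Set.range (eval (genSeq hk))) := by
  set S := Set.range (eval (genSeq hk))
  have hadd : ∀ x ∈ closure S, ∀ y ∈ closure S, x + y ∈ closure S := fun x hx y hy =>
    map_mem_closure₂ continuous_add hx hy (by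
      rintro _ ⟨p, rfl⟩ _ ⟨q, rfl⟩
      exact ⟨p ++ q, eval_append _ _ _⟩)
  have hmul : ∀ x ∈ closure S, ∀ y ∈ closure S, x * y ∈ closure S := fun x hx y hy =>
    map_mem_closure₂ continuous_mul hx hy (by
      rintro _ ⟨p, rfl⟩ _ ⟨q, rfl⟩
      exact ⟨CuntzPoly.mul p q, eval_mul _ _ _⟩)
  have hscal : ∀ r : ℂ, algebraMap ℂ (CuntzAlgebra k) r ∈ closure S := by
    intro r
    have hd : DenseRange fun q : ℚ × ℚ => (⟨(q.1 : ℝ), (q.2 : ℝ)⟩ : ℂ) := by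
      have h := (Rat.isDenseEmbedding_coe_real.dense.prodMap Rat.isDenseEmbedding_coe_real.dense)
      exact Complex.equivRealProdCLM.symm.surjective.denseRange.comp h
        Complex.equivRealProdCLM.symm.continuous
    have hr := map_mem_closure (continuous_algebraMap ℂ (CuntzAlgebra k)) (hd r)
      (t := S) (by
        rintro _ ⟨q, rfl⟩
        obtain ⟨c1, h1⟩ := RatCode.exists_toRat q.1
        obtain ⟨c2, h2⟩ := RatCode.exists_toRat q.2
        refine ⟨[((c1, c2), [])], ?_⟩
        simp [GaussCode.toComplex, h1, h2, Algebra.algebraMap_eq_smul_one])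
    exact hr
  have hlet : ∀ l : Fin k × Bool, ofFree k (FreeStarAlg.letter l) ∈ S := by
    rintro ⟨i, b⟩
    refine ⟨[(GaussCode.one, [((i : ℕ), b)])], ?_⟩
    have hi : genSeq hk i = gen i := by
      simp [genSeq, CuntzRel.seq, Nat.mod_eq_of_lt i.2]
    cases b with
    | false => simp [evalLetter, hi, gen, FreeStarAlg.gen]
    | true =>
      have e : FreeStarAlg.letter (i, true) = star (FreeStarAlg.gen i) :=
        (FreeStarAlg.star_letter (k := k) (i, false)).symm
      simp [evalLetter, hi, gen, e, star_ofFree]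
  induction x using ind with
  | hp => exact isClosed_closure
  | h x =>
    induction x using FreeStarAlg.induct with
    | scalar r => rw [AlgHom.commutes]; exact hscal r
    | lett l => exact subset_closure (hlet l)
    | mul a b ha hb => rw [map_mul]; exact hmul _ ha _ hb
    | add a b ha hb => rw [map_add]; exact hadd _ ha _ hb

/-- Unital `*`-homomorphisms from a Cuntz algebra to a nontrivial C*-algebra are isometric. -/
theorem norm_map {A : Type*} [CStarAlgebra A] [Nontrivial A] (hk : 2 ≤ k)
    (φ : CuntzAlgebra k →⋆ₐ[ℂ] A) (x : CuntzAlgebra k) : ‖φ x‖ = ‖x‖ := by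
  have hφc : Continuous φ := AddMonoidHomClass.continuous_of_bound φ 1 fun x => by
    rw [one_mul]; exact NonUnitalStarAlgHom.norm_apply_le φ x
  have hcl : IsClosed {x : CuntzAlgebra k | ‖φ x‖ = ‖x‖} := isClosed_eq hφc.norm continuous_norm
  refine closure_minimal ?_ hcl (mem_closure_rational hk x)
  rintro _ ⟨p, rfl⟩
  exact norm_map_eval hk φ p

end CuntzAlgebra

/-! ## The Cuntz relations on a Hilbert space -/

/-- The standard orthonormal basis of `ℓ²`. -/
def stdBasis : HilbertBasis ℕ ℂ (lp (fun _ : ℕ => ℂ) 2) :=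
  HilbertBasis.ofRepr (LinearIsometryEquiv.refl ℂ _)

/-- The isometry of `ℓ²` which maps the `j`-th basis vector to the one with index `k * j + i`. -/
def shiftIso (k : ℕ) [NeZero k] (i : Fin k) :
    lp (fun _ : ℕ => ℂ) 2 →ₗᵢ[ℂ] lp (fun _ : ℕ => ℂ) 2 :=
  ((stdBasis.orthonormal.comp (fun j : ℕ => k * j + i) fun a b h => by
    simpa [NeZero.ne k] using h).orthogonalFamily).linearIsometry

theorem shiftIso_basis (k : ℕ) [NeZero k] (i : Fin k) (j : ℕ) :
    shiftIso k i (stdBasis j) = stdBasis (k * j + i) := by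
  have h : stdBasis j = lp.single 2 j (1 : ℂ) :=
    (stdBasis.repr_symm_single j).symm
  rw [h, shiftIso, OrthogonalFamily.linearIsometry_apply_single]
  simp

open ContinuousLinearMap in
theorem cuntzRel_shiftIso (k : ℕ) [NeZero k] :
    CuntzRel fun i : Fin k => (shiftIso k i).toContinuousLinearMap := by
  have hiso : ∀ i : Fin k, star (shiftIso k i).toContinuousLinearMap *
      (shiftIso k i).toContinuousLinearMap = 1 := fun i =>
    (ContinuousLinearMap.norm_map_iff_adjoint_comp_self _).1 (shiftIso k i).norm_map
  refine ⟨hiso, ?_⟩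
  have key : ∀ (i : Fin k) (l : ℕ), (shiftIso k i).toContinuousLinearMap
      (star (shiftIso k i).toContinuousLinearMap (stdBasis l)) =
        if (i : ℕ) = l % k then stdBasis l else 0 := by
    intro i l
    split_ifs with h
    · have e : stdBasis l = (shiftIso k i).toContinuousLinearMap (stdBasis (l / k)) := by
        rw [LinearIsometry.coe_toContinuousLinearMap, shiftIso_basis, h, Nat.div_add_mod]
      rw [e]
      have := DFunLike.congr_fun (hiso i) (stdBasis (l / k))
      rw [mul_apply_eq_comp] at this
      rw [this, one_apply_eq_self]
    · have e : star (shiftIso k i).toContinuousLinearMap (stdBasis l) = 0 := by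
        apply stdBasis.repr.injective
        rw [map_zero]
        ext j
        rw [HilbertBasis.repr_apply_apply, star_eq_adjoint, adjoint_inner_right,
          LinearIsometry.coe_toContinuousLinearMap, shiftIso_basis]
        refine stdBasis.orthonormal.2 fun hjl => h ?_
        rw [← hjl, Nat.mul_add_mod, Nat.mod_eq_of_lt i.2]
      rw [e, map_zero]
  refine ContinuousLinearMap.ext_on (s := Set.range stdBasis) ?_ ?_
  · rw [dense_iff_closure_eq, ← Submodule.topologicalClosure_coe, stdBasis.dense_span]
    rfl
  · rintro _ ⟨l, rfl⟩
    simp only [sum_apply, mul_apply_eq_comp, key, one_apply_eq_self]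
    rw [Finset.sum_eq_single_of_mem (⟨l % k, Nat.mod_lt _ (NeZero.pos k)⟩ : Fin k)
      (Finset.mem_univ _) fun i _ hi => if_neg fun h => hi (Fin.ext h)]
    simp

open ContinuousLinearMap in
instance (k : ℕ) [NeZero k] : Nontrivial (CuntzAlgebra k) := by
  obtain ⟨φ, -, -⟩ := CuntzAlgebra.existsUnique_lift (cuntzRel_shiftIso k)
  refine nontrivial_of_ne 1 0 fun h => ?_
  have h1 : φ 1 = φ 0 := congrArg φ h
  rw [map_one, map_zero] at h1
  have h2 := DFunLike.congr_fun h1 (stdBasis 0)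
  have h3 : ‖stdBasis 0‖ = 1 := stdBasis.orthonormal.1 0
  rw [one_apply_eq_self] at h2
  rw [h2] at h3
  simp at h3

/-! ## Corners of C*-algebras -/

section Corner

variable {A : Type*} [CStarAlgebra A] {e : A}

/-- The corner `e A e` as a subalgebra. -/
def cornerSubalgebra (he : IsStarProjection e) : NonUnitalStarSubalgebra ℂ A where
  carrier := {x | e * x = x ∧ x * e = x}
  zero_mem' := by simp
  add_mem' {x y} hx hy := by
    constructor
    · rw [mul_add, hx.1, hy.1]
    · rw [add_mul, hx.2, hy.2]
  mul_mem' {x y} hx hy := by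
    constructor
    · rw [← mul_assoc, hx.1]
    · rw [mul_assoc, hy.2]
  smul_mem' c x hx := by
    constructor
    · rw [mul_smul_comm, hx.1]
    · rw [smul_mul_assoc, hx.2]
  star_mem' {x} hx := by
    have h := he.isSelfAdjoint.star_eq
    constructor
    · conv_lhs => rw [← h]
      rw [← star_mul, hx.2]
    · conv_lhs => rw [← h]
      rw [← star_mul, hx.1]

theorem isClosed_cornerSubalgebra (he : IsStarProjection e) :
    IsClosed (cornerSubalgebra he : Set A) :=
  (isClosed_eq (continuous_const.mul continuous_id) continuous_id).inter
    (isClosed_eq (continuous_id.mul continuous_const) continuous_id)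

/-- The corner `e A e` of a C*-algebra, a unital C*-algebra with unit `e`. -/
def Corner (he : IsStarProjection e) : Type _ := cornerSubalgebra he

namespace Corner

variable (he : IsStarProjection e)

instance : NonUnitalCStarAlgebra (Corner he) :=
  NonUnitalStarSubalgebra.nonUnitalCStarAlgebra (cornerSubalgebra he)
    (h_closed := isClosed_cornerSubalgebra he)

instance : One (Corner he) := ⟨⟨e, he.isIdempotentElem, he.isIdempotentElem⟩⟩

instance : NormedRing (Corner he) where
  __ := (inferInstance : NonUnitalNormedRing (Corner he))
  one_mul x := Subtype.ext x.2.1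
  mul_one x := Subtype.ext x.2.2

instance : Algebra ℂ (Corner he) := Algebra.ofModule smul_mul_assoc mul_smul_comm

instance : CStarAlgebra (Corner he) where
  __ := (inferInstance : NonUnitalCStarAlgebra (Corner he))
  __ := (inferInstance : NormedRing (Corner he))
  __ := (inferInstance : Algebra ℂ (Corner he))

/-- The inclusion of a corner. -/
def incl : Corner he →⋆ₙₐ[ℂ] A := NonUnitalStarSubalgebraClass.subtype (cornerSubalgebra he)

theorem incl_injective : Function.Injective (incl he) := Subtype.val_injective

theorem incl_one : incl he 1 = e := rfl

theorem mul_incl (x : Corner he) : e * incl he x = incl he x := x.2.1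

theorem incl_mul (x : Corner he) : incl he x * e = incl he x := x.2.2

theorem exists_incl {x : A} (h1 : e * x = x) (h2 : x * e = x) : ∃ y, incl he y = x :=
  ⟨⟨x, h1, h2⟩, rfl⟩

end Corner

end Corner

/-! ## An embedding between Cuntz algebras -/

section Embedding

variable {A : Type*} [CStarAlgebra A]

/-- A Cuntz family of `k` isometries in the corner of the complement of the range of `u`, for
isometries `u`, `v` with orthogonal ranges. -/
def cornerFamily (u v : A) (k i : ℕ) : A :=
  if i + 1 = k then v * u ^ (k - 1) * star v + (1 - u * star u - v * star v)
  else v * u ^ i * (1 - u * star u)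

theorem isStarProjection_compl {u : A} (hu : star u * u = 1) :
    IsStarProjection (1 - u * star u) := by
  have : IsStarProjection (u * star u) := by
    refine ⟨?_, IsSelfAdjoint.mul_star_self u⟩
    change u * star u * (u * star u) = u * star u
    rw [mul_assoc, ← mul_assoc (star u), hu, one_mul]
  exact this.one_sub

variable {u v : A} (hu : star u * u = 1) (hv : star v * v = 1) (huv : star u * v = 0)

include hu in
theorem star_mul_compl : star u * (1 - u * star u) = 0 := by
  rw [mul_sub, mul_one, ← mul_assoc, hu, one_mul, sub_self]

include hu in
theorem compl_mul : (1 - u * star u) * u = 0 := by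
  rw [sub_mul, one_mul, mul_assoc, hu, mul_one, sub_self]

include hu in
theorem star_pow_mul_pow_self (n : ℕ) : star u ^ n * u ^ n = 1 := by
  induction n with
  | zero => simp
  | succ n ih => rw [pow_succ, pow_succ', mul_assoc, ← mul_assoc (star u), hu, one_mul, ih]

theorem sum_pow_compl (n : ℕ) :
    ∑ i ∈ Finset.range n, u ^ i * (1 - u * star u) * star u ^ i = 1 - u ^ n * star u ^ n := by
  induction n with
  | zero => simp
  | succ n ih =>
    rw [Finset.sum_range_succ, ih, pow_succ u, pow_succ' (star u)]
    noncomm_ring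

include hu huv in
theorem compl_mul_cornerFamily (k i : ℕ) :
    (1 - u * star u) * cornerFamily u v k i = cornerFamily u v k i := by
  have h1 : (1 - u * star u) * v = v := by
    rw [sub_mul, one_mul, mul_assoc, huv, mul_zero, sub_zero]
  have h2 : (1 - u * star u) * (1 - u * star u - v * star v) = 1 - u * star u - v * star v := by
    rw [mul_sub, (isStarProjection_compl hu).isIdempotentElem.eq, ← mul_assoc, h1]
  unfold cornerFamily
  split_ifs
  · rw [mul_add, h2, ← mul_assoc, ← mul_assoc, h1]
  · rw [← mul_assoc, ← mul_assoc, h1]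

include hu huv in
theorem cornerFamily_mul_compl (k i : ℕ) :
    cornerFamily u v k i * (1 - u * star u) = cornerFamily u v k i := by
  have huv' : star v * u = 0 := by simpa using congrArg star huv
  have h1 : star v * (1 - u * star u) = star v := by
    rw [mul_sub, mul_one, ← mul_assoc, huv', zero_mul, sub_zero]
  have h2 : (1 - u * star u - v * star v) * (1 - u * star u) = 1 - u * star u - v * star v := by
    rw [sub_mul, (isStarProjection_compl hu).isIdempotentElem.eq, mul_assoc, h1]
  unfold cornerFamily
  split_ifs
  · rw [add_mul, h2, mul_assoc, h1]
  · rw [mul_assoc, (isStarProjection_compl hu).isIdempotentElem.eq]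

include hu hv huv in
theorem compl_sub_relations : star v * (1 - u * star u - v * star v) = 0 ∧
    (1 - u * star u - v * star v) * v = 0 ∧
    star (1 - u * star u - v * star v) = 1 - u * star u - v * star v ∧
    (1 - u * star u - v * star v) * (1 - u * star u - v * star v) =
      1 - u * star u - v * star v := by
  have huv' : star v * u = 0 := by simpa using congrArg star huv
  have h1 : star v * (1 - u * star u - v * star v) = 0 := by
    rw [mul_sub, mul_sub, mul_one, ← mul_assoc, huv', ← mul_assoc, hv]; simp
  have h2 : (1 - u * star u - v * star v) * v = 0 := by
    rw [sub_mul, sub_mul, one_mul, mul_assoc, huv, mul_assoc, hv]; simp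
  have h3 : star (1 - u * star u - v * star v) = 1 - u * star u - v * star v := by simp
  have h4 : (1 - u * star u - v * star v) * (1 - u * star u - v * star v) =
      1 - u * star u - v * star v := by
    conv_lhs => rw [mul_sub, ← mul_assoc, h2, zero_mul, sub_zero, mul_sub, mul_one, sub_mul,
      sub_mul, one_mul]
    rw [← mul_assoc (u * star u), mul_assoc u (star u) u, hu, mul_one, ← mul_assoc (v * star v),
      mul_assoc v (star v) u, huv']
    simp
  exact ⟨h1, h2, h3, h4⟩

include hu hv huv in
theorem star_cornerFamily_mul_self (k i : ℕ) :
    star (cornerFamily u v k i) * cornerFamily u v k i = 1 - u * star u := by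
  have hp := isStarProjection_compl hu
  unfold cornerFamily
  split_ifs
  · obtain ⟨h1, h2, h3, h4⟩ := compl_sub_relations hu hv huv
    rw [star_add, h3, star_mul, star_mul, star_star, star_pow, add_mul, mul_add, mul_add, h4]
    have e1 : v * (star u ^ (k - 1) * star v) * (v * u ^ (k - 1) * star v) = v * star v := by
      calc _ = v * (star u ^ (k - 1) * (star v * v) * u ^ (k - 1)) * star v := by noncomm_ring
        _ = _ := by rw [hv, mul_one, star_pow_mul_pow_self hu, mul_one]
    have e2 : v * (star u ^ (k - 1) * star v) * (1 - u * star u - v * star v) = 0 := by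
      rw [mul_assoc, mul_assoc, h1]; simp
    have e3 : (1 - u * star u - v * star v) * (v * u ^ (k - 1) * star v) = 0 := by
      rw [← mul_assoc, ← mul_assoc, h2]; simp
    rw [e1, e2, e3]
    abel
  · rw [star_mul, star_mul, hp.isSelfAdjoint.star_eq, star_pow]
    calc _ = (1 - u * star u) * (star u ^ i * (star v * v) * u ^ i) * (1 - u * star u) := by
          noncomm_ring
      _ = _ := by rw [hv, mul_one, star_pow_mul_pow_self hu, mul_one, hp.isIdempotentElem.eq]

include hu hv huv in
theorem sum_cornerFamily {k : ℕ} (hk : 1 ≤ k) :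
    ∑ i ∈ Finset.range k, cornerFamily u v k i * star (cornerFamily u v k i) =
      1 - u * star u := by
  have hp := isStarProjection_compl hu
  obtain ⟨n, rfl⟩ : ∃ n, k = n + 1 := ⟨k - 1, by omega⟩
  rw [Finset.sum_range_succ]
  have h1 : ∀ i ∈ Finset.range n, cornerFamily u v (n + 1) i *
      star (cornerFamily u v (n + 1) i) =
        v * (u ^ i * (1 - u * star u) * star u ^ i) * star v := by
    intro i hi
    have : i + 1 ≠ n + 1 := by have := Finset.mem_range.1 hi; omega
    rw [cornerFamily, if_neg this, star_mul, star_mul, hp.isSelfAdjoint.star_eq, star_pow]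
    calc _ = v * u ^ i * ((1 - u * star u) * (1 - u * star u)) * (star u ^ i * star v) := by
          noncomm_ring
      _ = _ := by rw [hp.isIdempotentElem.eq]; simp only [mul_assoc]
  rw [Finset.sum_congr rfl h1, ← Finset.sum_mul, ← Finset.mul_sum, sum_pow_compl, cornerFamily,
    if_pos rfl, Nat.add_sub_cancel]
  obtain ⟨h1, h2, h3, h4⟩ := compl_sub_relations hu hv huv
  rw [star_add, h3, star_mul, star_mul, star_star, star_pow, add_mul, mul_add, mul_add, h4]
  have e1 : v * u ^ n * star v * (v * (star u ^ n * star v)) =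
      v * (u ^ n * star u ^ n) * star v := by
    calc _ = v * u ^ n * (star v * v) * (star u ^ n * star v) := by noncomm_ring
      _ = _ := by rw [hv]; noncomm_ring
  have e2 : v * u ^ n * star v * (1 - u * star u - v * star v) = 0 := by
    rw [mul_assoc, h1, mul_zero]
  have e3 : (1 - u * star u - v * star v) * (v * (star u ^ n * star v)) = 0 := by
    rw [← mul_assoc, h2, zero_mul]
  rw [e1, e2, e3]
  noncomm_ring

end Embedding

namespace CuntzAlgebra

variable {k : ℕ} {A : Type*} [CStarAlgebra A] {u v : A}

/-- A non-unital embedding of a Cuntz algebra into the corner complementary to the range of an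
isometry. -/
theorem exists_cornerHom (hk : 2 ≤ k) (hu : star u * u = 1) (hv : star v * v = 1)
    (huv : star u * v = 0) (hne : 1 - u * star u ≠ 0) :
    ∃ φ : CuntzAlgebra k →⋆ₙₐ[ℂ] A, Function.Injective φ ∧ φ 1 = 1 - u * star u ∧
      (∀ i : Fin k, φ (gen i) = cornerFamily u v k i) ∧
      ∀ x, star u * φ x = 0 ∧ φ x * u = 0 := by
  have hp := isStarProjection_compl hu
  choose t ht using fun i : Fin k => Corner.exists_incl hp
    (compl_mul_cornerFamily hu huv k i) (cornerFamily_mul_compl hu huv k i)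
  have hrel : CuntzRel t :=
    { isometry := fun i => Corner.incl_injective hp (by
        rw [map_mul, map_star, ht, Corner.incl_one, star_cornerFamily_mul_self hu hv huv])
      sum_range := Corner.incl_injective hp (by
        rw [map_sum, Corner.incl_one]
        refine Eq.trans ?_ (sum_cornerFamily hu hv huv (by omega : 1 ≤ k))
        rw [← Fin.sum_univ_eq_sum_range fun i =>
            cornerFamily u v k i * star (cornerFamily u v k i)]
        exact Finset.sum_congr rfl fun i _ => by rw [map_mul, map_star, ht]) }
  have : Nontrivial (Corner hp) :=
    nontrivial_of_ne 1 0 fun h => hne (congrArg (Corner.incl hp) h)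
  obtain ⟨φ, hφ, -⟩ := existsUnique_lift hrel
  have hinj : Function.Injective φ := by
    refine (injective_iff_map_eq_zero φ).2 fun x hx => ?_
    rw [← norm_eq_zero, ← norm_map hk φ, hx, norm_zero]
  refine ⟨(Corner.incl hp).comp φ.toNonUnitalStarAlgHom, ?_, ?_, ?_, ?_⟩
  · exact (Corner.incl_injective hp).comp hinj
  · change Corner.incl hp (φ 1) = _
    rw [map_one, Corner.incl_one]
  · intro i
    change Corner.incl hp (φ (gen i)) = _
    rw [hφ, ht]
  · intro x
    change star u * Corner.incl hp (φ x) = 0 ∧ Corner.incl hp (φ x) * u = 0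
    constructor
    · rw [← Corner.mul_incl, ← mul_assoc, star_mul_compl hu, zero_mul]
    · rw [← Corner.incl_mul, mul_assoc, compl_mul hu, mul_zero]

end CuntzAlgebra

/-! ## Evaluation of polynomials -/

section EvalPoly

variable {A B : Type*} [NonUnitalCStarAlgebra A] [NonUnitalCStarAlgebra B]

theorem map_evalMonomial (φ : A →⋆ₙₐ[ℂ] B) (a : ℕ → A) (m : RatMonomial) :
    φ (evalMonomial a m) = evalMonomial (fun j => φ (a j)) m := by
  have hl : ∀ l : Letter, φ (evalLetter a l) = evalLetter (fun j => φ (a j)) l := by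
    rintro ⟨j, b⟩
    cases b <;> simp [evalLetter, map_star]
  have hf : ∀ (w : List Letter) (x : A),
      φ ((w.map (evalLetter a)).foldl (· * ·) x) =
        (w.map (evalLetter fun j => φ (a j))).foldl (· * ·) (φ x) := by
    intro w
    induction w with
    | nil => intro x; rfl
    | cons l w ih => intro x; simp [ih, hl]
  rw [evalMonomial, evalMonomial, map_smul, hf, hl]

theorem map_evalPoly (φ : A →⋆ₙₐ[ℂ] B) (a : ℕ → A) (p : RatStarPoly) :
    φ (evalPoly a p) = evalPoly (fun j => φ (a j)) p := by
  rw [evalPoly, evalPoly, map_list_sum, List.map_map]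
  congr 2
  funext m
  exact map_evalMonomial φ a m

/-- The letters of a polynomial. -/
def letters (p : RatStarPoly) : List Letter := p.flatMap fun m => m.2.1 :: m.2.2

theorem evalPoly_congr {a b : ℕ → A} {p : RatStarPoly}
    (h : ∀ l ∈ letters p, a l.1 = b l.1) : evalPoly a p = evalPoly b p := by
  have hl : ∀ l ∈ letters p, evalLetter a l = evalLetter b l := fun l hlp => by
    simp [evalLetter, h l hlp]
  rw [evalPoly, evalPoly]
  congr 1
  refine List.map_congr_left fun m hm => ?_
  have hm' : ∀ l ∈ m.2.1 :: m.2.2, evalLetter a l = evalLetter b l := fun l hlm =>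
    hl l (List.mem_flatMap.2 ⟨m, hm, hlm⟩)
  rw [evalMonomial, evalMonomial, hm' _ List.mem_cons_self, List.map_congr_left fun l hlm =>
    hm' l (List.mem_cons_of_mem _ hlm)]

theorem evalPoly_zero (p : RatStarPoly) : evalPoly (fun _ => (0 : A)) p = 0 :=
  (map_evalPoly (0 : A →⋆ₙₐ[ℂ] A) (fun _ => 0) p).symm

theorem evalPoly_prod (a : ℕ → A) (b : ℕ → B) (p : RatStarPoly) :
    evalPoly (fun j => (a j, b j)) p = (evalPoly a p, evalPoly b p) :=
  Prod.ext (map_evalPoly (NonUnitalStarAlgHom.fst ℂ A B) (fun j => (a j, b j)) p)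
    (map_evalPoly (NonUnitalStarAlgHom.snd ℂ A B) (fun j => (a j, b j)) p)

end EvalPoly

/-! ## The construction of the special points -/

/-- The number of generators of the `n`-th Cuntz algebra. -/
def numGen (n : ℕ) : ℕ := Nat.nth Nat.Prime n + 1

theorem three_le_numGen (n : ℕ) : 3 ≤ numGen n :=
  Nat.succ_le_succ (Nat.prime_nth_prime n).two_le

theorem two_le_numGen (n : ℕ) : 2 ≤ numGen n := by have := three_le_numGen n; omega

instance (n : ℕ) : NeZero (numGen n) := ⟨by have := three_le_numGen n; omega⟩

/-- The least natural number above `x` which is not in the list `h`. -/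
def target (h : List ℕ) (x : ℕ) : ℕ :=
  x + 1 + (List.range (h.sum + 1)).findIdx fun i => decide (x + 1 + i ∉ h)

theorem exists_target (h : List ℕ) (x : ℕ) :
    ∃ i ∈ List.range (h.sum + 1), decide (x + 1 + i ∉ h) = true := by
  refine ⟨h.sum, by simp, decide_eq_true fun hm => ?_⟩
  have := List.single_le_sum (l := h) (by simp) _ hm
  omega

theorem target_notMem (h : List ℕ) (x : ℕ) : target h x ∉ h := by
  have h1 := List.findIdx_lt_length_of_exists (exists_target h x)
  have h2 := List.findIdx_getElem (w := h1)
  rw [List.getElem_range] at h2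
  exact of_decide_eq_true h2

theorem lt_target (h : List ℕ) (x : ℕ) : x < target h x := by
  unfold target; omega

theorem target_le {h : List ℕ} {x M : ℕ} (hM : M ∉ h) (hx : x < M) : target h x ≤ M := by
  by_contra hlt
  rw [not_le, target] at hlt
  have h1 : M - (x + 1) < (List.range (h.sum + 1)).findIdx fun i => decide (x + 1 + i ∉ h) := by
    omega
  have h2 := List.not_of_lt_findIdx h1
  rw [List.getElem_range, show x + 1 + (M - (x + 1)) = M by omega] at h2
  simp [hM] at h2

namespace CuntzPoly

/-- The conjugate of a polynomial by the isometry `s 0`. -/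
def conjugate (p : CuntzPoly) : CuntzPoly :=
  p.map fun a => (a.1, (0, false) :: (a.2 ++ [(0, true)]))

/-- The projection `1 - s 0 * star (s 0)`. -/
def compl : CuntzPoly := [(GaussCode.one, []), (GaussCode.negOne, [(0, false), (0, true)])]

/-- The members of `cornerFamily (s 0) (s 1) k`. -/
def cornerPoly (k i : ℕ) : CuntzPoly :=
  if i + 1 = k then
    [(GaussCode.one, (1, false) :: (List.replicate (k - 1) (0, false) ++ [(1, true)])),
      (GaussCode.one, []), (GaussCode.negOne, [(0, false), (0, true)]),
      (GaussCode.negOne, [(1, false), (1, true)])]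
  else
    [(GaussCode.one, (1, false) :: List.replicate i (0, false)),
      (GaussCode.negOne, (1, false) :: (List.replicate i (0, false) ++ [(0, false), (0, true)]))]

/-- The image of a letter under the embedding of a Cuntz algebra on `k` generators. -/
def embedLetter (k : ℕ) (l : Letter) : CuntzPoly :=
  if l.2 = true then adj (cornerPoly k (l.1 % k)) else cornerPoly k (l.1 % k)

/-- The image of a word under the embedding of a Cuntz algebra on `k` generators. -/
def embedWord (k : ℕ) (w : List Letter) : CuntzPoly :=
  w.foldr (fun l r => mul (embedLetter k l) r) compl

/-- The image of a polynomial under the embedding of a Cuntz algebra on `k` generators. -/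
def embed (k : ℕ) (p : CuntzPoly) : CuntzPoly := p.flatMap fun a => smul a.1 (embedWord k a.2)

section

variable {A : Type*} [CStarAlgebra A] (g : ℕ → A)

theorem eval_conjugate (p : CuntzPoly) :
    eval g (conjugate p) = g 0 * eval g p * star (g 0) := by
  induction p with
  | nil => simp [conjugate]
  | cons a p ih =>
    rw [eval_cons, mul_add, add_mul, ← ih]
    simp [conjugate, evalLetter, mul_assoc]

theorem eval_compl : eval g compl = 1 - g 0 * star (g 0) := by
  simp [compl, evalLetter, sub_eq_add_neg]

theorem evalWord_replicate (n : ℕ) :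
    evalWord g (List.replicate n (0, false)) = g 0 ^ n := by
  simp [evalWord, evalLetter]

theorem eval_cornerPoly (k i : ℕ) : eval g (cornerPoly k i) = cornerFamily (g 0) (g 1) k i := by
  unfold cornerPoly cornerFamily
  split_ifs
  · simp [evalWord_replicate, evalLetter, mul_assoc, sub_eq_add_neg, add_assoc]
  · simp [evalWord_replicate, evalLetter, mul_assoc, sub_eq_add_neg, mul_add]

theorem eval_embed {k : ℕ} (hk : 2 ≤ k) {φ : CuntzAlgebra k →⋆ₙₐ[ℂ] A}
    (h1 : φ 1 = 1 - g 0 * star (g 0))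
    (hφ : ∀ i : Fin k, φ (CuntzAlgebra.gen i) = cornerFamily (g 0) (g 1) k i) (p : CuntzPoly) :
    eval g (embed k p) = φ (eval (CuntzAlgebra.genSeq hk) p) := by
  have hl : ∀ l : Letter, eval g (embedLetter k l) =
      φ (evalLetter (CuntzAlgebra.genSeq hk) l) := by
    rintro ⟨i, b⟩
    cases b
    · simp [embedLetter, evalLetter, eval_cornerPoly, CuntzAlgebra.genSeq, CuntzRel.seq, hφ]
    · simp [embedLetter, evalLetter, eval_adj, eval_cornerPoly, CuntzAlgebra.genSeq,
        CuntzRel.seq, hφ, map_star]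
  have hw : ∀ w : List Letter, eval g (embedWord k w) =
      φ (evalWord (CuntzAlgebra.genSeq hk) w) := by
    intro w
    induction w with
    | nil => rw [evalWord_nil, h1]; exact eval_compl g
    | cons l w ih =>
      rw [evalWord_cons, map_mul, ← ih, ← hl, ← eval_mul]
      rfl
  induction p with
  | nil => simp [embed]
  | cons a p ih =>
    rw [eval_cons, map_add, ← ih, map_smul, ← hw, ← eval_smul, ← eval_append]
    simp [embed]

end

end CuntzPoly

/-- The position and the value of a new special point. -/
def initState (h : List ℕ) (n i : ℕ) : ℕ × CuntzPoly :=
  (n, if n ∈ h then CuntzPoly.one else [(GaussCode.one, [(i, false)])])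

/-- The effect on a special point of the enumeration of `x` after the elements of `h`. -/
def push (x : ℕ) (h : List ℕ) (s : ℕ × CuntzPoly) : ℕ × CuntzPoly :=
  if x ∈ h then s
  else if s.1 = x then (target h x, CuntzPoly.embed (numGen x) s.2)
  else if s.1 = target h x then (s.1, CuntzPoly.conjugate s.2)
  else s

/-- The state of a special point after the enumeration of the elements of `h`: the index of the
summand in which it lies, and a polynomial in the generators of that summand. -/
def state (b n i : ℕ) : List ℕ → ℕ × CuntzPoly
  | [] => initState [] n i
  | x :: h => if h.length < b then initState (x :: h) n i else push x h (state b n i h)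

/-- The stage at which the `j`-th special point appears. -/
def birth (j : ℕ) : ℕ := j.unpair.1

/-- The state of the `j`-th special point. -/
def pointState (j : ℕ) (h : List ℕ) : ℕ × CuntzPoly :=
  state (birth j) j.unpair.2.unpair.1 j.unpair.2.unpair.2 h

/-- The component of a special point or its adjoint in the `n`-th summand. -/
def component (h : List ℕ) (n : ℕ) (l : Letter) : CuntzPoly :=
  if (pointState l.1 h).1 = n then
    (if l.2 = true then CuntzPoly.adj (pointState l.1 h).2 else (pointState l.1 h).2)
  else []

/-- The component in the `n`-th summand of the value of a monomial. -/
def monomialComponent (h : List ℕ) (n : ℕ) (m : RatMonomial) : CuntzPoly :=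
  CuntzPoly.smul m.1
    (m.2.2.foldl (fun r l => CuntzPoly.mul r (component h n l)) (component h n m.2.1))

/-- The component in the `n`-th summand of the value of a polynomial. -/
def polyComponent (h : List ℕ) (n : ℕ) (p : RatStarPoly) : CuntzPoly :=
  p.flatMap (monomialComponent h n)

/-- The generators of the `n`-th Cuntz algebra. -/
def gens (n : ℕ) : ℕ → CuntzAlgebra (numGen n) := CuntzAlgebra.genSeq (two_le_numGen n)

/-- The value of a special point in the `n`-th summand. -/
def pointValue (h : List ℕ) (n j : ℕ) : CuntzAlgebra (numGen n) :=
  CuntzPoly.eval (gens n) (component h n (j, false))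

theorem eval_polyComponent (h : List ℕ) (n : ℕ) (p : RatStarPoly) :
    CuntzPoly.eval (gens n) (polyComponent h n p) = evalPoly (pointValue h n) p := by
  have hl : ∀ l : Letter, CuntzPoly.eval (gens n) (component h n l) =
      evalLetter (pointValue h n) l := by
    rintro ⟨j, b⟩
    cases b
    · rfl
    · simp only [evalLetter, if_true, pointValue, ← CuntzPoly.eval_adj]
      congr 1
      simp only [component]
      split_ifs <;> simp_all [CuntzPoly.adj]
  have hf : ∀ (w : List Letter) (r : CuntzPoly), CuntzPoly.eval (gens n)
      (w.foldl (fun r l => CuntzPoly.mul r (component h n l)) r) =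
        (w.map (evalLetter (pointValue h n))).foldl (· * ·) (CuntzPoly.eval (gens n) r) := by
    intro w
    induction w with
    | nil => intro r; rfl
    | cons l w ih => intro r; simp [ih, hl, CuntzPoly.eval_mul]
  have hm : ∀ m : RatMonomial, CuntzPoly.eval (gens n) (monomialComponent h n m) =
      evalMonomial (pointValue h n) m := fun m => by
    rw [monomialComponent, CuntzPoly.eval_smul, hf, hl]
    rfl
  induction p with
  | nil => simp [polyComponent, evalPoly]
  | cons m p ih =>
    have : polyComponent h n (m :: p) = monomialComponent h n m ++ polyComponent h n p := rfl
    rw [this, CuntzPoly.eval_append, ih, hm]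
    simp [evalPoly]

theorem pointState_cons {j x : ℕ} {h : List ℕ} (hj : birth j ≤ h.length) :
    pointState j (x :: h) = push x h (pointState j h) := by
  rw [pointState, state, if_neg (by omega)]
  rfl

theorem pointValue_of_eq {h : List ℕ} {n j : ℕ} (hn : (pointState j h).1 = n) :
    pointValue h n j = CuntzPoly.eval (gens n) (pointState j h).2 := by
  simp [pointValue, component, hn]

theorem pointValue_of_ne {h : List ℕ} {n j : ℕ} (hn : (pointState j h).1 ≠ n) :
    pointValue h n j = 0 := by
  simp [pointValue, component, hn]

/-! ## Invariance of the norm -/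

section Merge

variable {A B : Type*} [CStarAlgebra A] [CStarAlgebra B]

/-- The homomorphism from a direct sum given by conjugation with an isometry and a homomorphism into
the complementary corner. -/
def mergeHom (u : A) (hu : star u * u = 1) (φ : B →⋆ₙₐ[ℂ] A)
    (hφ : ∀ x, star u * φ x = 0 ∧ φ x * u = 0) : A × B →⋆ₙₐ[ℂ] A where
  toFun x := u * x.1 * star u + φ x.2
  map_smul' c x := by simp [map_smul]
  map_zero' := by simp
  map_add' x y := by
    simp only [Prod.fst_add, Prod.snd_add, map_add, mul_add, add_mul]
    abel
  map_mul' x y := by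
    have e1 : u * x.1 * star u * (u * y.1 * star u) = u * (x.1 * y.1) * star u := by
      calc _ = u * x.1 * (star u * u) * y.1 * star u := by noncomm_ring
        _ = _ := by rw [hu]; noncomm_ring
    have e2 : u * x.1 * star u * φ y.2 = 0 := by rw [mul_assoc, (hφ _).1, mul_zero]
    have e3 : φ x.2 * (u * y.1 * star u) = 0 := by
      rw [← mul_assoc, ← mul_assoc, (hφ _).2, zero_mul, zero_mul]
    rw [Prod.fst_mul, Prod.snd_mul, map_mul, mul_add, add_mul, add_mul, e1, e2, e3]
    abel
  map_star' x := by simp [mul_assoc, map_star]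

theorem mergeHom_injective {u : A} (hu : star u * u = 1) {φ : B →⋆ₙₐ[ℂ] A}
    (hφ : ∀ x, star u * φ x = 0 ∧ φ x * u = 0) (hinj : Function.Injective φ) :
    Function.Injective (mergeHom u hu φ hφ) := by
  refine (injective_iff_map_eq_zero _).2 fun x hx => ?_
  have hx : u * x.1 * star u + φ x.2 = 0 := hx
  have h1 : x.1 = 0 := by
    have : star u * (u * x.1 * star u + φ x.2) * u = x.1 := by
      rw [mul_add, (hφ _).1, add_zero]
      calc _ = (star u * u) * x.1 * (star u * u) := by noncomm_ring
        _ = _ := by rw [hu, one_mul, mul_one]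
    rw [← this, hx]
    simp
  rw [h1, mul_zero, zero_mul, zero_add] at hx
  exact Prod.ext h1 ((injective_iff_map_eq_zero φ).1 hinj _ hx)

end Merge

theorem gens_relations (n : ℕ) : star (gens n 0) * gens n 0 = 1 ∧
    star (gens n 1) * gens n 1 = 1 ∧ star (gens n 0) * gens n 1 = 0 ∧
    1 - gens n 0 * star (gens n 0) ≠ 0 := by
  have h := CuntzAlgebra.isCuntzSeq_genSeq (two_le_numGen n)
  have h3 := three_le_numGen n
  have h01 : star (gens n 0) * gens n 1 = 0 := h.star_mul_of_ne 0 1 (by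
    rw [Nat.zero_mod, Nat.mod_eq_of_lt (by omega)]; omega)
  refine ⟨h.star_mul_self 0, h.star_mul_self 1, h01, fun e => ?_⟩
  have e2 : star (gens n 1) * (1 - gens n 0 * star (gens n 0)) * gens n 1 = 1 := by
    calc _ = star (gens n 1) * gens n 1 -
          star (gens n 1) * gens n 0 * (star (gens n 0) * gens n 1) := by noncomm_ring
      _ = 1 := by rw [h01, mul_zero, sub_zero]; exact h.star_mul_self 1
  rw [e] at e2
  simp at e2

/-- All special points in a polynomial have appeared by stage `t`. -/
def BornBy (p : RatStarPoly) (t : ℕ) : Prop := ∀ l ∈ letters p, birth l.1 ≤ t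

theorem norm_le_cons_iff {p : RatStarPoly} {h : List ℕ} (hp : BornBy p h.length) (x : ℕ) (c : ℝ) :
    (∀ n, ‖evalPoly (pointValue (x :: h) n) p‖ ≤ c) ↔
      ∀ n, ‖evalPoly (pointValue h n) p‖ ≤ c := by
  by_cases hx : x ∈ h
  · have : ∀ n, evalPoly (pointValue (x :: h) n) p = evalPoly (pointValue h n) p := fun n =>
      evalPoly_congr fun l hl => by
        simp [pointValue, component, pointState_cons (hp l hl), push, hx]
    simp only [this]
  set m := target h x with hm
  have hxm : x < m := lt_target h x
  obtain ⟨hu, hv, huv, hne⟩ := gens_relations m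
  obtain ⟨φ, hinj, h1, hgen, hφ⟩ :=
    CuntzAlgebra.exists_cornerHom (two_le_numGen x) hu hv huv hne
  have hn : ∀ n, n ≠ x → n ≠ m →
      evalPoly (pointValue (x :: h) n) p = evalPoly (pointValue h n) p := by
    intro n hnx hnm
    refine evalPoly_congr fun l hl => ?_
    have hs := pointState_cons (x := x) (hp l hl)
    by_cases h1 : (pointState l.1 h).1 = x
    · rw [pointValue_of_ne (h := h) (by rw [h1]; exact hnx.symm), pointValue_of_ne]
      rw [hs, push, if_neg hx, if_pos h1]
      exact hnm.symm
    · by_cases h2 : (pointState l.1 h).1 = m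
      · rw [pointValue_of_ne (h := h) (by rw [h2]; exact hnm.symm), pointValue_of_ne]
        rw [hs, push, if_neg hx, if_neg h1, if_pos h2]
        rw [h2]
        exact hnm.symm
      · have hs' : pointState l.1 (x :: h) = pointState l.1 h := by
          rw [hs, push, if_neg hx, if_neg h1, if_neg h2]
        simp [pointValue, component, hs']
  have hx0 : evalPoly (pointValue (x :: h) x) p = 0 := by
    rw [← evalPoly_zero (A := CuntzAlgebra (numGen x)) p]
    refine evalPoly_congr fun l hl => pointValue_of_ne ?_
    rw [pointState_cons (hp l hl), push, if_neg hx]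
    split_ifs with h1 h2
    · exact hxm.ne'
    · exact h1
    · exact h1
  have hm' : evalPoly (pointValue (x :: h) m) p = mergeHom _ hu φ hφ
      (evalPoly (pointValue h m) p, evalPoly (pointValue h x) p) := by
    rw [← evalPoly_prod, map_evalPoly]
    refine evalPoly_congr fun l hl => ?_
    change _ = gens m 0 * pointValue h m l.1 * star (gens m 0) + φ (pointValue h x l.1)
    have hs := pointState_cons (x := x) (hp l hl)
    by_cases h1' : (pointState l.1 h).1 = x
    · rw [push, if_neg hx, if_pos h1'] at hs
      rw [pointValue_of_ne (h := h) (n := m) (by rw [h1']; exact hxm.ne), pointValue_of_eq h1',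
        pointValue_of_eq (by rw [hs]), hs, mul_zero, zero_mul, zero_add]
      exact CuntzPoly.eval_embed _ (two_le_numGen x) h1 hgen _
    · rw [pointValue_of_ne (h := h) (n := x) h1', map_zero, add_zero]
      by_cases h2 : (pointState l.1 h).1 = m
      · rw [push, if_neg hx, if_neg h1', if_pos h2] at hs
        rw [pointValue_of_eq h2, pointValue_of_eq (by rw [hs]; exact h2), hs]
        exact CuntzPoly.eval_conjugate _ _
      · rw [push, if_neg hx, if_neg h1', if_neg h2] at hs
        rw [pointValue_of_ne h2, pointValue_of_ne (by rw [hs]; exact h2), mul_zero, zero_mul]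
  have hmn : ‖evalPoly (pointValue (x :: h) m) p‖ =
      max ‖evalPoly (pointValue h m) p‖ ‖evalPoly (pointValue h x) p‖ := by
    rw [hm', NonUnitalStarAlgHom.norm_map _ (mergeHom_injective hu hφ hinj)]
    rfl
  constructor
  · intro H n
    have h3 := H m
    rw [hmn] at h3
    by_cases h1 : n = x
    · subst h1; exact (le_max_right _ _).trans h3
    · by_cases h2 : n = m
      · subst h2; exact (le_max_left _ _).trans h3
      · rw [← hn n h1 h2]; exact H n
  · intro H n
    by_cases h1 : n = x
    · subst h1
      rw [hx0, norm_zero]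
      exact (norm_nonneg _).trans (H n)
    · by_cases h2 : n = m
      · subst h2
        rw [hmn]
        exact max_le (H _) (H _)
      · rw [hn n h1 h2]; exact H n

/-- The list of the first `t` values of a sequence, in reverse order. -/
def history (e : ℕ → ℕ) (t : ℕ) : List ℕ := t.rec [] fun s h => e s :: h

theorem history_succ (e : ℕ → ℕ) (t : ℕ) : history e (t + 1) = e t :: history e t := rfl

@[simp] theorem length_history (e : ℕ → ℕ) (t : ℕ) : (history e t).length = t := by
  induction t with
  | zero => rfl
  | succ t ih => rw [history_succ, List.length_cons, ih]

theorem mem_history {e : ℕ → ℕ} {t x : ℕ} : x ∈ history e t ↔ ∃ s < t, e s = x := by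
  induction t with
  | zero => simp [history]
  | succ t ih =>
    rw [history_succ, List.mem_cons, ih]
    constructor
    · rintro (rfl | ⟨s, hs, rfl⟩)
      · exact ⟨t, by omega, rfl⟩
      · exact ⟨s, by omega, rfl⟩
    · rintro ⟨s, hs, rfl⟩
      rcases Nat.lt_succ_iff_lt_or_eq.1 hs with h | rfl
      · exact Or.inr ⟨s, h, rfl⟩
      · exact Or.inl rfl

theorem norm_le_history_iff {p : RatStarPoly} {t T : ℕ} (hp : BornBy p t) (htT : t ≤ T)
    (e : ℕ → ℕ) (c : ℝ) : (∀ n, ‖evalPoly (pointValue (history e T) n) p‖ ≤ c) ↔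
      ∀ n, ‖evalPoly (pointValue (history e t) n) p‖ ≤ c := by
  induction T, htT using Nat.le_induction with
  | base => rfl
  | succ T hT ih =>
    rw [history_succ, norm_le_cons_iff _ _ c, ih]
    intro l hl
    rw [length_history]
    exact (hp l hl).trans hT

/-! ## Limits of the special points -/

section Limit

variable {R : Set ℕ} {e : ℕ → ℕ}

theorem state_of_length_le {b n i : ℕ} {h : List ℕ} (hb : h.length ≤ b) :
    state b n i h = initState h n i := by
  cases h with
  | nil => rfl
  | cons x h => rw [state, if_pos (by simpa using hb)]

theorem pointState_birth (e : ℕ → ℕ) (j : ℕ) : pointState j (history e (birth j)) =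
    initState (history e (birth j)) j.unpair.2.unpair.1 j.unpair.2.unpair.2 :=
  state_of_length_le (length_history e _).le

theorem pointState_succ {e : ℕ → ℕ} {j t : ℕ} (ht : birth j ≤ t) :
    pointState j (history e (t + 1)) = push (e t) (history e t) (pointState j (history e t)) :=
  pointState_cons (ht.trans_eq (length_history e t).symm)

theorem exists_stage (he : ∀ n, n ∈ R ↔ ∃ s, e s = n) (M : ℕ) :
    ∃ T₀, ∀ T ≥ T₀, ∀ x ≤ M, x ∈ R → x ∈ history e T := by
  have : ∀ x, ∃ s, x ∈ R → e s = x := fun x => by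
    by_cases hx : x ∈ R
    · obtain ⟨s, hs⟩ := (he x).1 hx; exact ⟨s, fun _ => hs⟩
    · exact ⟨0, fun h => absurd h hx⟩
  choose s hs using this
  refine ⟨∑ x ∈ Finset.range (M + 1), (s x + 1), fun T hT x hxM hx => mem_history.2 ⟨s x, ?_, hs x hx⟩⟩
  have := Finset.single_le_sum (f := fun x => s x + 1) (fun _ _ => Nat.zero_le _)
    (Finset.mem_range.2 (Nat.lt_succ_of_le hxM))
  exact (lt_of_lt_of_le (Nat.lt_succ_self (s x)) this).trans_le hT

theorem mem_of_mem_history (he : ∀ n, n ∈ R ↔ ∃ s, e s = n) {t x : ℕ} (hx : x ∈ history e t) :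
    x ∈ R := by
  obtain ⟨s, -, hs⟩ := mem_history.1 hx
  exact (he x).2 ⟨s, hs⟩

theorem pointState_le (he : ∀ n, n ∈ R ↔ ∃ s, e s = n) {M j t : ℕ} (hM : M ∉ R)
    (hj : j.unpair.2.unpair.1 ≤ M) (ht : birth j ≤ t) :
    (pointState j (history e t)).1 ≤ M := by
  induction t, ht using Nat.le_induction with
  | base => rw [pointState_birth]; exact hj
  | succ t ht ih =>
    rw [pointState_succ ht, push]
    split_ifs with h1 h2 h3
    · exact ih
    · refine target_le (fun h => hM (mem_of_mem_history he h)) ?_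
      rw [h2] at ih
      refine lt_of_le_of_ne ih fun h => hM ?_
      rw [← h]
      exact (he _).2 ⟨t, rfl⟩
    · exact ih
    · exact ih

theorem pointState_eq_one {j t : ℕ} (ht : birth j ≤ t)
    (h : (pointState j (history e t)).1 ∈ history e t) :
    (pointState j (history e t)).2 = CuntzPoly.one := by
  induction t, ht using Nat.le_induction with
  | base =>
    rw [pointState_birth] at h ⊢
    exact if_pos h
  | succ t ht ih =>
    rw [pointState_succ ht, history_succ, push] at h
    rw [pointState_succ ht, push]
    have hT := target_notMem (history e t) (e t)
    have hT2 := (lt_target (history e t) (e t)).ne'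
    split_ifs at h ⊢ with h1 h2 h3
    · refine ih ?_
      rcases List.mem_cons.1 h with h | h
      · rw [h]; exact h1
      · exact h
    · rcases List.mem_cons.1 h with h | h
      · exact absurd h hT2
      · exact absurd h hT
    · rw [h3] at h
      rcases List.mem_cons.1 h with h | h
      · exact absurd h hT2
      · exact absurd h hT
    · rcases List.mem_cons.1 h with h | h
      · exact absurd h h2
      · exact ih h

theorem pointState_eventually_const (he : ∀ n, n ∈ R ↔ ∃ s, e s = n) {M j t : ℕ}
    (hpos : ∀ T ≥ t, (pointState j (history e T)).1 ≤ M) (hb : birth j ≤ t)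
    (hst : ∀ T ≥ t, ∀ x ≤ M, x ∈ R → x ∈ history e T) :
    ∀ T ≥ t, pointState j (history e T) = pointState j (history e t) := by
  intro T hT
  induction T, hT using Nat.le_induction with
  | base => rfl
  | succ T hT ih =>
    rw [pointState_succ (hb.trans hT), push, ← ih]
    split_ifs with h1 h2 h3
    · rfl
    · refine absurd (hst T hT (e T) ?_ ((he _).2 ⟨T, rfl⟩)) h1
      rw [← h2]
      exact hpos T hT
    · refine absurd (hst T hT (e T) ?_ ((he _).2 ⟨T, rfl⟩)) h1
      have := hpos T hT
      have := lt_target (history e T) (e T)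
      omega
    · rfl

theorem exists_limitState (he : ∀ n, n ∈ R ↔ ∃ s, e s = n) (hR : ∀ n, ∃ M ≥ n, M ∉ R) (j : ℕ) :
    ∃ s : ℕ × CuntzPoly, (s.1 ∈ R → s.2 = CuntzPoly.one) ∧
      ∀ᶠ T in atTop, pointState j (history e T) = s := by
  obtain ⟨M, hjM, hM⟩ := hR j.unpair.2.unpair.1
  obtain ⟨T₀, hT₀⟩ := exists_stage he M
  set t := max T₀ (birth j)
  have ht1 : T₀ ≤ t := le_max_left _ _
  have ht2 : birth j ≤ t := le_max_right _ _
  refine ⟨pointState j (history e t), fun h => pointState_eq_one ht2 ?_, ?_⟩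
  · exact hT₀ t ht1 _ (pointState_le he hM hjM ht2) h
  · filter_upwards [eventually_ge_atTop t] with T hT
    exact pointState_eventually_const he (fun T hT => pointState_le he hM hjM (ht2.trans hT)) ht2
      (fun T hT => hT₀ T (ht1.trans hT)) T hT

end Limit

/-! ## The special points of the direct sum -/

/-- The summands embed into Cuntz algebras, with range the scalars or everything. -/
theorem exists_summandHom (R : Set ℕ) (n : ℕ) :
    ∃ ι : summand R n →⋆ₙₐ[ℂ] CuntzAlgebra (numGen n), Function.Injective ι ∧
      (n ∈ R → ∀ x, ∃ c : ℂ, ι x = c • 1) ∧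
      ∀ y, (n ∈ R → ∃ c : ℂ, y = c • 1) → ∃ x, ι x = y := by
  by_cases hn : n ∈ R
  · have hs : summand R n = ⟨ℂ⟩ := if_pos hn
    rw [hs]
    have hmap : ∀ c : ℂ, algebraMap ℂ (CuntzAlgebra (numGen n)) c = c • 1 :=
      fun c => Algebra.algebraMap_eq_smul_one c
    refine ⟨(StarAlgHom.ofId ℂ (CuntzAlgebra (numGen n))).toNonUnitalStarAlgHom, ?_, ?_, ?_⟩
    · exact (algebraMap ℂ (CuntzAlgebra (numGen n))).injective
    · exact fun _ c => ⟨c, hmap c⟩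
    · intro y hy
      obtain ⟨c, rfl⟩ := hy hn
      exact ⟨c, hmap c⟩
  · have hs : summand R n = ⟨CuntzAlgebra (numGen n)⟩ := if_neg hn
    rw [hs]
    exact ⟨NonUnitalStarAlgHom.id ℂ (CuntzAlgebra (numGen n)), Function.injective_id,
      fun h => absurd h hn, fun y _ => ⟨y, rfl⟩⟩

section DirectSum

variable {A : ℕ → Type*} [∀ n, NonUnitalCStarAlgebra (A n)]

/-- The element of the direct sum with one given coordinate, the other ones being zero. -/
def single (n : ℕ) (x : A n) : directSum A :=
  ⟨lp.single ∞ n x, by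
    change Tendsto (fun i => ‖lp.single ∞ n x i‖) atTop (𝓝 0)
    refine tendsto_const_nhds.congr' ?_
    filter_upwards [eventually_gt_atTop n] with i hi
    rw [lp.single_apply_ne _ _ _ hi.ne', norm_zero]⟩

/-- The coordinate of an element of the direct sum. -/
def coord (n : ℕ) : directSum A →⋆ₙₐ[ℂ] A n where
  toFun x := (x : lp A ∞) n
  map_smul' _ _ := rfl
  map_zero' := rfl
  map_add' _ _ := rfl
  map_mul' _ _ := rfl
  map_star' _ := rfl

@[simp] theorem coord_single_self (n : ℕ) (x : A n) : coord n (single n x) = x :=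
  lp.single_apply_self ∞ _ _

theorem coord_single_ne {n i : ℕ} (x : A n) (h : i ≠ n) : coord i (single n x) = 0 :=
  lp.single_apply_ne ∞ _ _ h

theorem ext_coord {x y : directSum A} (h : ∀ n, coord n x = coord n y) : x = y :=
  Subtype.ext (lp.ext (funext h))

theorem norm_le_iff_coord {x : directSum A} {c : ℝ} (hc : 0 ≤ c) :
    ‖x‖ ≤ c ↔ ∀ n, ‖coord n x‖ ≤ c :=
  ⟨fun h n => (lp.norm_apply_le_norm ENNReal.top_ne_zero (x : lp A ∞) n).trans h,
    fun h => lp.norm_le_of_forall_le hc h⟩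

theorem single_mul (n : ℕ) (x y : A n) : single n (x * y) = single n x * single n y := by
  refine ext_coord fun i => ?_
  rw [map_mul]
  by_cases h : i = n
  · subst h; simp
  · simp [coord_single_ne _ h]

theorem single_add (n : ℕ) (x y : A n) : single n (x + y) = single n x + single n y := by
  refine ext_coord fun i => ?_
  rw [map_add]
  by_cases h : i = n
  · subst h; simp
  · simp [coord_single_ne _ h]

theorem single_smul (n : ℕ) (c : ℂ) (x : A n) : single n (c • x) = c • single n x := by
  refine ext_coord fun i => ?_
  rw [map_smul]
  by_cases h : i = n
  · subst h; simp
  · simp [coord_single_ne _ h]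

theorem single_star (n : ℕ) (x : A n) : single n (star x) = star (single n x) := by
  refine ext_coord fun i => ?_
  rw [map_star]
  by_cases h : i = n
  · subst h; simp
  · simp [coord_single_ne _ h]

theorem norm_single_sub_le (n : ℕ) (x y : A n) : ‖single n x - single n y‖ ≤ ‖x - y‖ := by
  refine (norm_le_iff_coord (norm_nonneg _)).2 fun i => ?_
  rw [map_sub]
  by_cases h : i = n
  · subst h; simp
  · simp [coord_single_ne _ h]

/-- A closed additive subgroup which contains all elements with one nonzero coordinate is
everything. -/
theorem mem_of_forall_single {S : AddSubmonoid (directSum A)} (hS : IsClosed (S : Set (directSum A)))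
    (h : ∀ n (x : A n), single n x ∈ S) (y : directSum A) : y ∈ S := by
  rw [← SetLike.mem_coe, ← hS.closure_eq, Metric.mem_closure_iff]
  intro ε hε
  have hy : Tendsto (fun n => ‖coord n y‖) atTop (𝓝 0) := y.2
  obtain ⟨N, hN⟩ := Metric.tendsto_atTop.1 hy (ε / 2) (half_pos hε)
  refine ⟨∑ n ∈ Finset.range N, single n (coord n y), S.sum_mem fun n _ => h n _, ?_⟩
  rw [dist_eq_norm]
  refine lt_of_le_of_lt ((norm_le_iff_coord (half_pos hε).le).2 fun i => ?_) (half_lt_self hε)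
  rw [map_sub, map_sum]
  by_cases hi : i < N
  · rw [Finset.sum_eq_single_of_mem i (Finset.mem_range.2 hi) fun n _ hn =>
      coord_single_ne _ hn.symm, coord_single_self, sub_self, norm_zero]
    exact (half_pos hε).le
  · rw [Finset.sum_eq_zero fun n hn => coord_single_ne _ (by
      have := Finset.mem_range.1 hn; omega), sub_zero]
    have := hN i (not_lt.1 hi)
    simp only [dist_zero_right, norm_norm] at this
    exact this.le

end DirectSum

theorem single_mem_of_generators {A : ℕ → Type*} [∀ n, NonUnitalCStarAlgebra (A n)] {n m : ℕ}
    (ι : A n →⋆ₙₐ[ℂ] CuntzAlgebra (numGen m)) (hinj : Function.Injective ι)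
    (hsur : Function.Surjective ι) {S : NonUnitalStarSubalgebra ℂ (directSum A)}
    (hSc : IsClosed (S : Set (directSum A)))
    (hgen : ∀ (i : ℕ) (y : A n), ι y = gens m i → single n y ∈ S) (y : A n) :
    single n y ∈ S := by
  have hlet : ∀ (l : Letter) (y : A n), ι y = evalLetter (gens m) l →
      single n y ∈ S := by
    rintro ⟨i, b⟩ y hy
    obtain ⟨z, hz1⟩ := hsur (gens m i)
    have hz := hgen i z hz1
    cases b with
    | false =>
      have : y = z := hinj (by rw [hy, hz1]; rfl)
      rw [this]
      exact hz
    | true =>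
      have : y = star z := hinj (by rw [hy, map_star, hz1]; rfl)
      rw [this, single_star]
      exact star_mem hz
  have hword : ∀ (w : List Letter) (y : A n), ι y = CuntzPoly.evalWord (gens m) w →
      single n y ∈ S := by
    intro w
    induction w with
    | nil =>
      intro y hy
      obtain ⟨u, hu⟩ := hsur (evalLetter (gens m) (0, true))
      obtain ⟨v, hv⟩ := hsur (evalLetter (gens m) (0, false))
      have : y = u * v := hinj (by
        rw [hy, map_mul, hu, hv]
        exact (gens_relations m).1.symm)
      rw [this, single_mul]
      exact mul_mem (hlet _ u hu) (hlet _ v hv)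
    | cons l w ih =>
      intro y hy
      obtain ⟨u, hu⟩ := hsur (evalLetter (gens m) l)
      obtain ⟨v, hv⟩ := hsur (CuntzPoly.evalWord (gens m) w)
      have : y = u * v := hinj (by rw [hy, map_mul, hu, hv, CuntzPoly.evalWord_cons])
      rw [this, single_mul]
      exact mul_mem (hlet _ u hu) (ih v hv)
  have hpoly : ∀ (p : CuntzPoly) (y : A n), ι y = CuntzPoly.eval (gens m) p →
      single n y ∈ S := by
    intro p
    induction p with
    | nil =>
      intro y hy
      have : y = (0 : ℂ) • y := hinj (by rw [hy]; simp)
      rw [this, single_smul, zero_smul]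
      exact zero_mem S
    | cons q p ih =>
      intro y hy
      obtain ⟨u, hu⟩ := hsur (CuntzPoly.evalWord (gens m) q.2)
      obtain ⟨v, hv⟩ := hsur (CuntzPoly.eval (gens m) p)
      have : y = GaussCode.toComplex q.1 • u + v := hinj (by
        rw [hy, map_add, map_smul, hu, hv, CuntzPoly.eval_cons])
      rw [this, single_add, single_smul]
      exact add_mem (SMulMemClass.smul_mem _ (hword _ u hu)) (ih v hv)
  rw [← SetLike.mem_coe, ← hSc.closure_eq, Metric.mem_closure_iff]
  intro ε hε
  obtain ⟨_, ⟨p, rfl⟩, hp⟩ := Metric.mem_closure_iff.1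
    (CuntzAlgebra.mem_closure_rational (two_le_numGen m) (ι y)) ε hε
  obtain ⟨z, hz⟩ := hsur (CuntzPoly.eval (gens m) p)
  refine ⟨single n z, hpoly p z hz, ?_⟩
  rw [dist_eq_norm] at hp ⊢
  refine (norm_single_sub_le n y z).trans_lt ?_
  rw [← NonUnitalStarAlgHom.norm_map ι (hinj), map_sub, hz]
  exact hp

theorem exists_points {R : Set ℕ} {e : ℕ → ℕ} (he : ∀ n, n ∈ R ↔ ∃ s, e s = n)
    (hR : ∀ n, ∃ M ≥ n, M ∉ R) : ∃ P : Presentation (directSum fun n => summand R n),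
      ∀ (p : RatStarPoly) (t : ℕ), BornBy p t → ∀ c : ℝ, 0 ≤ c →
        (‖evalPoly P.point p‖ ≤ c ↔ ∀ n, ‖evalPoly (pointValue (history e t) n) p‖ ≤ c) := by
  choose ι hinj hscal hsurj using exists_summandHom R
  choose s hs1 hs2 using exists_limitState he hR
  have hpre : ∀ j, ∃ x : summand R (s j).1, ι (s j).1 x = CuntzPoly.eval (gens (s j).1) (s j).2 :=
    fun j => hsurj _ _ fun h => ⟨1, by rw [hs1 j h]; simp⟩
  choose x hx using hpre
  let a : ℕ → directSum fun n => summand R n := fun j => single (s j).1 (x j)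
  have ha : ∀ j n, ι n (coord n (a j)) =
      if (s j).1 = n then CuntzPoly.eval (gens n) (s j).2 else 0 := by
    intro j n
    split_ifs with h
    · subst h
      rw [coord_single_self, hx]
    · rw [coord_single_ne _ (Ne.symm h), map_zero]
  have hev : ∀ j, ∀ᶠ T in atTop, ∀ n, ι n (coord n (a j)) = pointValue (history e T) n j := by
    intro j
    filter_upwards [hs2 j] with T hT n
    rw [ha]
    split_ifs with h
    · rw [pointValue_of_eq (by rw [hT]; exact h), hT]
    · rw [pointValue_of_ne (by rw [hT]; exact h)]
  set S := (NonUnitalStarAlgebra.adjoin ℂ (Set.range a)).topologicalClosure with hS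
  have haS : ∀ j, a j ∈ S := fun j => NonUnitalStarSubalgebra.le_topologicalClosure _
    (NonUnitalStarAlgebra.subset_adjoin ℂ _ ⟨j, rfl⟩)
  have hSc : IsClosed (S : Set (directSum fun n => summand R n)) :=
    NonUnitalStarSubalgebra.isClosed_topologicalClosure _
  -- a point which appears late enough stays where it is
  have hpt : ∀ n i, ∃ y : summand R n, single n y ∈ S ∧
      (n ∈ R → ι n y = 1) ∧ (n ∉ R → ι n y = gens n i) := by
    intro n i
    obtain ⟨T₀, hT₀⟩ := exists_stage he n
    let j := Nat.pair T₀ (Nat.pair n i)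
    have hbj : birth j = T₀ := by simp [j, birth]
    have hinit : pointState j (history e T₀) = initState (history e T₀) n i := by
      have := pointState_birth e j
      rw [hbj] at this
      simpa [j] using this
    have hpos : ∀ T ≥ T₀, (pointState j (history e T)).1 = n := by
      intro T hT
      induction T, hT using Nat.le_induction with
      | base => rw [hinit]; rfl
      | succ T hT ih =>
        rw [pointState_succ (hbj.trans_le hT), push, ih]
        split_ifs with h1 h2 h3
        · exact ih
        · exact absurd (hT₀ T hT (e T) h2.ge ((he _).2 ⟨T, rfl⟩)) h1
        · rfl
        · exact ih
    have hst := pointState_eventually_const he (fun T hT => (hpos T hT).le) hbj.le hT₀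
    obtain ⟨T, hT⟩ := ((hs2 j).and (eventually_ge_atTop T₀)).exists
    have hsj : s j = initState (history e T₀) n i := by
      rw [← hT.1, hst T hT.2, hinit]
    have hsn : (s j).1 = n := by rw [hsj]; rfl
    refine ⟨coord n (a j), ?_, ?_⟩
    · have : single n (coord n (a j)) = a j := by
        refine ext_coord fun i => ?_
        by_cases h : i = n
        · subst h; rw [coord_single_self]
        · rw [coord_single_ne _ h]
          exact (coord_single_ne (A := fun n => summand R n) (x j) fun h' => h (h'.trans hsn)).symm
      rw [this]
      exact haS j
    · rw [ha, if_pos hsn, hsj, initState]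
      refine ⟨fun h => ?_, fun h => ?_⟩
      · rw [if_pos (hT₀ T₀ le_rfl n le_rfl h)]
        exact CuntzPoly.eval_one _
      · rw [if_neg fun h' => h (mem_of_mem_history he h')]
        simp [evalLetter]
  have hsingle : ∀ n (y : summand R n), single n y ∈ S := by
    intro n y
    by_cases hn : n ∈ R
    · obtain ⟨z, hz, hz1, -⟩ := hpt n 0
      obtain ⟨c, hc⟩ := hscal n hn y
      have : y = c • z := hinj n (by rw [hc, map_smul, hz1 hn])
      rw [this, single_smul]
      exact SMulMemClass.smul_mem c hz
    · refine single_mem_of_generators (ι n) (hinj n) (fun y => hsurj n y fun h => absurd h hn) hSc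
        (fun i y hy => ?_) y
      obtain ⟨z, hz, -, hz1⟩ := hpt n i
      rw [hinj n (hy.trans (hz1 hn).symm)]
      exact hz
  refine ⟨⟨a, ?_⟩, fun p t hp c hc => ?_⟩
  · rw [eq_top_iff]
    intro y _
    exact mem_of_forall_single (S := S.toNonUnitalSubalgebra.toSubmodule.toAddSubmonoid) hSc
      hsingle y
  · obtain ⟨T, hT1, hT2⟩ : ∃ T, t ≤ T ∧ ∀ l ∈ letters p, ∀ n,
        ι n (coord n (a l.1)) = pointValue (history e T) n l.1 := by
      have h : ∀ᶠ T in atTop, ∀ l ∈ (letters p).toFinset, ∀ n,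
          ι n (coord n (a l.1)) = pointValue (history e T) n l.1 :=
        (Filter.eventually_all_finset _).2 fun l _ => hev l.1
      obtain ⟨T, hT, htT⟩ := (h.and (eventually_ge_atTop t)).exists
      exact ⟨T, htT, fun l hl => hT l (List.mem_toFinset.2 hl)⟩
    refine ((norm_le_iff_coord hc).trans (forall_congr' fun n => ?_)).trans
      (norm_le_history_iff hp hT1 e c)
    have h1 : ι n (coord n (evalPoly a p)) = evalPoly (pointValue (history e T) n) p := by
      rw [map_evalPoly, map_evalPoly]
      refine evalPoly_congr (a := fun j => ι n (coord n (a j))) fun l hl => ?_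
      exact hT2 l hl n
    have h2 := NonUnitalStarAlgHom.norm_map (ι n) (hinj n) (coord n (evalPoly a p))
    have h3 : ‖coord n (evalPoly a p)‖ = ‖evalPoly (pointValue (history e T) n) p‖ :=
      h2.symm.trans (congrArg norm h1)
    exact Iff.of_eq (congrArg (fun r : ℝ => r ≤ c) h3)

/-! ## Primitive recursive functions -/

attribute [fun_prop] Primrec
attribute [fun_prop] Primrec.id Primrec.const Primrec.comp Primrec.fst Primrec.snd Primrec.pair

section PrimrecBasic

variable {α β γ σ : Type*} [Primcodable α] [Primcodable β] [Primcodable γ] [Primcodable σ]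

@[fun_prop] theorem primrec_add {f g : α → ℕ} (hf : Primrec f) (hg : Primrec g) :
    Primrec fun a => f a + g a := Primrec.nat_add.comp hf hg

@[fun_prop] theorem primrec_mul {f g : α → ℕ} (hf : Primrec f) (hg : Primrec g) :
    Primrec fun a => f a * g a := Primrec.nat_mul.comp hf hg

@[fun_prop] theorem primrec_sub {f g : α → ℕ} (hf : Primrec f) (hg : Primrec g) :
    Primrec fun a => f a - g a := Primrec.nat_sub.comp hf hg

@[fun_prop] theorem primrec_div {f g : α → ℕ} (hf : Primrec f) (hg : Primrec g) :
    Primrec fun a => f a / g a := Primrec.nat_div.comp hf hg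

@[fun_prop] theorem primrec_mod {f g : α → ℕ} (hf : Primrec f) (hg : Primrec g) :
    Primrec fun a => f a % g a := Primrec.nat_mod.comp hf hg

@[fun_prop] theorem primrec_pow {f g : α → ℕ} (hf : Primrec f) (hg : Primrec g) :
    Primrec fun a => f a ^ g a := (Primrec₂.unpaired'.1 Nat.Primrec.pow).comp hf hg

@[fun_prop] theorem primrec_unpair {f : α → ℕ} (hf : Primrec f) :
    Primrec fun a => (f a).unpair := Primrec.unpair.comp hf

@[fun_prop] theorem primrec_not {f : α → Bool} (hf : Primrec f) :
    Primrec fun a => !f a := Primrec.not.comp hf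

@[fun_prop] theorem primrec_and {f g : α → Bool} (hf : Primrec f) (hg : Primrec g) :
    Primrec fun a => f a && g a := Primrec.and.comp hf hg

@[fun_prop] theorem primrec_or {f g : α → Bool} (hf : Primrec f) (hg : Primrec g) :
    Primrec fun a => f a || g a := Primrec.or.comp hf hg

@[fun_prop] theorem primrec_ite {c : α → Prop} [DecidablePred c] {f g : α → σ}
    (hc : Primrec fun a => decide (c a)) (hf : Primrec f) (hg : Primrec g) :
    Primrec fun a => if c a then f a else g a :=
  Primrec.ite (primrecPred_iff_primrec_decide.2 hc) hf hg

@[fun_prop] theorem primrec_decide_eq [DecidableEq β] {f g : α → β} (hf : Primrec f)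
    (hg : Primrec g) : Primrec fun a => decide (f a = g a) :=
  (primrecRel_iff_primrec_decide.1 Primrec.eq).comp hf hg

@[fun_prop] theorem primrec_decide_lt {f g : α → ℕ} (hf : Primrec f) (hg : Primrec g) :
    Primrec fun a => decide (f a < g a) :=
  (primrecRel_iff_primrec_decide.1 Primrec.nat_lt).comp hf hg

@[fun_prop] theorem primrec_decide_not {c : α → Prop} [DecidablePred c]
    (hc : Primrec fun a => decide (c a)) : Primrec fun a => decide (¬c a) :=
  (primrec_not hc).of_eq fun a => by simp

@[fun_prop] theorem primrec_decide_mem {f : α → ℕ} {l : α → List ℕ} (hf : Primrec f)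
    (hl : Primrec l) : Primrec fun a => decide (f a ∈ l a) := by
  have h := primrecRel_iff_primrec_decide.1
    ((Primrec.eq (α := ℕ)).exists_mem_list.of_eq (s := fun l b => b ∈ l) fun l b => by simp)
  exact h.comp hl hf

@[fun_prop] theorem primrec_some {f : α → β} (hf : Primrec f) :
    Primrec fun a => some (f a) := Primrec.option_some.comp hf

@[fun_prop] theorem primrec_bind {f : α → Option β} {g : α → β → Option σ} (hf : Primrec f)
    (hg : Primrec fun p : α × β => g p.1 p.2) : Primrec fun a => (f a).bind (g a) :=
  Primrec.option_bind hf hg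

@[fun_prop] theorem primrec_cons {f : α → β} {g : α → List β} (hf : Primrec f)
    (hg : Primrec g) : Primrec fun a => f a :: g a := Primrec.list_cons.comp hf hg

@[fun_prop] theorem primrec_append {f g : α → List β} (hf : Primrec f) (hg : Primrec g) :
    Primrec fun a => f a ++ g a := Primrec.list_append.comp hf hg

@[fun_prop] theorem primrec_length {f : α → List β} (hf : Primrec f) :
    Primrec fun a => (f a).length := Primrec.list_length.comp hf

@[fun_prop] theorem primrec_reverse {f : α → List β} (hf : Primrec f) :
    Primrec fun a => (f a).reverse := Primrec.list_reverse.comp hf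

@[fun_prop] theorem primrec_range {f : α → ℕ} (hf : Primrec f) :
    Primrec fun a => List.range (f a) := Primrec.list_range.comp hf

@[fun_prop] theorem primrec_map {f : α → List β} {g : α → β → σ} (hf : Primrec f)
    (hg : Primrec fun p : α × β => g p.1 p.2) : Primrec fun a => (f a).map (g a) :=
  Primrec.list_map hf hg

@[fun_prop] theorem primrec_flatMap {f : α → List β} {g : α → β → List σ} (hf : Primrec f)
    (hg : Primrec fun p : α × β => g p.1 p.2) : Primrec fun a => (f a).flatMap (g a) :=
  Primrec.list_flatMap hf hg

@[fun_prop] theorem primrec_filter {f : α → List β} {g : α → β → Bool} (hf : Primrec f)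
    (hg : Primrec fun p : α × β => g p.1 p.2) : Primrec fun a => (f a).filter (g a) := by
  have h : Primrec fun a => (f a).flatMap fun b => if g a b = true then [b] else [] := by fun_prop
  refine h.of_eq fun a => ?_
  induction f a with
  | nil => rfl
  | cons b l ih => by_cases hb : g a b = true <;> simp [hb, ih]

@[fun_prop] theorem primrec_findIdx {f : α → List β} {g : α → β → Bool} (hf : Primrec f)
    (hg : Primrec fun p : α × β => g p.1 p.2) : Primrec fun a => (f a).findIdx (g a) :=
  Primrec.list_findIdx hf hg

@[fun_prop] theorem primrec_foldr {f : α → List β} {g : α → σ} {h : α → β → σ → σ}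
    (hf : Primrec f) (hg : Primrec g) (hh : Primrec fun p : α × β × σ => h p.1 p.2.1 p.2.2) :
    Primrec fun a => (f a).foldr (h a) (g a) :=
  Primrec.list_foldr (h := fun a p => h a p.1 p.2) hf hg hh

@[fun_prop] theorem primrec_foldl {f : α → List β} {g : α → σ} {h : α → σ → β → σ}
    (hf : Primrec f) (hg : Primrec g) (hh : Primrec fun p : α × σ × β => h p.1 p.2.1 p.2.2) :
    Primrec fun a => (f a).foldl (h a) (g a) :=
  Primrec.list_foldl (h := fun a p => h a p.1 p.2) hf hg hh

@[fun_prop] theorem primrec_natRec {f : α → ℕ} {g : α → σ} {h : α → ℕ → σ → σ}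
    (hf : Primrec f) (hg : Primrec g) (hh : Primrec fun p : α × ℕ × σ => h p.1 p.2.1 p.2.2) :
    Primrec fun a => Nat.rec (motive := fun _ => σ) (g a) (h a) (f a) :=
  Primrec.nat_rec' (h := fun a p => h a p.1 p.2) hf hg hh

@[fun_prop] theorem primrec_listSum {f : α → List ℕ} (hf : Primrec f) :
    Primrec fun a => (f a).sum := by
  unfold List.sum
  fun_prop

@[fun_prop] theorem primrec_replicate {f : α → ℕ} {g : α → β} (hf : Primrec f)
    (hg : Primrec g) : Primrec fun a => List.replicate (f a) (g a) := by
  have h : Primrec fun a => (List.range (f a)).map fun _ => g a := by fun_prop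
  exact h.of_eq fun a => by simp

end PrimrecBasic

section PrimrecPoly

variable {α : Type*} [Primcodable α]

@[fun_prop] theorem primrec_ratAdd {f g : α → RatCode} (hf : Primrec f) (hg : Primrec g) :
    Primrec fun a => RatCode.add (f a) (g a) := by
  unfold RatCode.add
  fun_prop

@[fun_prop] theorem primrec_ratMul {f g : α → RatCode} (hf : Primrec f) (hg : Primrec g) :
    Primrec fun a => RatCode.mul (f a) (g a) := by
  unfold RatCode.mul
  fun_prop

@[fun_prop] theorem primrec_ratNeg {f : α → RatCode} (hf : Primrec f) :
    Primrec fun a => RatCode.neg (f a) := by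
  unfold RatCode.neg
  fun_prop

@[fun_prop] theorem primrec_ratAbs {f : α → RatCode} (hf : Primrec f) :
    Primrec fun a => RatCode.abs (f a) := by
  unfold RatCode.abs
  fun_prop

@[fun_prop] theorem primrec_ratPow {f : α → RatCode} {g : α → ℕ} (hf : Primrec f)
    (hg : Primrec g) : Primrec fun a => RatCode.pow (f a) (g a) := by
  unfold RatCode.pow
  fun_prop

@[fun_prop] theorem primrec_ratSum {f : α → List RatCode} (hf : Primrec f) :
    Primrec fun a => RatCode.sum (f a) := by
  unfold RatCode.sum
  fun_prop

@[fun_prop] theorem primrec_gaussMul {f g : α → GaussCode} (hf : Primrec f)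
    (hg : Primrec g) : Primrec fun a => GaussCode.mul (f a) (g a) := by
  unfold GaussCode.mul
  fun_prop

@[fun_prop] theorem primrec_gaussConj {f : α → GaussCode} (hf : Primrec f) :
    Primrec fun a => GaussCode.conj (f a) := by
  unfold GaussCode.conj
  fun_prop

namespace CuntzPoly

@[fun_prop] theorem primrec_starWord {f : α → List Letter} (hf : Primrec f) :
    Primrec fun a => starWord (f a) := by
  unfold starWord
  fun_prop

@[fun_prop] theorem primrec_mul {f g : α → CuntzPoly} (hf : Primrec f) (hg : Primrec g) :
    Primrec fun a => mul (f a) (g a) := by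
  unfold mul
  fun_prop

@[fun_prop] theorem primrec_adj {f : α → CuntzPoly} (hf : Primrec f) :
    Primrec fun a => adj (f a) := by
  unfold adj
  fun_prop

@[fun_prop] theorem primrec_smul {f : α → GaussCode} {g : α → CuntzPoly} (hf : Primrec f)
    (hg : Primrec g) : Primrec fun a => smul (f a) (g a) := by
  unfold smul
  fun_prop

@[fun_prop] theorem primrec_pow {f : α → CuntzPoly} {g : α → ℕ} (hf : Primrec f)
    (hg : Primrec g) : Primrec fun a => pow (f a) (g a) := by
  unfold pow
  fun_prop

@[fun_prop] theorem primrec_balanced {f : α → CuntzPoly} (hf : Primrec f) :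
    Primrec fun a => balanced (f a) := by
  unfold balanced posCount negCount
  fun_prop

@[fun_prop] theorem primrec_actLetter {k j : α → ℕ} {l : α → Letter} (hk : Primrec k)
    (hl : Primrec l) (hj : Primrec j) : Primrec fun a => actLetter (k a) (l a) (j a) := by
  unfold actLetter
  fun_prop

@[fun_prop] theorem primrec_act {k j : α → ℕ} {w : α → List Letter} (hk : Primrec k)
    (hw : Primrec w) (hj : Primrec j) : Primrec fun a => act (k a) (w a) (j a) := by
  unfold act
  fun_prop

@[fun_prop] theorem primrec_entrySize {k i j : α → ℕ} {p : α → CuntzPoly} (hk : Primrec k)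
    (hp : Primrec p) (hi : Primrec i) (hj : Primrec j) :
    Primrec fun a => entrySize (k a) (p a) (i a) (j a) := by
  unfold entrySize
  fun_prop

@[fun_prop] theorem primrec_matrixSize {k m : α → ℕ} {p : α → CuntzPoly} (hk : Primrec k)
    (hm : Primrec m) (hp : Primrec p) : Primrec fun a => matrixSize (k a) (m a) (p a) := by
  unfold matrixSize
  fun_prop

@[fun_prop] theorem primrec_normApprox {k d n : α → ℕ} {p : α → CuntzPoly} (hk : Primrec k)
    (hd : Primrec d) (hn : Primrec n) (hp : Primrec p) :
    Primrec fun a => normApprox (k a) (d a) (n a) (p a) := by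
  unfold normApprox core
  fun_prop

@[fun_prop] theorem primrec_conjugate {f : α → CuntzPoly} (hf : Primrec f) :
    Primrec fun a => conjugate (f a) := by
  unfold conjugate
  fun_prop

@[fun_prop] theorem primrec_cornerPoly {k i : α → ℕ} (hk : Primrec k) (hi : Primrec i) :
    Primrec fun a => cornerPoly (k a) (i a) := by
  unfold cornerPoly
  fun_prop

@[fun_prop] theorem primrec_embed {k : α → ℕ} {p : α → CuntzPoly} (hk : Primrec k)
    (hp : Primrec p) : Primrec fun a => embed (k a) (p a) := by
  unfold embed embedWord embedLetter
  fun_prop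

end CuntzPoly

theorem nth_prime_le (n : ℕ) : Nat.nth Nat.Prime n ≤ 2 ^ (n + 1) := by
  induction n with
  | zero => simp [Nat.nth_prime_zero_eq_two]
  | succ n ih =>
    obtain ⟨q, hq, h1, h2⟩ := Nat.exists_prime_lt_and_le_two_mul (Nat.nth Nat.Prime n)
      (Nat.prime_nth_prime n).ne_zero
    have : Nat.nth Nat.Prime (n + 1) ≤ q := by
      rw [← Nat.nth_count hq]
      exact Nat.nth_monotone Nat.infinite_setOfPred_prime
        ((Nat.lt_nth_iff_count_lt Nat.infinite_setOfPred_prime).2 h1)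
    rw [pow_succ]
    omega

@[fun_prop] theorem primrec_decide_prime {f : α → ℕ} (hf : Primrec f) :
    Primrec fun a => decide (f a).Prime := by
  have h : Primrec fun a => decide (1 < f a) && decide
      (((List.range (f a)).filter fun d => decide (1 < d) && decide (f a % d = 0)) = []) := by
    fun_prop
  refine h.of_eq fun a => ?_
  rw [Bool.eq_iff_iff]
  simp only [Bool.and_eq_true, decide_eq_true_iff, List.filter_eq_nil_iff, List.mem_range,
    Nat.prime_def_lt', Nat.dvd_iff_mod_eq_zero]
  grind

@[fun_prop] theorem primrec_numGen {f : α → ℕ} (hf : Primrec f) :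
    Primrec fun a => numGen (f a) := by
  have h : Primrec fun a => ((List.range (2 ^ (f a + 1) + 1)).findIdx fun q =>
      decide (f a < ((List.range (q + 1)).filter fun r => decide r.Prime).length)) + 1 := by
    fun_prop
  refine h.of_eq fun a => congrArg (· + 1) ?_
  have hc : ∀ q, f a < ((List.range (q + 1)).filter fun r => decide r.Prime).length ↔
      Nat.nth Nat.Prime (f a) ≤ q := by
    intro q
    rw [← List.countP_eq_length_filter, ← Nat.lt_succ_iff]
    exact Nat.lt_nth_iff_count_lt Nat.infinite_setOfPred_prime
  have hlt := Nat.lt_succ_of_le (nth_prime_le (f a))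
  rw [List.findIdx_eq (by simpa using hlt)]
  simp [hc]

@[fun_prop] theorem primrec_initState {h : α → List ℕ} {n i : α → ℕ} (hh : Primrec h)
    (hn : Primrec n) (hi : Primrec i) : Primrec fun a => initState (h a) (n a) (i a) := by
  unfold initState
  fun_prop

@[fun_prop] theorem primrec_push {x : α → ℕ} {h : α → List ℕ} {s : α → ℕ × CuntzPoly}
    (hx : Primrec x) (hh : Primrec h) (hs : Primrec s) :
    Primrec fun a => push (x a) (h a) (s a) := by
  unfold push target
  fun_prop

@[fun_prop] theorem primrec_pointState {j : α → ℕ} {h : α → List ℕ} (hj : Primrec j)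
    (hh : Primrec h) : Primrec fun a => pointState (j a) (h a) := by
  have H := Primrec.list_rec (f := h)
    (g := fun a => initState [] (j a).unpair.2.unpair.1 (j a).unpair.2.unpair.2)
    (h := fun a p => if p.2.1.length < (j a).unpair.1 then
      initState (p.1 :: p.2.1) (j a).unpair.2.unpair.1 (j a).unpair.2.unpair.2
      else push p.1 p.2.1 p.2.2) hh (by fun_prop) (by unfold Primrec₂; fun_prop)
  refine H.of_eq fun a => ?_
  unfold pointState birth
  induction h a with
  | nil => rfl
  | cons x l ih =>
    rw [state, ← ih]

@[fun_prop] theorem primrec_polyComponent {h : α → List ℕ} {n : α → ℕ}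
    {p : α → RatStarPoly} (hh : Primrec h) (hn : Primrec n) (hp : Primrec p) :
    Primrec fun a => polyComponent (h a) (n a) (p a) := by
  unfold polyComponent monomialComponent component
  fun_prop

@[fun_prop] theorem primrec_letters {p : α → RatStarPoly} (hp : Primrec p) :
    Primrec fun a => letters (p a) := by
  unfold letters
  fun_prop

end PrimrecPoly

/-! ## Approximating a number by two-sided bounds for its powers -/

/-- The test whether `q` is a good approximation to a number `x` for which
`x ^ E ≤ B * L` and `L ≤ B * x ^ E`. -/
def approxTest (B : ℕ) (L : RatCode) (E : ℕ) (ε q : RatCode) : Bool :=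
  !decide (RatCode.Lt q (RatCode.ofNat 0)) &&
    decide (RatCode.Lt (RatCode.mul (RatCode.ofNat B) L) (RatCode.pow (RatCode.add q ε) E)) &&
    (decide (RatCode.Lt q ε) || decide (RatCode.Lt (RatCode.mul (RatCode.ofNat B)
      (RatCode.pow (RatCode.add q (RatCode.neg ε)) E)) L))

theorem approxTest_iff {B : ℕ} {L : RatCode} {E : ℕ} {ε q : RatCode} :
    approxTest B L E ε q = true ↔ (0 ≤ (q.toRat : ℝ) ∧
      (B : ℝ) * L.toRat < ((q.toRat : ℝ) + ε.toRat) ^ E) ∧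
      ((q.toRat : ℝ) < ε.toRat ∨ (B : ℝ) * ((q.toRat : ℝ) - ε.toRat) ^ E < L.toRat) := by
  simp only [approxTest, Bool.and_eq_true, Bool.or_eq_true, Bool.not_eq_true',
    decide_eq_false_iff_not, decide_eq_true_iff, RatCode.lt_iff, RatCode.toRat_mul,
    RatCode.toRat_add, RatCode.toRat_neg, RatCode.toRat_pow, RatCode.toRat_ofNat, not_lt,
    ← sub_eq_add_neg]
  norm_cast

theorem abs_sub_lt_of_approxTest {x : ℝ} (hx : 0 ≤ x) {B : ℕ} {L : RatCode} {E : ℕ}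
    {ε q : RatCode} (hε : 0 < (ε.toRat : ℝ)) (h1 : x ^ E ≤ B * L.toRat) (h2 : L.toRat ≤ B * x ^ E)
    (h : approxTest B L E ε q = true) : |x - q.toRat| < ε.toRat := by
  obtain ⟨⟨h3, h4⟩, h5⟩ := approxTest_iff.1 h
  have h6 : x < q.toRat + ε.toRat :=
    lt_of_pow_lt_pow_left₀ E (by positivity) (h1.trans_lt h4)
  have h7 : (q.toRat : ℝ) - ε.toRat < x ∨ (q.toRat : ℝ) < ε.toRat := by
    rcases h5 with h5 | h5
    · exact Or.inr h5
    · refine Or.inl (lt_of_pow_lt_pow_left₀ E hx ?_)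
      exact lt_of_mul_lt_mul_left (h5.trans_le h2) (Nat.cast_nonneg B)
  rw [abs_lt]
  constructor
  · rcases h7 with h7 | h7 <;> linarith
  · linarith

theorem exists_approxTest {x : ℝ} (hx : 0 ≤ x) {B E : ℕ → ℕ} {L : ℕ → RatCode} {ε : RatCode}
    (hε : 0 < (ε.toRat : ℝ)) (hE : ∀ a, E a ≠ 0) (h1 : ∀ a, x ^ E a ≤ B a * (L a).toRat)
    (h2 : ∀ a, (L a).toRat ≤ B a * x ^ E a)
    (hB : ∀ c : ℝ, 1 < c → ∃ a, (B a : ℝ) ^ 2 < c ^ E a) :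
    ∃ a q, approxTest (B a) (L a) (E a) ε q = true := by
  rcases hx.eq_or_lt with rfl | hx
  · refine ⟨0, RatCode.ofNat 0, approxTest_iff.2 ?_⟩
    have hL : ((L 0).toRat : ℝ) ≤ 0 := by
      have := h2 0
      rwa [zero_pow (hE 0), mul_zero] at this
    simp only [RatCode.toRat_ofNat, Nat.cast_zero, Rat.cast_zero, zero_add, le_refl, true_and]
    refine ⟨?_, Or.inl hε⟩
    exact (mul_nonpos_of_nonneg_of_nonpos (Nat.cast_nonneg _) hL).trans_lt (pow_pos hε _)
  · set e : ℝ := (ε.toRat : ℝ)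
    set δ := e / (2 * x) with hδ
    have hδ0 : 0 < δ := by positivity
    have hδx : x * δ = e / 2 := by rw [hδ]; field_simp
    obtain ⟨a, ha⟩ := hB (1 + δ) (by linarith)
    obtain ⟨r, hr1, hr2⟩ := exists_rat_btwn (show x < x + e / 2 by linarith)
    obtain ⟨q, rfl⟩ := RatCode.exists_toRat r
    refine ⟨a, q, approxTest_iff.2 ⟨⟨by linarith, ?_⟩, ?_⟩⟩
    · calc (B a : ℝ) * (L a).toRat ≤ B a * (B a * x ^ E a) := by gcongr; exact h2 a
        _ = (B a : ℝ) ^ 2 * x ^ E a := by ring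
        _ < (1 + δ) ^ E a * x ^ E a := by gcongr
        _ = (x + e / 2) ^ E a := by rw [← mul_pow, ← hδx]; ring
        _ ≤ _ := by gcongr; linarith
    · by_cases hq : (q.toRat : ℝ) < e
      · exact Or.inl hq
      right
      have hxe : 0 ≤ (q.toRat : ℝ) - e := by linarith
      have hpos : 0 < x ^ E a := pow_pos hx _
      have hB0 : 0 < (B a : ℝ) := by
        rcases (Nat.cast_nonneg (α := ℝ) (B a)).eq_or_lt with h | h
        · have := h1 a
          rw [← h, zero_mul] at this
          linarith
        · exact h
      refine lt_of_mul_lt_mul_left ?_ hB0.le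
      have h5 : (1 + δ) * ((q.toRat : ℝ) - e) < x := by
        have : (1 + δ) * ((q.toRat : ℝ) - e) < (1 + δ) * (x - e / 2) :=
          mul_lt_mul_of_pos_left (by linarith) (by linarith)
        nlinarith
      calc (B a : ℝ) * (B a * ((q.toRat : ℝ) - e) ^ E a)
          = (B a : ℝ) ^ 2 * ((q.toRat : ℝ) - e) ^ E a := by ring
        _ ≤ (1 + δ) ^ E a * ((q.toRat : ℝ) - e) ^ E a := by gcongr
        _ = ((1 + δ) * ((q.toRat : ℝ) - e)) ^ E a := (mul_pow _ _ _).symm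
        _ < x ^ E a := pow_lt_pow_left₀ h5 (by positivity) (hE a)
        _ ≤ _ := h1 a

/-! ## The algorithm -/

/-- A stage by which all special points in a polynomial have appeared. -/
def bornStage (p : RatStarPoly) : ℕ := ((letters p).map fun l => birth l.1).sum

theorem bornBy_bornStage (p : RatStarPoly) : BornBy p (bornStage p) := fun l hl =>
  List.single_le_sum (by simp) _ (List.mem_map.2 ⟨l, hl, rfl⟩)

/-- A number above the positions of all special points in a polynomial. -/
def positionBound (h : List ℕ) (p : RatStarPoly) : ℕ :=
  ((letters p).map fun l => (pointState l.1 h).1 + 1).sum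

theorem evalPoly_eq_zero {h : List ℕ} {p : RatStarPoly} {n : ℕ} (hn : positionBound h p ≤ n) :
    evalPoly (pointValue h n) p = 0 := by
  rw [← evalPoly_zero (A := CuntzAlgebra (numGen n)) p]
  refine evalPoly_congr fun l hl => pointValue_of_ne ?_
  have : (pointState l.1 h).1 + 1 ≤ positionBound h p :=
    List.single_le_sum (by simp) _ (List.mem_map.2 ⟨l, hl, rfl⟩)
  omega

/-- A bound for the lengths of the words in a polynomial. -/
def CuntzPoly.lengthBound (p : CuntzPoly) : ℕ := (p.map fun a => a.2.length).sum

theorem CuntzPoly.lengthLE_lengthBound (p : CuntzPoly) : LengthLE p (lengthBound p) :=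
  fun a ha => List.single_le_sum (by simp) _ (List.mem_map.2 ⟨a, ha, rfl⟩)

/-- A bound for the lengths of the words in the components of a polynomial. -/
def degreeBound (h : List ℕ) (p : RatStarPoly) : ℕ :=
  ((List.range (positionBound h p)).map fun n =>
    CuntzPoly.lengthBound (polyComponent h n p)).sum

/-- A bound for the numbers of generators of the summands involved in a polynomial. -/
def genBound (h : List ℕ) (p : RatStarPoly) : ℕ :=
  ((List.range (positionBound h p)).map numGen).sum + 1

/-- An approximation to a power of the norm of the value of a polynomial. -/
def normPowApprox (h : List ℕ) (p : RatStarPoly) (a : ℕ) : RatCode :=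
  RatCode.sum ((List.range (positionBound h p)).map fun n =>
    CuntzPoly.normApprox (numGen n) (degreeBound h p) (2 ^ a) (polyComponent h n p))

/-- The factor by which the approximation can differ from the true value. -/
def normPowError (h : List ℕ) (p : RatStarPoly) (a : ℕ) : ℕ :=
  normBound (genBound h p) (degreeBound h p) (positionBound h p + 1) (2 ^ a)

theorem lengthLE_degreeBound {h : List ℕ} {p : RatStarPoly} {n : ℕ} (hn : n < positionBound h p) :
    CuntzPoly.LengthLE (polyComponent h n p) (degreeBound h p) :=
  (CuntzPoly.lengthLE_lengthBound _).mono
    (List.single_le_sum (by simp) _ (List.mem_map.2 ⟨n, List.mem_range.2 hn, rfl⟩))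

theorem numGen_le_genBound {h : List ℕ} {p : RatStarPoly} {n : ℕ} (hn : n < positionBound h p) :
    numGen n ≤ genBound h p :=
  (List.single_le_sum (by simp) _ (List.mem_map.2 ⟨n, List.mem_range.2 hn, rfl⟩)).trans
    (Nat.le_succ _)

theorem toRat_normPowApprox (h : List ℕ) (p : RatStarPoly) (a : ℕ) :
    ((normPowApprox h p a).toRat : ℝ) = ((List.range (positionBound h p)).map fun n =>
      ((CuntzPoly.normApprox (numGen n) (degreeBound h p) (2 ^ a)
        (polyComponent h n p)).toRat : ℝ)).sum := by
  rw [normPowApprox, RatCode.toRat_sum, Rat.cast_list_sum, List.map_map, List.map_map]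
  rfl

theorem normPowApprox_le {h : List ℕ} {p : RatStarPoly} {x : ℝ}
    (hle : ∀ n, ‖evalPoly (pointValue h n) p‖ ≤ x) (a : ℕ) :
    (normPowApprox h p a).toRat ≤ normPowError h p a * x ^ (4 * (2 ^ a) ^ 2) := by
  have hx : 0 ≤ x := (norm_nonneg _).trans (hle 0)
  set d := degreeBound h p with hd
  set y : ℝ := 2 * (genBound h p : ℝ) ^ (8 * d * 2 ^ a) * x ^ (4 * (2 ^ a) ^ 2) with hy
  have hy0 : 0 ≤ y := by positivity
  have h1 : ((normPowApprox h p a).toRat : ℝ) ≤ positionBound h p * y := by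
    rw [toRat_normPowApprox]
    refine (List.sum_le_card_nsmul _ y ?_).trans (by simp)
    simp only [List.mem_map, List.mem_range]
    rintro _ ⟨n, hn, rfl⟩
    refine (CuntzPoly.normApprox_le (CuntzAlgebra.isCuntzSeq_genSeq (two_le_numGen n))
      (lengthLE_degreeBound hn) (2 ^ a)).trans ?_
    have h2 : (numGen n : ℝ) ≤ genBound h p := by exact_mod_cast numGen_le_genBound hn
    have h3 : ‖CuntzPoly.eval (gens n) (polyComponent h n p)‖ ≤ x := by
      rw [eval_polyComponent]
      exact hle n
    rw [hy]
    gcongr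
    exact h3
  refine h1.trans ?_
  have h4 : (1 : ℝ) ≤ (4 * d * 2 ^ a + 1) ^ 2 ^ a := one_le_pow₀ (by
    have : (0 : ℝ) ≤ 4 * d * 2 ^ a := by positivity
    linarith)
  have h5 : (normPowError h p a : ℝ) * x ^ (4 * (2 ^ a) ^ 2) =
      (4 * d * 2 ^ a + 1) ^ 2 ^ a * ((positionBound h p + 1) * y) := by
    rw [normPowError, normBound, hy]
    push_cast
    ring
  rw [h5]
  calc positionBound h p * y ≤ (positionBound h p + 1) * y := by gcongr; linarith
    _ ≤ _ := le_mul_of_one_le_left (by positivity) h4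

theorem le_normPowApprox (h : List ℕ) (p : RatStarPoly) (n a : ℕ) :
    ‖evalPoly (pointValue h n) p‖ ^ (4 * (2 ^ a) ^ 2) ≤
      normPowError h p a * (normPowApprox h p a).toRat := by
  set d := degreeBound h p with hd
  have key : ∀ m < positionBound h p, ‖evalPoly (pointValue h m) p‖ ^ (4 * (2 ^ a) ^ 2) ≤
      (4 * d * 2 ^ a + 1) ^ 2 ^ a *
        ((CuntzPoly.normApprox (numGen m) d (2 ^ a) (polyComponent h m p)).toRat : ℝ) := by
    intro m hm
    rw [← eval_polyComponent]
    exact CuntzPoly.le_normApprox (two_le_numGen m) (lengthLE_degreeBound hm) a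
  have hpos : ∀ m < positionBound h p, (0 : ℝ) ≤
      (CuntzPoly.normApprox (numGen m) d (2 ^ a) (polyComponent h m p)).toRat := by
    intro m hm
    exact nonneg_of_mul_nonneg_right ((pow_nonneg (norm_nonneg _) _).trans (key m hm))
      (by positivity)
  have hnn : ∀ y ∈ (List.range (positionBound h p)).map fun n =>
      ((CuntzPoly.normApprox (numGen n) d (2 ^ a) (polyComponent h n p)).toRat : ℝ), 0 ≤ y := by
    simp only [List.mem_map, List.mem_range]
    rintro _ ⟨m, hm, rfl⟩
    exact hpos m hm
  have hL : (0 : ℝ) ≤ (normPowApprox h p a).toRat := by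
    rw [toRat_normPowApprox]
    exact List.sum_nonneg hnn
  by_cases hn : n < positionBound h p
  · refine (key n hn).trans ?_
    have h1 : ((CuntzPoly.normApprox (numGen n) d (2 ^ a) (polyComponent h n p)).toRat : ℝ) ≤
        (normPowApprox h p a).toRat := by
      rw [toRat_normPowApprox]
      exact List.single_le_sum hnn _ (List.mem_map.2 ⟨n, List.mem_range.2 hn, rfl⟩)
    have h2 : (4 * d * 2 ^ a + 1) ^ 2 ^ a ≤ normPowError h p a := by
      rw [normPowError, normBound, Nat.mul_assoc (_ ^ _)]
      exact Nat.le_mul_of_pos_right _ (Nat.mul_pos (Nat.mul_pos two_pos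
        (Nat.pow_pos (Nat.succ_pos _))) (Nat.succ_pos _))
    have h3 : ((4 * d * 2 ^ a + 1) ^ 2 ^ a : ℝ) ≤ normPowError h p a := by exact_mod_cast h2
    exact mul_le_mul h3 h1 (hpos n hn) (Nat.cast_nonneg _)
  · rw [evalPoly_eq_zero (not_lt.1 hn), norm_zero, zero_pow (by positivity)]
    positivity

section Algorithm

variable {α : Type*} [Primcodable α]

@[fun_prop] theorem primrec_normPowApprox {h : α → List ℕ} {p : α → RatStarPoly} {n : α → ℕ}
    (hh : Primrec h) (hp : Primrec p) (hn : Primrec n) :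
    Primrec fun a => normPowApprox (h a) (p a) (n a) := by
  unfold normPowApprox degreeBound CuntzPoly.lengthBound positionBound
  fun_prop

@[fun_prop] theorem primrec_normPowError {h : α → List ℕ} {p : α → RatStarPoly} {n : α → ℕ}
    (hh : Primrec h) (hp : Primrec p) (hn : Primrec n) :
    Primrec fun a => normPowError (h a) (p a) (n a) := by
  unfold normPowError normBound genBound degreeBound CuntzPoly.lengthBound positionBound
  fun_prop

@[fun_prop] theorem primrec_approxTest {B E : α → ℕ} {L ε q : α → RatCode} (hB : Primrec B)
    (hL : Primrec L) (hE : Primrec E) (hε : Primrec ε) (hq : Primrec q) :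
    Primrec fun a => approxTest (B a) (L a) (E a) (ε a) (q a) := by
  unfold approxTest
  fun_prop

end Algorithm

/-- The code of `2⁻ᵏ`. -/
def precision (k : ℕ) : RatCode := (1, 0, 2 ^ k - 1)

theorem toRat_precision (k : ℕ) : ((precision k).toRat : ℝ) = ((2 : ℝ) ^ k)⁻¹ := by
  simp [precision, RatCode.toRat, Nat.cast_sub (Nat.one_le_two_pow (n := k))]

/-- The test for the search of an approximation to the norm. -/
def searchTest (h : List ℕ) (p : RatStarPoly) (k a : ℕ) (q : RatCode) : Bool :=
  approxTest (normPowError h p a) (normPowApprox h p a) (4 * (2 ^ a) ^ 2) (precision k) q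

theorem computable_history {e : ℕ → ℕ} (he : Computable e) : Computable (history e) :=
  (Computable.nat_rec (f := fun t : ℕ => t) (g := fun _ => ([] : List ℕ))
    (h := fun _ s => e s.1 :: s.2) Computable.id (Computable.const _)
    (Computable.list_cons.comp (he.comp (Computable.fst.comp Computable.snd))
      (Computable.snd.comp Computable.snd))).of_eq fun _ => rfl

theorem exists_algorithm {e : ℕ → ℕ} (he : Computable e) {ν : RatStarPoly → ℝ}
    (hν : ∀ p, 0 ≤ ν p) (hν2 : ∀ p t, BornBy p t → ∀ c : ℝ, 0 ≤ c →
      (ν p ≤ c ↔ ∀ n, ‖evalPoly (pointValue (history e t) n) p‖ ≤ c)) :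
    ∃ f : RatStarPoly × ℕ → RatCode, Computable f ∧
      ∀ p k, |ν p - ((f (p, k)).toRat : ℝ)| < ((2 : ℝ) ^ k)⁻¹ := by
  let H : RatStarPoly → List ℕ := fun p => history e (bornStage p)
  have hH : Computable H := (computable_history he).comp (Primrec.to_comp (by
    unfold bornStage birth; fun_prop))
  have h1 : ∀ p a, ν p ^ (4 * (2 ^ a) ^ 2) ≤
      normPowError (H p) p a * (normPowApprox (H p) p a).toRat := by
    intro p a
    set E := 4 * (2 ^ a) ^ 2 with hE
    have hE0 : E ≠ 0 := by positivity
    set y : ℝ := normPowError (H p) p a * (normPowApprox (H p) p a).toRat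
    have hy : 0 ≤ y := (pow_nonneg (norm_nonneg _) _).trans (le_normPowApprox (H p) p 0 a)
    have : ν p ≤ y ^ ((E : ℝ)⁻¹) := by
      refine (hν2 p _ (bornBy_bornStage p) _ (Real.rpow_nonneg hy _)).2 fun n => ?_
      refine le_of_pow_le_pow_left₀ hE0 (Real.rpow_nonneg hy _) ?_
      rw [Real.rpow_inv_natCast_pow hy hE0]
      exact le_normPowApprox _ p n a
    calc ν p ^ E ≤ (y ^ ((E : ℝ)⁻¹)) ^ E := pow_le_pow_left₀ (hν p) this _
      _ = y := Real.rpow_inv_natCast_pow hy hE0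
  have h2 : ∀ p a, ((normPowApprox (H p) p a).toRat : ℝ) ≤
      normPowError (H p) p a * ν p ^ (4 * (2 ^ a) ^ 2) := fun p a =>
    normPowApprox_le ((hν2 p _ (bornBy_bornStage p) _ (hν p)).1 le_rfl) a
  have hex : ∀ y : RatStarPoly × ℕ, ∃ m : ℕ, searchTest (H y.1) y.1 y.2 m.unpair.1
      (Denumerable.ofNat RatCode m.unpair.2) = true := by
    intro y
    obtain ⟨a, q, hq⟩ := exists_approxTest (B := normPowError (H y.1) y.1)
      (E := fun a => 4 * (2 ^ a) ^ 2) (L := normPowApprox (H y.1) y.1) (ε := precision y.2)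
      (hν y.1) (by rw [toRat_precision]; positivity) (fun a => by positivity) (h1 y.1) (h2 y.1)
      fun c hc => exists_normBound_sq_lt _ _ _ hc
    refine ⟨Nat.pair a (Encodable.encode q), ?_⟩
    rw [Nat.unpair_pair, Denumerable.ofNat_encode]
    exact hq
  have htest : Primrec fun z : (List ℕ × RatStarPoly × ℕ) × ℕ =>
      searchTest z.1.1 z.1.2.1 z.1.2.2 z.2.unpair.1
        (Denumerable.ofNat RatCode z.2.unpair.2) := by
    have := Primrec.ofNat RatCode
    unfold searchTest precision
    fun_prop
  have hcomp : ComputablePred fun z : (RatStarPoly × ℕ) × ℕ =>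
      searchTest (H z.1.1) z.1.1 z.1.2 z.2.unpair.1
        (Denumerable.ofNat RatCode z.2.unpair.2) = true := by
    refine Computable.computablePred ?_
    have hz : Computable fun z : (RatStarPoly × ℕ) × ℕ => ((H z.1.1, z.1.1, z.1.2), z.2) :=
      ((hH.comp (Computable.fst.comp Computable.fst)).pair Computable.fst).pair Computable.snd
    exact (htest.to_comp.comp hz).of_eq fun z => by simp
  have hfind := Computable.find hcomp hex
  refine ⟨fun y => Denumerable.ofNat RatCode (Nat.find (hex y)).unpair.2,
    (Computable.ofNat RatCode).comp (Computable.snd.comp (Computable.unpair.comp hfind)),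
    fun p k => ?_⟩
  rw [← toRat_precision k]
  exact abs_sub_lt_of_approxTest (hν p) (by rw [toRat_precision]; positivity) (h1 p _) (h2 p _)
    (Nat.find_spec (hex (p, k)))

/-! ## Enumerations -/

theorem exists_computable_enumeration {R : Set ℕ} (hR : REPred fun n => n ∈ R)
    (hne : R.Nonempty) : ∃ e : ℕ → ℕ, Computable e ∧ ∀ n, n ∈ R ↔ ∃ s, e s = n := by
  obtain ⟨r, hr⟩ := hne
  obtain ⟨c, hc⟩ := Nat.Partrec.Code.exists_code.1
    (Partrec.nat_iff.1 (hR.map (Computable.const 0).to₂))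
  have hmem : ∀ n, n ∈ R ↔ ∃ x, x ∈ Nat.Partrec.Code.eval c n := fun n => by
    rw [hc]
    simp
  have hev := Nat.Partrec.Code.primrec_evaln
  have hsome : Primrec (Option.isSome : Option ℕ → Bool) := Primrec.option_isSome
  refine ⟨fun s => if (Nat.Partrec.Code.evaln s.unpair.1 c s.unpair.2).isSome = true
    then s.unpair.2 else r, Primrec.to_comp ?_, fun n => ⟨fun hn => ?_, ?_⟩⟩
  · have : Primrec fun s : ℕ => (Nat.Partrec.Code.evaln s.unpair.1 c s.unpair.2).isSome :=
      hsome.comp (hev.comp (f := fun a : (ℕ × Nat.Partrec.Code) × ℕ =>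
        Nat.Partrec.Code.evaln a.1.1 a.1.2 a.2) (g := fun s : ℕ => ((s.unpair.1, c), s.unpair.2))
        (by fun_prop))
    fun_prop
  · obtain ⟨x, hx⟩ := (hmem n).1 hn
    obtain ⟨k, hk⟩ := Nat.Partrec.Code.evaln_complete.1 hx
    refine ⟨Nat.pair k n, ?_⟩
    simp [Option.isSome_of_mem hk]
  · rintro ⟨s, rfl⟩
    dsimp only
    split_ifs with h
    · obtain ⟨x, hx⟩ := Option.isSome_iff_exists.1 h
      exact (hmem _).2 ⟨x, Nat.Partrec.Code.evaln_sound hx⟩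
    · exact hr

theorem exists_notMem_ge {R : Set ℕ} (hR : ¬ComputablePred fun n => n ∈ R) (n : ℕ) :
    ∃ M ≥ n, M ∉ R := by
  classical
  by_contra! h
  have h1 : Primrec fun M => !(decide (M < n) &&
      decide (M ∉ (List.range n).filter fun m => decide (m ∈ R))) := by fun_prop
  refine hR ⟨inferInstance, h1.to_comp.of_eq fun M => ?_⟩
  by_cases hM : M < n
  · simp [hM]
  · simp [hM, h M (not_lt.1 hM)]

end CompCStar

end

theorem mainTheorem6 (R : Set ℕ) (hRce : REPred (fun n => n ∈ R))
    (hRnc : ¬ ComputablePred (fun n => n ∈ R)) :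
    ∃ P : CompCStar.Presentation (CompCStar.directSum fun n => CompCStar.summand R n),
      P.IsComputable := by
  have hne : R.Nonempty := by
    rw [Set.nonempty_iff_ne_empty]
    rintro rfl
    exact hRnc ⟨fun _ => .isFalse id, (Computable.const false).of_eq fun _ => rfl⟩
  obtain ⟨e, hec, he⟩ := CompCStar.exists_computable_enumeration hRce hne
  obtain ⟨P, hP⟩ := CompCStar.exists_points he (CompCStar.exists_notMem_ge hRnc)
  exact ⟨P, CompCStar.exists_algorithm hec (fun _ => norm_nonneg _) hP⟩
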